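/- Let $N\ge 0$ be an integer and let $q,c_0,\dots,c_4\in\mathbb C$ be nonzero with $q^{2N+3}c_0c_1c_2c_3c_4=1$. Assume the parameters are generic in the following sense (indices modulo $5$): $q,q^2,\dots,q^N\ne 1$; $\;c_kc_{k+1}\notin\{q^{-2},q^{-3},\dots,q^{-2N}\}$ and $c_k\notin\{q^{-1},\dots,q^{-N}\}$ for $k=0,\dots,4$. Fix square roots $q^{1/2},c_0^{1/2},\dots,c_4^{1/2}$ such that $(q^{1/2})^{2N+3}c_0^{1/2}c_1^{1/2}c_2^{1/2}c_3^{1/2}c_4^{1/2}=1$ (such a choice always exists); all half-integer powers below are formed from these, i.e. $(c_k/c_l)^{n/2}=(c_k^{1/2}/c_l^{1/2})^n$ and $(qc_k)^{n/2}=(q^{1/2}c_k^{1/2})^n$. Write $(a;q)_n=\prod_{l=0}^{n-1}(1-aq^l)$, $\left[{M\atop n}\right]_q=\frac{(q;q)_M}{(q;q)_n(q;q)_{M-n}}$, and, for $d_1,d_2,d_3$ each one of $c_0,\dots,c_4$ and $0\le n,x\le M\le N$ (in all instances used below the denominators are nonzero), $$p_n(x;d_1,d_2,d_3;M)=\Omega(n;d_1,d_2,d_3;M)\;{}_4\phi_3\!\left({q^{-n},\,d_2d_3q^{n+1},\,q^{-x},\,d_1d_2q^{x+1}\atop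 qd_2,\,d_1d_2d_3q^{M+2},\,q^{-M}};q;q\right),$$ $$\Omega(n;d_1,d_2,d_3;M)=\left[{M\atop n}\right]_q\frac{(1-d_2d_3q^{2n+1})(qd_2;q)_n(d_1d_2d_3q^{M+2};q)_n(qd_1;q)_{M-n}}{(qd_2)^{n-M/2}(d_2d_3q^{n+1};q)_{M+1}(qd_3;q)_n},$$ where the ${}_4\phi_3$ is the terminating series $\sum_{k=0}^n\frac{(q^{-n},\,d_2d_3q^{n+1},\,q^{-x},\,d_1d_2q^{x+1};q)_k}{(qd_2,\,d_1d_2d_3q^{M+2},\,q^{-M};q)_k}\frac{q^k}{(q;q)_k}$ (a comma-separated list in $(\cdots;q)_k$ denotes a product), and where the factor $1-d_2d_3q^{2n+1}$ is cancelled against the equal factor of $(d_2d_3q^{n+1};q)_{M+1}$. Set $p_n(x;d_1,d_2,d_3;M)=0$ if $n>M$ or $x>M$. Put $$\xi_n(d_1,d_2)=\frac{(qd_1;q)_n}{(qd_2;q)_n}\Big(\frac{d_2}{d_1}\Big)^{n/2}.$$ For a permutation $(d_0,\dots,d_4)$ of $(c_0,\dots,c_4)$, so that $q^{2N+3}d_0d_1d_2d_3d_4=1$,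 the Tratnik polynomial of $q$-Racah type is $\mathcal T_{i,j}(x,y;d_1,d_2,d_3,d_4;N)=p_i(x;d_1,d_2,d_3;N-j)\,p_j(y;d_3,d_0,d_4;N-x)$, the parameter $d_0$ (and its square root) being determined by $d_1,\dots,d_4$ and the constraint. Then, for all nonnegative integers $i,j,x,y$ with $i+j\le N$ and $x+y\le N$, $$\sum_{a=0}^{\min(N-j,N-y)}p_i(a;c_3,c_2,c_1;N-j)\,p_j(y;c_1,c_0,c_4;N-a)\,p_a(x;c_4,c_3,c_2;N-y)$$ $$\qquad\times\Big(\frac{c_0}{c_3}\Big)^{i/2}\Big(\frac{c_3}{c_1}\Big)^{j/2}\Big(\frac{c_1}{c_4}\Big)^{a/2}\Big(\frac{c_4}{c_2}\Big)^{y/2}\Big(\frac{c_2}{c_0}\Big)^{x/2}\xi_i(c_1,c_2)\,\xi_j(c_4,c_0)\,\xi_a(c_2,c_3)\,\xi_y(c_0,c_1)\,\xi_x(c_3,c_4)$$ $$=p_j(x;c_3,c_4,c_0;N-i)\,p_i(y;c_0,c_1,c_2;N-x)=\mathcal T_{j,i}(x,y;c_3,c_4,c_0,c_2;N).$$ -/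

import Mathlib

noncomputable section

namespace QRacah

/-- The `q`-Pochhammer symbol `(a;q)_n`. -/
def qPoch (q a : ℂ) (n : ℕ) : ℂ := ∏ l ∈ Finset.range n, (1 - a * q ^ l)

/-- The `q`-binomial coefficient, which vanishes for `n > N`. -/
def qBinom (q : ℂ) (N n : ℕ) : ℂ :=
  if n ≤ N then qPoch q q N / (qPoch q q n * qPoch q q (N - n)) else 0

/-- The terminating basic hypergeometric series
`₄φ₃(q^{-n}, a₂, a₃, a₄; d₁, d₂, d₃; q; q)`, a sum over `0 ≤ k ≤ n`. -/
def phi43 (q : ℂ) (n : ℕ) (a₂ a₃ a₄ d₁ d₂ d₃ : ℂ) : ℂ :=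
  ∑ k ∈ Finset.range (n + 1),
    (qPoch q (q ^ (-(n : ℤ))) k * qPoch q a₂ k * qPoch q a₃ k * qPoch q a₄ k) /
      (qPoch q d₁ k * qPoch q d₂ k * qPoch q d₃ k) * (q ^ k / qPoch q q k)

/-- The ratio `(1 - c q^{2n+1}) / (c q^{n+1};q)_{N+1}`, for `n ≤ N`, after cancellation of the
factor `1 - c q^{2n+1}`, which occurs in the denominator (as the factor of index `n`). -/
def cancelledRatio (q c : ℂ) (n N : ℕ) : ℂ :=
  (∏ l ∈ (Finset.range (N + 1)).erase n, (1 - c * q ^ (n + 1 + l)))⁻¹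

theorem cancelledRatio_eq (q c : ℂ) (n N : ℕ) (hn : n ≤ N) (h : 1 - c * q ^ (2 * n + 1) ≠ 0) :
    cancelledRatio q c n N = (1 - c * q ^ (2 * n + 1)) / qPoch q (c * q ^ (n + 1)) (N + 1) := by
  have hmem : n ∈ Finset.range (N + 1) := Finset.mem_range.2 (by omega)
  have e : qPoch q (c * q ^ (n + 1)) (N + 1) = (1 - c * q ^ (2 * n + 1)) *
      ∏ l ∈ (Finset.range (N + 1)).erase n, (1 - c * q ^ (n + 1 + l)) := by
    unfold qPoch
    rw [← Finset.mul_prod_erase _ _ hmem]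
    congr 1
    · ring
    · refine Finset.prod_congr rfl fun l _ => ?_
      ring
  rw [cancelledRatio, e, div_mul_eq_div_div, div_self h, one_div]

/-! In the functions below the parameters enter through square roots: `q = s²`, `c₁ = b₁²`,
`c₂ = b₂²`, …, so that `s`, `b₂ / b₁` and `s b₂` are the values of `q^{1/2}`, `(c₂/c₁)^{1/2}` and
`(q c₂)^{1/2}` used in the half-integer powers. -/

/-- The normalization `Ω(n;c₁,c₂,c₃;N)`:
`[N,n]_q (1-c₂c₃q^{2n+1}) (qc₂;q)_n (c₁c₂c₃q^{N+2};q)_n (qc₁;q)_{N-n}` divided by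
`(qc₂)^{n-N/2} (c₂c₃q^{n+1};q)_{N+1} (qc₃;q)_n`. -/
def Omega (s : ℂ) (n : ℕ) (b₁ b₂ b₃ : ℂ) (N : ℕ) : ℂ :=
  qBinom (s ^ 2) N n * cancelledRatio (s ^ 2) (b₂ ^ 2 * b₃ ^ 2) n N *
    (qPoch (s ^ 2) (s ^ 2 * b₂ ^ 2) n *
      qPoch (s ^ 2) (b₁ ^ 2 * b₂ ^ 2 * b₃ ^ 2 * (s ^ 2) ^ (N + 2)) n *
      qPoch (s ^ 2) (s ^ 2 * b₁ ^ 2) (N - n)) /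
    ((s * b₂) ^ (2 * (n : ℤ) - (N : ℤ)) * qPoch (s ^ 2) (s ^ 2 * b₃ ^ 2) n)

/-- The normalized `q`-Racah polynomial `p_n(x;c₁,c₂,c₃;N)`, with the convention that it vanishes
for `n > N` or `x > N`. -/
def qRacah (s : ℂ) (n x : ℕ) (b₁ b₂ b₃ : ℂ) (N : ℕ) : ℂ :=
  if n ≤ N ∧ x ≤ N then
    Omega s n b₁ b₂ b₃ N *
      phi43 (s ^ 2) n (b₂ ^ 2 * b₃ ^ 2 * (s ^ 2) ^ (n + 1)) ((s ^ 2) ^ (-(x : ℤ)))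
        (b₁ ^ 2 * b₂ ^ 2 * (s ^ 2) ^ (x + 1))
        (s ^ 2 * b₂ ^ 2) (b₁ ^ 2 * b₂ ^ 2 * b₃ ^ 2 * (s ^ 2) ^ (N + 2)) ((s ^ 2) ^ (-(N : ℤ)))
  else 0

/-- `ξ_n(c₁,c₂) = (qc₁;q)_n / (qc₂;q)_n * (c₂/c₁)^{n/2}`. -/
def xi (s : ℂ) (n : ℕ) (b₁ b₂ : ℂ) : ℂ :=
  qPoch (s ^ 2) (s ^ 2 * b₁ ^ 2) n / qPoch (s ^ 2) (s ^ 2 * b₂ ^ 2) n * (b₂ / b₁) ^ n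

/-- The bivariate Tratnik polynomial of `q`-Racah type `T_{i,j}(x,y;c₁,c₂,c₃,c₄;N)`, equal to
`p_i(x;c₁,c₂,c₃;N-j) p_j(y;c₃,c₀,c₄;N-x)` with `c₀` fixed by `q^{2N+3} c₀c₁c₂c₃c₄ = 1`. -/
def tratnik (s : ℂ) (i j x y : ℕ) (b₁ b₂ b₃ b₄ : ℂ) (N : ℕ) : ℂ :=
  qRacah s i x b₁ b₂ b₃ (N - j) *
    qRacah s j y b₃ (s ^ (2 * N + 3) * b₁ * b₂ * b₃ * b₄)⁻¹ b₄ (N - x)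

end QRacah

end

/-! Write the left side as `∑ₐ Pᵢ(a) Qⱼ(y) Rₐ(x) w(a)` with `P = p_i(a;c₃,c₂,c₁;N-j)`, `Q =
p_j(y;c₁,c₀,c₄;N-a)`, `R = p_a(x;c₄,c₃,c₂;N-y)` and a weight `w`. Both sides satisfy the same
recurrences, each of which lowers `N` by one and multiplies two cyclically adjacent parameters by
`q`; this preserves `q^{2N+3} c₀c₁c₂c₃c₄ = 1`. The identity is therefore proved by induction on `N`
(`pentagonAt`), first for parameters so generic that no factor `1 - c q^m`, `m ∈ ℤ`, vanishes, and
then extended by continuity.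

If `j > 0`, a contiguous relation lowers the degree of `Q`. Its coefficients depend on `a`, but the
constraint turns them into exactly the coefficients of two relations replacing `c₄` by `q c₄` in
`R`. The remaining dependence on `a` is a power absorbed by the weight, so the convolution becomes a
combination of four convolutions, at `x` or `x - 1` and `y` or `y - 1`. The right side is a product
of the same shape for the reflected parameters, so the same lemma (`qRacah_succ_mul_qRacah`) gives
it the same recurrence.

If `j = 0` and `x > 0`, then `Q` is an explicit product and `Rₐ(x)` is a difference in `a` of
polynomials at `x - 1`. Summation by parts moves the difference onto `P Q w`, where
`qRacah_raise_b₁` collapses it to a single term. If `j = x = 0` and `i > 0`, both `Q` and `R` are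
products; lowering the degree of `P` and shifting the index reduces the recurrence to a rational
identity for each `a`. If `i = j = x = 0`, the sum is a terminating very-well-poised `₆φ₅`,
evaluated in `sum_wpTerm`.

Finally, `s` and the `b_k` are moved along real exponentials respecting the constraint. Only
countably many times are non-generic, and both sides are continuous at time zero under the
hypotheses of the theorem, so equality passes to the limit. -/

namespace QRacah

/-! ### The `q`-Pochhammer symbol and its nonvanishing. -/

theorem qPoch_zero (q a : ℂ) : qPoch q a 0 = 1 := by simp [qPoch]

theorem qPoch_succ (q a : ℂ) (n : ℕ) : qPoch q a (n + 1) = qPoch q a n * (1 - a * q ^ n) := by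
  simp [qPoch, Finset.prod_range_succ]

theorem qPoch_succ' (q a : ℂ) (n : ℕ) : qPoch q a (n + 1) = (1 - a) * qPoch q (a * q) n := by
  rw [qPoch, Finset.prod_range_succ', qPoch, mul_comm]
  congr 1
  · simp
  · exact Finset.prod_congr rfl fun l _ => by ring

theorem qPoch_shift (q a : ℂ) (n : ℕ) :
    (1 - a) * qPoch q (a * q) n = qPoch q a n * (1 - a * q ^ n) := by
  rw [← qPoch_succ', qPoch_succ]

theorem qPoch_add (q a : ℂ) (m n : ℕ) :
    qPoch q a (m + n) = qPoch q a m * qPoch q (a * q ^ m) n := by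
  induction n with
  | zero => simp [qPoch_zero]
  | succ n ih => rw [← add_assoc, qPoch_succ, ih, qPoch_succ]; ring

/-- No integral power of `q` is an inverse of `a`. -/
def Avoids (q a : ℂ) : Prop := ∀ m : ℤ, 1 - a * q ^ m ≠ 0

theorem Avoids.pow {q a : ℂ} (h : Avoids q a) (n : ℕ) : 1 - a * q ^ n ≠ 0 := by
  simpa using h n

theorem Avoids.mul_zpow {q a : ℂ} (h : Avoids q a) (hq : q ≠ 0) (n : ℤ) :
    Avoids q (a * q ^ n) := fun m => by
  rw [mul_assoc, ← zpow_add₀ hq]; exact h _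

theorem Avoids.mul_pow {q a : ℂ} (h : Avoids q a) (hq : q ≠ 0) (n : ℕ) :
    Avoids q (a * q ^ n) := by
  simpa using h.mul_zpow hq n

theorem Avoids.mul_self {q a : ℂ} (h : Avoids q a) (hq : q ≠ 0) : Avoids q (a * q) := by
  simpa using h.mul_pow hq 1

theorem Avoids.self_mul {q a : ℂ} (h : Avoids q a) (hq : q ≠ 0) : Avoids q (q * a) := by
  rw [mul_comm]; exact h.mul_self hq

theorem Avoids.inv {q a : ℂ} (h : Avoids q a) (hq : q ≠ 0) (ha : a ≠ 0) : Avoids q a⁻¹ := by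
  intro m hm
  apply h (-m)
  have hz : q ^ m ≠ 0 := zpow_ne_zero _ hq
  rw [zpow_neg]
  field_simp at hm ⊢
  linear_combination -hm

theorem Avoids.one_sub {q a : ℂ} (h : Avoids q a) : 1 - a ≠ 0 := by simpa using h 0

theorem Avoids.qPoch_ne {q a : ℂ} (h : Avoids q a) (n : ℕ) : qPoch q a n ≠ 0 :=
  Finset.prod_ne_zero_iff.2 fun _ _ => h.pow _

theorem qPoch_self_ne {q : ℂ} (hr : ∀ m : ℕ, 1 - q ^ (m + 1) ≠ 0) (n : ℕ) : qPoch q q n ≠ 0 :=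
  Finset.prod_ne_zero_iff.2 fun _ _ => by rw [← pow_succ']; exact hr _

theorem one_sub_inv_pow_mul_pow_ne {q : ℂ} (hq : q ≠ 0) (hr : ∀ m : ℕ, 1 - q ^ (m + 1) ≠ 0)
    {M k : ℕ} (h : k < M) : 1 - (q ^ M)⁻¹ * q ^ k ≠ 0 := by
  obtain ⟨r, rfl⟩ := Nat.exists_eq_add_of_lt h
  have hk : q ^ k ≠ 0 := pow_ne_zero _ hq
  have hk' : q ^ (r + 1) ≠ 0 := pow_ne_zero _ hq
  have := hr r
  rw [add_assoc, pow_add]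
  intro h0
  field_simp at h0
  apply this
  linear_combination -h0

theorem qPoch_inv_pow_ne {q : ℂ} (hq : q ≠ 0) (hr : ∀ m : ℕ, 1 - q ^ (m + 1) ≠ 0)
    {M k : ℕ} (h : k ≤ M) : qPoch q (q ^ M)⁻¹ k ≠ 0 :=
  Finset.prod_ne_zero_iff.2 fun _ hl =>
    one_sub_inv_pow_mul_pow_ne hq hr ((Finset.mem_range.1 hl).trans_le h)

theorem qPoch_inv_pow_eq_zero {q : ℂ} (hq : q ≠ 0) {M k : ℕ} (h : M < k) :
    qPoch q (q ^ M)⁻¹ k = 0 :=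
  Finset.prod_eq_zero (Finset.mem_range.2 h) (by
    rw [inv_mul_cancel₀ (pow_ne_zero _ hq), sub_self])

/-! ### Contiguous relations for the `₄φ₃` series. -/

/-- The `₄φ₃` of the `q`-Racah polynomial, with `z` in place of `q ^ x`. -/
noncomputable def racahPhi (q : ℂ) (n : ℕ) (z d₁ d₂ d₃ : ℂ) (M : ℕ) : ℂ :=
  phi43 q n (d₂ * d₃ * q ^ (n + 1)) z⁻¹ (d₁ * d₂ * (z * q)) (q * d₂)
    (d₁ * d₂ * d₃ * q ^ (M + 2)) (q ^ M)⁻¹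

/-- Since `(q^{-n};q)_k` vanishes for `k > n` and `(q^{-x};q)_k` for `k > x`, both series may be
summed over a common longer range, where the summand is visibly symmetric. This is the duality
between degree and variable. -/
theorem phi43_swap {q : ℂ} (hq : q ≠ 0) (n x : ℕ) (A B D E G : ℂ) :
    phi43 q n A (q ^ x)⁻¹ B D E G = phi43 q x B (q ^ n)⁻¹ A D E G := by
  have key : ∀ (n x : ℕ) (A B : ℂ), phi43 q n A (q ^ x)⁻¹ B D E G =
      ∑ k ∈ Finset.range (n + x + 1),
    (qPoch q (q ^ n)⁻¹ k * qPoch q A k * qPoch q (q ^ x)⁻¹ k * qPoch q B k) /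
      (qPoch q D k * qPoch q E k * qPoch q G k) * (q ^ k / qPoch q q k) := by
    intro n x A B
    simp only [phi43, zpow_neg, zpow_natCast]
    refine Finset.sum_subset (Finset.range_subset_range.2 (by omega)) fun k _ hk => ?_
    rw [qPoch_inv_pow_eq_zero hq (by simpa using hk)]
    simp
  rw [key, key, add_comm n x]
  exact Finset.sum_congr rfl fun k _ => by ring

theorem racahPhi_swap {q : ℂ} (hq : q ≠ 0) (n x : ℕ) (d₁ d₂ d₃ : ℂ) (M : ℕ) :
    racahPhi q n (q ^ x) d₁ d₂ d₃ M = racahPhi q x (q ^ n) d₃ d₂ d₁ M := by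
  rw [racahPhi, racahPhi, phi43_swap hq]
  congr 1 <;> ring

theorem racahPhi_zero (q z d₁ d₂ d₃ : ℂ) (M : ℕ) : racahPhi q 0 z d₁ d₂ d₃ M = 1 := by
  simp [racahPhi, phi43, qPoch_zero]

/-- Holds term by term: raising `d₁` while lowering `M + 1` leaves `d₁d₂d₃q^{M+3}` unchanged, so
only the two Pochhammer symbols in `z` and the one with base parameter `q^{-M-1}` move. At `z =
q^x`, the argument `z / q` means `x - 1`. -/
theorem racahPhi_lower_d₁_M {q z d₁ d₂ d₃ : ℂ} (hq : q ≠ 0) (hz : z ≠ 0)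
    (hr : ∀ m : ℕ, 1 - q ^ (m + 1) ≠ 0) {n M : ℕ} (hn : n ≤ M) :
    (1 - q ^ (M + 1)) * (1 - d₁ * d₂ * q * z ^ 2) * racahPhi q n z d₁ d₂ d₃ (M + 1) =
      (z - q ^ (M + 1)) * (1 - d₁ * d₂ * q * z) * racahPhi q n z (q * d₁) d₂ d₃ M +
      (1 - z) * (1 - d₁ * d₂ * q ^ (M + 2) * z) * racahPhi q n (z / q) (q * d₁) d₂ d₃ M := by
  simp only [racahPhi, phi43, Finset.mul_sum, ← Finset.sum_add_distrib]
  refine Finset.sum_congr rfl fun k hk => ?_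
  have hk' : k < M + 1 := (Finset.mem_range.1 hk).trans_le (by omega)
  have h1 := qPoch_shift q z⁻¹ k
  have h2 := qPoch_shift q (d₁ * d₂ * (z * q)) k
  have h3 := qPoch_shift q (q ^ (M + 1))⁻¹ k
  have h4 := one_sub_inv_pow_mul_pow_ne hq hr hk'
  have h5 := qPoch_inv_pow_ne hq hr hk'.le
  have h6 := hr M
  rw [show (q ^ (M + 1))⁻¹ * q = (q ^ M)⁻¹ by rw [pow_succ]; field_simp] at h3
  rw [show q * d₁ * d₂ * (z * q) = d₁ * d₂ * (z * q) * q by ring,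
    show q * d₁ * d₂ * (z / q * q) = d₁ * d₂ * (z * q) by field_simp,
    show (z / q)⁻¹ = z⁻¹ * q by field_simp,
    show q * d₁ * d₂ * d₃ * q ^ (M + 2) = d₁ * d₂ * d₃ * q ^ (M + 1 + 2) by ring]
  have h5' := qPoch_inv_pow_ne hq hr (Nat.lt_succ_iff.1 hk')
  set X := qPoch q (d₁ * d₂ * d₃ * q ^ (M + 1 + 2)) k
  set D := qPoch q (q * d₂) k
  set U := qPoch q (q ^ (-(n : ℤ))) k
  set U' := qPoch q (d₂ * d₃ * q ^ (n + 1)) k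
  set D4 := qPoch q q k
  set V1 := qPoch q z⁻¹ k
  set V1' := qPoch q (z⁻¹ * q) k
  set V2 := qPoch q (d₁ * d₂ * (z * q)) k
  set V2' := qPoch q (d₁ * d₂ * (z * q) * q) k
  set D3 := qPoch q (q ^ (M + 1))⁻¹ k
  set D3' := qPoch q (q ^ M)⁻¹ k
  have hE : q ^ M ≠ 0 := pow_ne_zero _ hq
  rw [pow_succ] at h3 h4 h6
  simp only [pow_succ _ M, pow_add _ M 2]
  set E := q ^ M
  set Q := q ^ k
  have h1' : (1 - z) * V1' = V1 * (Q - z) := by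
    field_simp at h1
    linear_combination -h1
  have h3' : (E * q - 1) * D3' = D3 * (E * q - Q) := by
    field_simp at h3
    linear_combination h3
  have h4' : E * q - Q ≠ 0 := by
    intro h; apply h4; field_simp; linear_combination h
  have e3 : D3⁻¹ * (E * q - 1) = D3'⁻¹ * (E * q - Q) := by
    field_simp
    linear_combination h3'
  have e : (1 - E * q) * (1 - d₁ * d₂ * q * z ^ 2) * (V1 * V2 * D3⁻¹) =
     (z - E * q) * (1 - d₁ * d₂ * q * z) * (V1 * V2' * D3'⁻¹) +
     (1 - z) * (1 - d₁ * d₂ * (E * q ^ 2) * z) * (V1' * V2 * D3'⁻¹) := by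
    linear_combination (-(1 - d₁ * d₂ * q * z ^ 2) * (V1 * V2)) * e3 -
      (z - E * q) * (V1 * D3'⁻¹) * h2 - (1 - d₁ * d₂ * (E * q ^ 2) * z) * (V2 * D3'⁻¹) * h1'
  simp only [div_eq_mul_inv, mul_inv]
  linear_combination (U * U' * D⁻¹ * X⁻¹ * (Q * D4⁻¹)) * e

/-- Again term by term; here `q^{-M}` is fixed and the denominator `d₁d₂d₃q^{M+2}` moves instead. -/
theorem racahPhi_lower_d₁ {q z d₁ d₂ d₃ : ℂ} (hq : q ≠ 0) (hz : z ≠ 0)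
    (he : Avoids q (d₁ * d₂ * d₃)) (n M : ℕ) :
    (1 - d₁ * d₂ * d₃ * q ^ (M + 2)) * (1 - d₁ * d₂ * q * z ^ 2) * racahPhi q n z d₁ d₂ d₃ M =
      (1 - d₁ * d₂ * d₃ * q ^ (M + 2) * z) * (1 - d₁ * d₂ * q * z) *
        racahPhi q n z (q * d₁) d₂ d₃ M +
      d₁ * d₂ * q * (1 - z) * (z - d₃ * q ^ (M + 1)) *
        racahPhi q n (z / q) (q * d₁) d₂ d₃ M := by
  simp only [racahPhi, phi43, Finset.mul_sum, ← Finset.sum_add_distrib]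
  refine Finset.sum_congr rfl fun k _ => ?_
  have h1 := qPoch_shift q z⁻¹ k
  have h2 := qPoch_shift q (d₁ * d₂ * (z * q)) k
  have h3 := qPoch_shift q (d₁ * d₂ * d₃ * q ^ (M + 2)) k
  have h4 := (he.mul_pow hq (M + 2)).pow k
  have h5 := (he.mul_pow hq (M + 2)).qPoch_ne k
  have h5' := ((he.mul_pow hq (M + 2)).mul_self hq).qPoch_ne k
  rw [show q * d₁ * d₂ * (z * q) = d₁ * d₂ * (z * q) * q by ring,
    show q * d₁ * d₂ * (z / q * q) = d₁ * d₂ * (z * q) by field_simp,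
    show (z / q)⁻¹ = z⁻¹ * q by field_simp,
    show q * d₁ * d₂ * d₃ * q ^ (M + 2) = d₁ * d₂ * d₃ * q ^ (M + 2) * q by ring]
  set D3 := qPoch q (d₁ * d₂ * d₃ * q ^ (M + 2)) k
  set D3' := qPoch q (d₁ * d₂ * d₃ * q ^ (M + 2) * q) k
  set D := qPoch q (q * d₂) k
  set U := qPoch q (q ^ (-(n : ℤ))) k
  set U' := qPoch q (d₂ * d₃ * q ^ (n + 1)) k
  set D4 := qPoch q q k
  set V1 := qPoch q z⁻¹ k
  set V1' := qPoch q (z⁻¹ * q) k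
  set V2 := qPoch q (d₁ * d₂ * (z * q)) k
  set V2' := qPoch q (d₁ * d₂ * (z * q) * q) k
  set X := qPoch q (q ^ M)⁻¹ k
  simp only [pow_succ _ M, pow_add _ M 2] at h3 h4 ⊢
  set E := q ^ M
  set Q := q ^ k
  have h1' : (1 - z) * V1' = V1 * (Q - z) := by
    field_simp at h1
    linear_combination -h1
  have e3 : D3⁻¹ * (1 - d₁ * d₂ * d₃ * (E * q ^ 2)) =
      D3'⁻¹ * (1 - d₁ * d₂ * d₃ * (E * q ^ 2) * Q) := by
    field_simp
    linear_combination h3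
  have e : (1 - d₁ * d₂ * d₃ * (E * q ^ 2)) * (1 - d₁ * d₂ * q * z ^ 2) * (V1 * V2 * D3⁻¹) =
     (1 - d₁ * d₂ * d₃ * (E * q ^ 2) * z) * (1 - d₁ * d₂ * q * z) * (V1 * V2' * D3'⁻¹) +
     d₁ * d₂ * q * (1 - z) * (z - d₃ * (E * q)) * (V1' * V2 * D3'⁻¹) := by
    linear_combination ((1 - d₁ * d₂ * q * z ^ 2) * (V1 * V2)) * e3 -
      (1 - d₁ * d₂ * d₃ * (E * q ^ 2) * z) * (V1 * D3'⁻¹) * h2 -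
      d₁ * d₂ * q * (z - d₃ * (E * q)) * (V2 * D3'⁻¹) * h1'
  simp only [div_eq_mul_inv, mul_inv]
  linear_combination (U * U' * D⁻¹ * X⁻¹ * (Q * D4⁻¹)) * e

/-- Not a termwise relation: lowering the degree shifts `q^{-n-1}` to `q^{-n}`, so neighbouring
summation indices have to be mixed before the coefficients of the two sides match. -/
theorem racahPhi_succ {q z d₁ d₂ d₃ : ℂ} (hq : q ≠ 0) (hz : z ≠ 0)
    (hr : ∀ m : ℕ, 1 - q ^ (m + 1) ≠ 0) (hd₂ : Avoids q d₂)
    (he : Avoids q (d₁ * d₂ * d₃)) {n M : ℕ} (hn : n ≤ M) :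
    (1 - q ^ (M + 1)) * (1 - q * d₂) * (1 - d₁ * d₂ * d₃ * q ^ (M + 3)) *
        (1 - d₁ * d₂ * q * z ^ 2) * racahPhi q (n + 1) z d₁ d₂ d₃ (M + 1) =
      (1 - q ^ (M + 1) / z) * (1 - d₂ * q * z) * (1 - d₁ * d₂ * d₃ * q ^ (M + 3) * z) *
        (1 - d₁ * d₂ * q * z) * racahPhi q n z d₁ (q * d₂) (q * d₃) M -
      q * d₂ * (1 - d₁ * d₂ * q ^ (M + 2) * z) * (1 - d₁ * z) * (1 - d₃ * q ^ (M + 2) / z) *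
        (1 - z) * racahPhi q n (z / q) d₁ (q * d₂) (q * d₃) M := by
  set K := (1 - q ^ (M + 1)) * (1 - q * d₂) * (1 - d₁ * d₂ * d₃ * q ^ (M + 3)) with hK
  set c := d₁ * d₂ with hcdef
  -- pieces of the summand of the left side
  let U' : ℕ → ℂ := fun k => qPoch q (q ^ n)⁻¹ k * qPoch q (d₂ * d₃ * q ^ (n + 3)) k
  let V : ℕ → ℂ := fun k => qPoch q z⁻¹ k * qPoch q (c * (z * q)) k
  let D : ℕ → ℂ := fun k => (qPoch q (q * d₂) k)⁻¹ * (qPoch q (c * d₃ * q ^ (M + 3)) k)⁻¹ *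
    (qPoch q (q ^ (M + 1))⁻¹ k)⁻¹ * (qPoch q q k)⁻¹
  let D' : ℕ → ℂ := fun k => (qPoch q (q * d₂ * q) k)⁻¹ *
    (qPoch q (c * d₃ * q ^ (M + 3) * q) k)⁻¹ * (qPoch q (q ^ M)⁻¹ k)⁻¹ * (qPoch q q k)⁻¹
  let A : ℕ → ℂ := fun k => K * U' k * V k * D k
  let B : ℕ → ℂ := fun k =>
    q ^ (M + 1) * (1 - d₂ * d₃ * q ^ 2 * q ^ k) * U' k * D' k * V (k + 1)
  have hA : A (n + 1) = 0 := by
    simp only [A, U', qPoch_inv_pow_eq_zero hq (Nat.lt_succ_self n), zero_mul, mul_zero]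
  -- The summand of index `k + 1` splits into `A (k + 1)`, with the original denominators, and `B
  -- k`, with the shifted ones; both carry the degree-`n` numerator `U'`. Regrouping as `A k + B k`
  -- yields the right side.
  have hL : K * racahPhi q (n + 1) z d₁ d₂ d₃ (M + 1) =
      ∑ k ∈ Finset.range (n + 2), A k + ∑ k ∈ Finset.range (n + 1), B k := by
    rw [Finset.sum_range_succ' A, add_right_comm, ← Finset.sum_add_distrib, racahPhi, phi43,
      Finset.mul_sum, Finset.sum_range_succ']
    congr 1
    · refine Finset.sum_congr rfl fun k hk => ?_
      have hkn : k ≤ n := Nat.lt_succ_iff.1 (Finset.mem_range.1 hk)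
      have hkM : k ≤ M := hkn.trans hn
      have hu := qPoch_succ' q (q ^ (n + 1))⁻¹ k
      have hu2 := qPoch_succ q (q ^ n)⁻¹ k
      have hu' := qPoch_succ' q (d₂ * d₃ * q ^ (n + 1 + 1)) k
      have hu2' := qPoch_succ q (d₂ * d₃ * q ^ (n + 3)) k
      have a1 := qPoch_succ' q (q * d₂) k
      have a2 := qPoch_succ' q (c * d₃ * q ^ (M + 3)) k
      have a3 := qPoch_succ' q (q ^ (M + 1))⁻¹ k
      have a4 := qPoch_succ q q k
      have n1 := (hd₂.self_mul hq).one_sub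
      have n2 := (he.mul_pow hq (M + 3)).one_sub
      have n3 := one_sub_inv_pow_mul_pow_ne hq hr (Nat.succ_pos M)
      have n4 := hr k
      rw [show (q ^ (n + 1))⁻¹ * q = (q ^ n)⁻¹ by rw [pow_succ]; field_simp] at hu
      rw [show (q ^ (M + 1))⁻¹ * q = (q ^ M)⁻¹ by rw [pow_succ]; field_simp] at a3
      rw [show d₂ * d₃ * q ^ (n + 1 + 1) * q = d₂ * d₃ * q ^ (n + 3) by ring] at hu'
      simp only [A, B, U', D, D', zpow_neg, zpow_natCast]
      rw [show d₁ * d₂ * (z * q) = c * (z * q) from rfl,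
        show d₁ * d₂ * d₃ * q ^ (M + 1 + 2) = c * d₃ * q ^ (M + 3) from rfl]
      rw [hu, hu2, hu', hu2', a1, a2, a3, a4]
      simp only [div_eq_mul_inv, mul_inv]
      have hq4 : 1 - q * q ^ k ≠ 0 := by rw [← pow_succ']; exact n4
      have hn0 : q ^ n ≠ 0 := pow_ne_zero _ hq
      have hM0 : q ^ M ≠ 0 := pow_ne_zero _ hq
      rw [pow_zero, mul_one] at n3
      set x1 := (qPoch q (q * d₂ * q) k)⁻¹
      set x2 := (qPoch q (c * d₃ * q ^ (M + 3) * q) k)⁻¹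
      set x3 := (qPoch q (q ^ M)⁻¹ k)⁻¹
      set x4 := (qPoch q q k)⁻¹
      set u1 := qPoch q (q ^ n)⁻¹ k
      set u2 := qPoch q (d₂ * d₃ * q ^ (n + 3)) k
      have hV : V (k + 1) = qPoch q z⁻¹ (k + 1) * qPoch q (c * (z * q)) (k + 1) := rfl
      rw [hV]
      set v1 := qPoch q z⁻¹ (k + 1)
      set v2 := qPoch q (c * (z * q)) (k + 1)
      have e : K * ((1 - (q ^ (n + 1))⁻¹) * (1 - d₂ * d₃ * q ^ (n + 1 + 1)) *
          ((1 - q * d₂)⁻¹ * (1 - c * d₃ * q ^ (M + 3))⁻¹ * (1 - (q ^ (M + 1))⁻¹)⁻¹ *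
          (q ^ (k + 1) * (1 - q * q ^ k)⁻¹))) =
          K * ((1 - (q ^ n)⁻¹ * q ^ k) * (1 - d₂ * d₃ * q ^ (n + 3) * q ^ k)) *
          ((1 - q * d₂)⁻¹ * (1 - c * d₃ * q ^ (M + 3))⁻¹ * (1 - (q ^ (M + 1))⁻¹)⁻¹ *
            (1 - q * q ^ k)⁻¹) + q ^ (M + 1) * (1 - d₂ * d₃ * q ^ 2 * q ^ k) := by
        have hK' : K * ((1 - q * d₂)⁻¹ * (1 - c * d₃ * q ^ (M + 3))⁻¹ *
            (1 - (q ^ (M + 1))⁻¹)⁻¹) = - q ^ (M + 1) := by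
          have n5 : (1 - q ^ (M + 1)) * (1 - (q ^ (M + 1))⁻¹)⁻¹ = - q ^ (M + 1) := by
            have hE : q ^ (M + 1) ≠ 0 := pow_ne_zero _ hq
            rw [← div_eq_mul_inv, div_eq_iff n3]
            field_simp
            ring
          rw [hK, ← n5]
          field_simp
        have e2 : ((1 - (q ^ (n + 1))⁻¹) * (1 - d₂ * d₃ * q ^ (n + 1 + 1)) *
            (q ^ (k + 1) * (1 - q * q ^ k)⁻¹)) =
            ((1 - (q ^ n)⁻¹ * q ^ k) * (1 - d₂ * d₃ * q ^ (n + 3) * q ^ k)) *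
              (1 - q * q ^ k)⁻¹ - (1 - d₂ * d₃ * q ^ 2 * q ^ k) := by
          simp only [pow_succ _ n, pow_add _ n, pow_succ _ k]
          field_simp
          ring
        linear_combination (-q ^ (M + 1)) * e2 + ((1 - (q ^ (n + 1))⁻¹) *
          (1 - d₂ * d₃ * q ^ (n + 1 + 1)) * (q ^ (k + 1) * (1 - q * q ^ k)⁻¹) -
          ((1 - (q ^ n)⁻¹ * q ^ k) * (1 - d₂ * d₃ * q ^ (n + 3) * q ^ k)) *
              (1 - q * q ^ k)⁻¹) * hK'
      linear_combination (u1 * u2 * v1 * v2 * x1 * x2 * x3 * x4) * e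
    · simp [A, U', V, D, qPoch_zero]
  rw [mul_right_comm, hL, Finset.sum_range_succ A, hA, add_zero, ← Finset.sum_add_distrib,
    Finset.sum_mul]
  simp only [racahPhi, phi43, Finset.mul_sum, ← Finset.sum_sub_distrib]
  refine Finset.sum_congr rfl fun k hk => ?_
  have hkn : k ≤ n := Nat.lt_succ_iff.1 (Finset.mem_range.1 hk)
  have hkM : k < M + 1 := Nat.lt_succ_iff.2 (hkn.trans hn)
  have h1 := qPoch_shift q z⁻¹ k
  have h2 := qPoch_shift q (c * (z * q)) k
  have b1 := qPoch_shift q (q * d₂) k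
  have b2 := qPoch_shift q (c * d₃ * q ^ (M + 3)) k
  have b3 := qPoch_shift q (q ^ (M + 1))⁻¹ k
  have n1 := (hd₂.self_mul hq).qPoch_ne k
  have n1' := ((hd₂.self_mul hq).mul_self hq).qPoch_ne k
  have n2 := (he.mul_pow hq (M + 3)).qPoch_ne k
  have n2' := ((he.mul_pow hq (M + 3)).mul_self hq).qPoch_ne k
  have n3 := qPoch_inv_pow_ne hq hr hkM.le
  have n3' := qPoch_inv_pow_ne hq hr (Nat.lt_succ_iff.1 hkM)
  rw [show (q ^ (M + 1))⁻¹ * q = (q ^ M)⁻¹ by rw [pow_succ]; field_simp] at b3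
  simp only [A, B, U', D, D', V, zpow_neg, zpow_natCast]
  rw [show d₁ * (q * d₂) * (z * q) = c * (z * q) * q by ring,
    show d₁ * (q * d₂) * (z / q * q) = c * (z * q) by field_simp; ring,
    show (z / q)⁻¹ = z⁻¹ * q by field_simp,
    show d₁ * (q * d₂) * (q * d₃) * q ^ (M + 2) = c * d₃ * q ^ (M + 3) * q by ring,
    show q * (q * d₂) = q * d₂ * q by ring,
    show q * d₂ * (q * d₃) * q ^ (n + 1) = d₂ * d₃ * q ^ (n + 3) by ring,
    qPoch_succ _ z⁻¹, qPoch_succ _ (c * (z * q))]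
  have hM0 : q ^ M ≠ 0 := pow_ne_zero _ hq
  set x4 := qPoch q q k
  set u1 := qPoch q (q ^ n)⁻¹ k
  set u2 := qPoch q (d₂ * d₃ * q ^ (n + 3)) k
  set X1 := qPoch q (q * d₂) k
  set X1' := qPoch q (q * d₂ * q) k
  set X2 := qPoch q (c * d₃ * q ^ (M + 3)) k
  set X2' := qPoch q (c * d₃ * q ^ (M + 3) * q) k
  set X3 := qPoch q (q ^ (M + 1))⁻¹ k
  set X3' := qPoch q (q ^ M)⁻¹ k
  set V1 := qPoch q z⁻¹ k
  set V1' := qPoch q (z⁻¹ * q) k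
  set V2 := qPoch q (c * (z * q)) k
  set V2' := qPoch q (c * (z * q) * q) k
  set Q := q ^ k with hQ
  have hQ0 : Q ≠ 0 := pow_ne_zero _ hq
  have h1' : (1 - z) * V1' = V1 * (Q - z) := by
    field_simp at h1
    linear_combination -h1
  have c1 : X1⁻¹ * (1 - q * d₂) = X1'⁻¹ * (1 - q * d₂ * Q) := by
    field_simp
    linear_combination b1
  have c2 : X2⁻¹ * (1 - c * d₃ * q ^ (M + 3)) =
      X2'⁻¹ * (1 - c * d₃ * q ^ (M + 3) * Q) := by
    field_simp
    linear_combination b2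
  have c3 : X3⁻¹ * (1 - q ^ (M + 1)) = X3'⁻¹ * (Q - q ^ (M + 1)) := by
    rw [pow_succ] at b3 ⊢
    field_simp at b3 ⊢
    linear_combination -b3
  have eA : K * (X1⁻¹ * X2⁻¹ * X3⁻¹) = X1'⁻¹ * X2'⁻¹ * X3'⁻¹ * ((Q - q ^ (M + 1)) *
      (1 - q * d₂ * Q) * (1 - c * d₃ * q ^ (M + 3) * Q)) := by
    rw [hK]
    calc _ = (X1⁻¹ * (1 - q * d₂)) * (X2⁻¹ * (1 - c * d₃ * q ^ (M + 3))) *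
          (X3⁻¹ * (1 - q ^ (M + 1))) := by ring
      _ = _ := by rw [c1, c2, c3]; ring
  -- After extraction of the common factors, `A k + B k` is a polynomial in `q^k`; this
  -- decomposition separates the parts belonging to `z` and to `z / q`.
  have key : ((Q - q ^ (M + 1)) * (1 - q * d₂ * Q) * (1 - c * d₃ * q ^ (M + 3) * Q) +
      q ^ (M + 1) * (1 - d₂ * d₃ * q ^ 2 * Q) * ((1 - z⁻¹ * Q) * (1 - c * (z * q) * Q))) *
      (1 - c * q * z ^ 2) = Q * ((1 - q ^ (M + 1) / z) * (1 - d₂ * q * z) *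
        (1 - c * d₃ * q ^ (M + 3) * z) * (1 - c * (z * q) * Q) -
      q * d₂ * (1 - c * q ^ (M + 2) * z) * (1 - d₁ * z) * (1 - d₃ * q ^ (M + 2) / z) *
        (Q - z)) := by
    simp only [pow_succ _ M, pow_add _ M]
    rw [hcdef]
    field_simp
    ring
  simp only [div_eq_mul_inv, mul_inv] at key ⊢
  linear_combination (u1 * u2 * V1 * V2 * x4⁻¹ * (1 - c * q * z ^ 2)) * eA +
    (u1 * u2 * V1 * V2 * x4⁻¹ * X1'⁻¹ * X2'⁻¹ * X3'⁻¹) * key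
   - ((1 - q ^ (M + 1) * z⁻¹) * (1 - d₂ * q * z) *
        (1 - c * d₃ * q ^ (M + 3) * z)) * (u1 * u2 * V1 * x4⁻¹ * X1'⁻¹ * X2'⁻¹ * X3'⁻¹) * Q * h2
   + q * d₂ * (1 - c * q ^ (M + 2) * z) * (1 - d₁ * z) * (1 - d₃ * q ^ (M + 2) * z⁻¹) *
       (u1 * u2 * V2 * x4⁻¹ * X1'⁻¹ * X2'⁻¹ * X3'⁻¹) * Q * h1'

/-- Inverse in direction to `racahPhi_lower_d₁_M`, and again mixing neighbouring indices. The
boundary degree `n = M + 1` is allowed when `(z⁻¹;q)_{M+1} = 0`, as at `z = q^x` with `x ≤ M`; the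
right side then vanishes. -/
theorem racahPhi_raise_d₁ {q z d₁ d₂ d₃ : ℂ} (hq : q ≠ 0) (hz : z ≠ 0)
    (hr : ∀ m : ℕ, 1 - q ^ (m + 1) ≠ 0) (hd₂ : Avoids q d₂)
    (he : Avoids q (d₁ * d₂ * d₃)) {n M : ℕ} (hn : n ≤ M + 1)
    (hM : n ≤ M ∨ qPoch q z⁻¹ (M + 1) = 0) :
    (1 - q ^ (M + 1)) * ((1 - d₂ * q * z) * (1 - d₁ * d₂ * d₃ * q ^ (M + 3) * z) *
        racahPhi q n (z * q) d₁ d₂ d₃ (M + 1) +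
      d₂ * q * (z - d₃ * q ^ (M + 1)) * (1 - d₁ * q * z) * racahPhi q n z d₁ d₂ d₃ (M + 1)) =
    (1 - d₂ * d₃ * q ^ (n + M + 2)) * (1 - q ^ (M + 1) / q ^ n) * (1 - d₁ * d₂ * q ^ 2 * z ^ 2) *
      racahPhi q n z (q * d₁) d₂ d₃ M := by
  set c := d₁ * d₂ with hcdef
  let U : ℕ → ℂ := fun k => qPoch q (q ^ n)⁻¹ k * qPoch q (d₂ * d₃ * q ^ (n + 1)) k
  let V : ℕ → ℂ := fun k => qPoch q z⁻¹ k * qPoch q (c * (z * q) * q) k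
  let D : ℕ → ℂ := fun k => (qPoch q (q * d₂) k)⁻¹ * (qPoch q (c * d₃ * q ^ (M + 3)) k)⁻¹ *
    (qPoch q (q ^ (M + 1))⁻¹ k)⁻¹ * (q ^ k * (qPoch q q k)⁻¹)
  let A : ℕ → ℂ := fun k => (1 - d₂ * d₃ * q ^ (M + 2) * q ^ k) * (q ^ k)⁻¹ * U k * V k * D k
  let B : ℕ → ℂ := fun k => (1 - d₂ * q ^ (k + 1)) * (1 - c * d₃ * q ^ (M + 3) * q ^ k) *
    (1 - (q ^ (k + 1))⁻¹) * U (k + 1) * D (k + 1) * V k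
  -- The combined summand of index `k + 1` has the factor `1 - c q² z²`, and its cofactor splits as
  -- `A (k + 1) + B k`. By `hAB`, the regrouped `B k + A k` is proportional to the summand of index
  -- `k` on the right.
  have hL : (1 - d₂ * q * z) * (1 - d₁ * d₂ * d₃ * q ^ (M + 3) * z) *
        racahPhi q n (z * q) d₁ d₂ d₃ (M + 1) +
      d₂ * q * (z - d₃ * q ^ (M + 1)) * (1 - d₁ * q * z) * racahPhi q n z d₁ d₂ d₃ (M + 1) =
      (1 - c * q ^ 2 * z ^ 2) *
        (∑ k ∈ Finset.range n, B k + ∑ k ∈ Finset.range (n + 1), A k) := by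
    rw [Finset.sum_range_succ', ← add_assoc, ← Finset.sum_add_distrib, mul_add, Finset.mul_sum]
    simp only [racahPhi, phi43, Finset.mul_sum, ← Finset.sum_add_distrib]
    rw [Finset.sum_range_succ']
    congr 1
    · refine Finset.sum_congr rfl fun k hk => ?_
      have h1 := qPoch_succ' q (z * q)⁻¹ k
      have h1' := qPoch_succ q z⁻¹ k
      have h2 := qPoch_succ' q (c * (z * q)) k
      have h2' := qPoch_succ q (c * (z * q) * q) k
      simp only [A, B, U, V, D, zpow_neg, zpow_natCast]
      rw [show (z * q)⁻¹ * q = z⁻¹ by field_simp] at h1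
      rw [show d₁ * d₂ * (z * q * q) = c * (z * q) * q by rw [hcdef]; ring,
        show d₁ * d₂ * (z * q) = c * (z * q) from rfl,
        show c * d₃ * q ^ (M + 1 + 2) = c * d₃ * q ^ (M + 3) from rfl]
      rw [h1, h1', h2, h2']
      set u1 := qPoch q (q ^ n)⁻¹ (k + 1)
      set u2 := qPoch q (d₂ * d₃ * q ^ (n + 1)) (k + 1)
      set x1 := qPoch q (q * d₂) (k + 1)
      set x2 := qPoch q (c * d₃ * q ^ (M + 3)) (k + 1)
      set x3 := qPoch q (q ^ (M + 1))⁻¹ (k + 1)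
      set x4 := qPoch q q (k + 1)
      set v1 := qPoch q z⁻¹ k
      set v2 := qPoch q (c * (z * q) * q) k
      have hQ0 : q ^ (k + 1) ≠ 0 := pow_ne_zero _ hq
      have key : (1 - d₂ * q * z) * (1 - c * d₃ * q ^ (M + 3) * z) * (1 - (z * q)⁻¹) *
          (1 - c * (z * q) * q * q ^ k) +
          d₂ * q * (z - d₃ * q ^ (M + 1)) * (1 - d₁ * q * z) * (1 - z⁻¹ * q ^ k) *
          (1 - c * (z * q)) = (1 - c * q ^ 2 * z ^ 2) *
          ((1 - d₂ * q ^ (k + 1)) * (1 - c * d₃ * q ^ (M + 3) * q ^ k) * (1 - (q ^ (k + 1))⁻¹) +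
          (1 - d₂ * d₃ * q ^ (M + 2) * q ^ (k + 1)) * (q ^ (k + 1))⁻¹ * (1 - z⁻¹ * q ^ k) *
          (1 - c * (z * q) * q * q ^ k)) := by
        simp only [pow_succ _ k, pow_add _ M, hcdef] at hQ0 ⊢
        field_simp
        ring
      simp only [div_eq_mul_inv, mul_inv] at key ⊢
      linear_combination (u1 * u2 * v1 * v2 * (x1⁻¹ * x2⁻¹ * x3⁻¹ * (q ^ (k + 1) * x4⁻¹))) * key
    · simp only [A, U, V, D, qPoch_zero, hcdef]
      simp
      ring
  rw [hL]
  have hAB : ∀ k, k ≤ M → (1 - q ^ (M + 1)) * (B k + A k) =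
      (1 - d₂ * d₃ * q ^ (n + M + 2)) * (1 - q ^ (M + 1) / q ^ n) *
      ((qPoch q (q ^ (-(n : ℤ))) k * qPoch q (d₂ * d₃ * q ^ (n + 1)) k * qPoch q z⁻¹ k *
        qPoch q (q * d₁ * d₂ * (z * q)) k) /
      (qPoch q (q * d₂) k * qPoch q (q * d₁ * d₂ * d₃ * q ^ (M + 2)) k * qPoch q (q ^ M)⁻¹ k) *
        (q ^ k / qPoch q q k)) := by
    intro k hk
    have hkM : k < M + 1 := Nat.lt_succ_iff.2 hk
    simp only [A, B, U, V, D, zpow_neg, zpow_natCast]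
    rw [show q * d₁ * d₂ * (z * q) = c * (z * q) * q by rw [hcdef]; ring,
      show q * d₁ * d₂ * d₃ * q ^ (M + 2) = c * d₃ * q ^ (M + 3) by rw [hcdef]; ring]
    have b3 := qPoch_shift q (q ^ (M + 1))⁻¹ k
    rw [show (q ^ (M + 1))⁻¹ * q = (q ^ M)⁻¹ by rw [pow_succ]; field_simp] at b3
    have n1 := (hd₂.self_mul hq).pow k
    have n2 := (he.mul_pow hq (M + 3)).pow k
    have n3 := qPoch_inv_pow_ne hq hr hkM.le
    have n3' := qPoch_inv_pow_ne hq hr hk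
    have n4 := one_sub_inv_pow_mul_pow_ne hq hr hkM
    have n5 := hr k
    have hn0 : q ^ n ≠ 0 := pow_ne_zero _ hq
    have hM0 : q ^ M ≠ 0 := pow_ne_zero _ hq
    have hQ0 : q ^ k ≠ 0 := pow_ne_zero _ hq
    simp only [qPoch_succ]
    set u1 := qPoch q (q ^ n)⁻¹ k
    set u2 := qPoch q (d₂ * d₃ * q ^ (n + 1)) k
    set x1 := qPoch q (q * d₂) k
    set x2 := qPoch q (c * d₃ * q ^ (M + 3)) k
    set x3 := qPoch q (q ^ (M + 1))⁻¹ k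
    set x3' := qPoch q (q ^ M)⁻¹ k
    set x4 := qPoch q q k
    set v1 := qPoch q z⁻¹ k
    set v2 := qPoch q (c * (z * q) * q) k
    have n4' : q ^ (M + 1) - q ^ k ≠ 0 := by
      intro h; apply n4; rw [pow_succ] at h ⊢; field_simp; linear_combination h
    have e3 : x3⁻¹ * (1 - q ^ (M + 1)) = x3'⁻¹ * (q ^ k - q ^ (M + 1)) := by
      rw [pow_succ] at b3 ⊢
      field_simp at b3 ⊢
      linear_combination -b3
    have eB : (1 - d₂ * q ^ (k + 1)) * (1 - c * d₃ * q ^ (M + 3) * q ^ k) *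
        (1 - (q ^ (k + 1))⁻¹) * ((1 - q * d₂ * q ^ k)⁻¹ *
        (1 - c * d₃ * q ^ (M + 3) * q ^ k)⁻¹ * (1 - (q ^ (M + 1))⁻¹ * q ^ k)⁻¹ *
        (q ^ (k + 1) * (1 - q * q ^ k)⁻¹)) * (q ^ (M + 1) - q ^ k) = - q ^ (M + 1) := by
      have a1 : (1 - d₂ * q ^ (k + 1)) * (1 - q * d₂ * q ^ k)⁻¹ = 1 := by
        rw [show d₂ * q ^ (k + 1) = q * d₂ * q ^ k by ring, mul_inv_cancel₀ n1]
      have a2 : (1 - (q ^ (k + 1))⁻¹) * (q ^ (k + 1) * (1 - q * q ^ k)⁻¹) = -1 := by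
        rw [← pow_succ', sub_mul, inv_mul_cancel_left₀ (pow_ne_zero _ hq), one_mul]
        linear_combination - mul_inv_cancel₀ n5
      have a3 : (1 - (q ^ (M + 1))⁻¹ * q ^ k)⁻¹ * (q ^ (M + 1) - q ^ k) = q ^ (M + 1) := by
        rw [inv_mul_eq_iff_eq_mul₀ n4, sub_mul, one_mul, mul_right_comm,
          inv_mul_cancel₀ (pow_ne_zero _ hq), one_mul]
      have a4 := mul_inv_cancel₀ n2
      calc _ = ((1 - d₂ * q ^ (k + 1)) * (1 - q * d₂ * q ^ k)⁻¹) *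
          ((1 - (q ^ (k + 1))⁻¹) * (q ^ (k + 1) * (1 - q * q ^ k)⁻¹)) *
          ((1 - (q ^ (M + 1))⁻¹ * q ^ k)⁻¹ * (q ^ (M + 1) - q ^ k)) *
          ((1 - c * d₃ * q ^ (M + 3) * q ^ k) * (1 - c * d₃ * q ^ (M + 3) * q ^ k)⁻¹) := by ring
        _ = _ := by rw [a1, a2, a3, a4]; ring
    have e4 : (q ^ (M + 1) - q ^ k) * ((1 - d₂ * d₃ * q ^ (M + 2) * q ^ k)) -
        q ^ (M + 1) * ((1 - (q ^ n)⁻¹ * q ^ k) * (1 - d₂ * d₃ * q ^ (n + 1) * q ^ k)) =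
        - q ^ k * ((1 - d₂ * d₃ * q ^ (n + M + 2)) * (1 - q ^ (M + 1) * (q ^ n)⁻¹)) := by
      simp only [pow_add _ n, pow_add _ M]
      field_simp
      ring
    simp only [div_eq_mul_inv, mul_inv] at eB ⊢
    rw [← mul_right_inj' n4']
    have hQ1 : q ^ k * (q ^ k)⁻¹ = 1 := mul_inv_cancel₀ hQ0
    linear_combination ((1 - q ^ (M + 1)) * u1 * u2 * (1 - (q ^ n)⁻¹ * q ^ k) *
        (1 - d₂ * d₃ * q ^ (n + 1) * q ^ k) * v1 * v2 * x1⁻¹ * x2⁻¹ * x3⁻¹ * x4⁻¹) * eB +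
      ((1 - q ^ (M + 1)) * u1 * u2 * v1 * v2 * x1⁻¹ * x2⁻¹ * x3⁻¹ * x4⁻¹) * e4
      + ((1 - q ^ (M + 1)) * u1 * u2 * v1 * v2 * x1⁻¹ * x2⁻¹ * x3⁻¹ * x4⁻¹ *
        (q ^ (M + 1) - q ^ k) * (1 - d₂ * d₃ * q ^ (M + 2) * q ^ k)) * hQ1
      - u1 * u2 * v1 * v2 * x1⁻¹ * x2⁻¹ * x4⁻¹ * q ^ k *
        ((1 - d₂ * d₃ * q ^ (n + M + 2)) * (1 - q ^ (M + 1) * (q ^ n)⁻¹)) * e3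
  rcases hn.lt_or_eq with hn' | rfl
  · have hB : B n = 0 := by
      simp only [B, U, qPoch_inv_pow_eq_zero hq (Nat.lt_succ_self n), zero_mul, mul_zero]
    rw [show ∑ k ∈ Finset.range n, B k = ∑ k ∈ Finset.range (n + 1), B k by
      rw [Finset.sum_range_succ, hB, add_zero], ← Finset.sum_add_distrib, mul_left_comm,
      Finset.mul_sum, Finset.sum_congr rfl fun k hk =>
        hAB k ((Nat.lt_succ_iff.1 (Finset.mem_range.1 hk)).trans (Nat.lt_succ_iff.1 hn')),
      ← Finset.mul_sum, racahPhi, phi43]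
    ring
  -- For `n = M + 1` the index `k = M + 1` is out of reach of `hAB`, and its term vanishes by `hM`;
  -- all other terms carry `1 - q^{M+1} / q^n = 0`.
  · have hV : A (M + 1) = 0 := by
      simp only [A, V, hM.resolve_left (by omega), zero_mul, mul_zero]
    rw [Finset.sum_range_succ A, hV, add_zero, ← Finset.sum_add_distrib, mul_left_comm,
      Finset.mul_sum, Finset.sum_congr rfl fun k hk =>
        hAB k (Nat.lt_succ_iff.1 (Finset.mem_range.1 hk))]
    simp [div_self (pow_ne_zero (M + 1) hq)]

/-! ### Generic parameter triples. -/

/-- Parameters for which no factor occurring in the theory of a `q`-Racah polynomial vanishes. -/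
structure GenericTriple (s b₁ b₂ b₃ : ℂ) : Prop where
  s_ne : s ≠ 0
  b₁_ne : b₁ ≠ 0
  b₂_ne : b₂ ≠ 0
  b₃_ne : b₃ ≠ 0
  root : ∀ m : ℕ, 1 - (s ^ 2) ^ (m + 1) ≠ 0
  a₁ : Avoids (s ^ 2) (b₁ ^ 2)
  a₂ : Avoids (s ^ 2) (b₂ ^ 2)
  a₃ : Avoids (s ^ 2) (b₃ ^ 2)
  a₁₂ : Avoids (s ^ 2) (b₁ ^ 2 * b₂ ^ 2)
  a₂₃ : Avoids (s ^ 2) (b₂ ^ 2 * b₃ ^ 2)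
  a₁₂₃ : Avoids (s ^ 2) (b₁ ^ 2 * b₂ ^ 2 * b₃ ^ 2)

namespace GenericTriple

variable {s b₁ b₂ b₃ : ℂ}

theorem q_ne (h : GenericTriple s b₁ b₂ b₃) : s ^ 2 ≠ 0 := pow_ne_zero _ h.s_ne

theorem swap (h : GenericTriple s b₁ b₂ b₃) : GenericTriple s b₃ b₂ b₁ where
  s_ne := h.s_ne
  b₁_ne := h.b₃_ne
  b₂_ne := h.b₂_ne
  b₃_ne := h.b₁_ne
  root := h.root
  a₁ := h.a₃
  a₂ := h.a₂
  a₃ := h.a₁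
  a₁₂ := by rw [mul_comm]; exact h.a₂₃
  a₂₃ := by rw [mul_comm]; exact h.a₁₂
  a₁₂₃ := by
    rw [show b₃ ^ 2 * b₂ ^ 2 * b₁ ^ 2 = b₁ ^ 2 * b₂ ^ 2 * b₃ ^ 2 by ring]; exact h.a₁₂₃

theorem shift₁ (h : GenericTriple s b₁ b₂ b₃) : GenericTriple s (s * b₁) b₂ b₃ where
  s_ne := h.s_ne
  b₁_ne := mul_ne_zero h.s_ne h.b₁_ne
  b₂_ne := h.b₂_ne
  b₃_ne := h.b₃_ne
  root := h.root
  a₁ := by rw [mul_pow]; exact h.a₁.self_mul h.q_ne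
  a₂ := h.a₂
  a₃ := h.a₃
  a₁₂ := by rw [mul_pow, mul_assoc]; exact h.a₁₂.self_mul h.q_ne
  a₂₃ := h.a₂₃
  a₁₂₃ := by
    rw [mul_pow, mul_assoc, mul_assoc, ← mul_assoc (b₁ ^ 2)]; exact h.a₁₂₃.self_mul h.q_ne

theorem shift₂ (h : GenericTriple s b₁ b₂ b₃) : GenericTriple s b₁ (s * b₂) b₃ where
  s_ne := h.s_ne
  b₁_ne := h.b₁_ne
  b₂_ne := mul_ne_zero h.s_ne h.b₂_ne
  b₃_ne := h.b₃_ne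
  root := h.root
  a₁ := h.a₁
  a₂ := by rw [mul_pow]; exact h.a₂.self_mul h.q_ne
  a₃ := h.a₃
  a₁₂ := by rw [mul_pow, mul_left_comm]; exact h.a₁₂.self_mul h.q_ne
  a₂₃ := by rw [mul_pow, mul_assoc]; exact h.a₂₃.self_mul h.q_ne
  a₁₂₃ := by
    rw [mul_pow, mul_left_comm, mul_assoc]; exact h.a₁₂₃.self_mul h.q_ne

theorem shift₃ (h : GenericTriple s b₁ b₂ b₃) : GenericTriple s b₁ b₂ (s * b₃) :=
  h.swap.shift₁.swap

end GenericTriple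

/-! ### Contiguous relations for the normalized polynomials. -/

theorem qRacah_eq (s : ℂ) {n x M : ℕ} (hn : n ≤ M) (hx : x ≤ M) (b₁ b₂ b₃ : ℂ) :
    qRacah s n x b₁ b₂ b₃ M =
      Omega s n b₁ b₂ b₃ M * racahPhi (s ^ 2) n ((s ^ 2) ^ x) (b₁ ^ 2) (b₂ ^ 2) (b₃ ^ 2) M := by
  rw [qRacah, if_pos ⟨hn, hx⟩, racahPhi, zpow_neg, zpow_neg, zpow_natCast, zpow_natCast,
    pow_succ _ x]

theorem qRacah_of_lt_left (s : ℂ) {n M : ℕ} (hn : M < n) (x : ℕ) (b₁ b₂ b₃ : ℂ) :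
    qRacah s n x b₁ b₂ b₃ M = 0 := if_neg fun h => by omega

theorem qRacah_of_lt_right (s : ℂ) {x M : ℕ} (hx : M < x) (n : ℕ) (b₁ b₂ b₃ : ℂ) :
    qRacah s n x b₁ b₂ b₃ M = 0 := if_neg fun h => by omega

/-- At `x = M + 1` the polynomial is zero by convention while the series need not be; the factor `1
- q^{M+1-x}` vanishes there, so the series formula may be used up to and including this value. -/
theorem one_sub_mul_qRacah (s : ℂ) {n x M : ℕ} (hn : n ≤ M) (hx : x ≤ M + 1) (b₁ b₂ b₃ : ℂ) :
    (1 - (s ^ 2) ^ (M + 1 - x)) * qRacah s n x b₁ b₂ b₃ M = (1 - (s ^ 2) ^ (M + 1 - x)) *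
      (Omega s n b₁ b₂ b₃ M * racahPhi (s ^ 2) n ((s ^ 2) ^ x) (b₁ ^ 2) (b₂ ^ 2) (b₃ ^ 2) M) := by
  rcases hx.lt_or_eq with hx | rfl
  · rw [qRacah_eq s hn (Nat.lt_succ_iff.1 hx)]
  · simp

/-- The factor `1 - q^x` kills the case `x = 0`, where the truncated `x - 1` differs from the
argument `q^x / q` of the series. -/
theorem one_sub_mul_qRacah_pred {s : ℂ} (hs : s ≠ 0) {n x M : ℕ} (hn : n ≤ M) (hx : x ≤ M + 1)
    (b₁ b₂ b₃ : ℂ) :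
    (1 - (s ^ 2) ^ x) * qRacah s n (x - 1) b₁ b₂ b₃ M = (1 - (s ^ 2) ^ x) *
      (Omega s n b₁ b₂ b₃ M *
        racahPhi (s ^ 2) n ((s ^ 2) ^ x / s ^ 2) (b₁ ^ 2) (b₂ ^ 2) (b₃ ^ 2) M) := by
  rcases x with _ | x
  · simp
  · rw [qRacah_eq s hn (by omega), pow_succ _ x, mul_div_cancel_right₀ _ (pow_ne_zero _ hs),
      Nat.add_sub_cancel]

/-- With `M = n + r` every truncated difference `M - n` becomes `r`, so the ratios of normalizations
below reduce to shifts of Pochhammer symbols. -/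
theorem Omega_add {s b₁ b₂ b₃ : ℂ} (h : GenericTriple s b₁ b₂ b₃) (n r : ℕ) :
    Omega s n b₁ b₂ b₃ (n + r) =
      qPoch (s ^ 2) (s ^ 2) (n + r) / (qPoch (s ^ 2) (s ^ 2) n * qPoch (s ^ 2) (s ^ 2) r) *
      ((1 - b₂ ^ 2 * b₃ ^ 2 * (s ^ 2) ^ (2 * n + 1)) /
        qPoch (s ^ 2) (b₂ ^ 2 * b₃ ^ 2 * (s ^ 2) ^ (n + 1)) (n + r + 1)) *
      (qPoch (s ^ 2) (s ^ 2 * b₂ ^ 2) n *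
        qPoch (s ^ 2) (b₁ ^ 2 * b₂ ^ 2 * b₃ ^ 2 * (s ^ 2) ^ (n + r + 2)) n *
        qPoch (s ^ 2) (s ^ 2 * b₁ ^ 2) r) /
      ((s * b₂) ^ ((n : ℤ) - r) * qPoch (s ^ 2) (s ^ 2 * b₃ ^ 2) n) := by
  rw [Omega, qBinom, if_pos (Nat.le_add_right n r),
    cancelledRatio_eq _ _ _ _ (Nat.le_add_right n r) (h.a₂₃.pow _), Nat.add_sub_cancel_left,
    show 2 * (n : ℤ) - ((n + r : ℕ) : ℤ) = (n : ℤ) - r by push_cast; ring]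

theorem Omega_lower_b₁_M {s b₁ b₂ b₃ : ℂ} (h : GenericTriple s b₁ b₂ b₃) {n M : ℕ}
    (hn : n ≤ M) :
    (1 - (s ^ 2) ^ (M + 1 - n)) * (1 - b₂ ^ 2 * b₃ ^ 2 * (s ^ 2) ^ (n + M + 2)) *
      Omega s n b₁ b₂ b₃ (M + 1) =
    (1 - (s ^ 2) ^ (M + 1)) * (1 - s ^ 2 * b₁ ^ 2) * (s * b₂) *
      Omega s n (s * b₁) b₂ b₃ M := by
  obtain ⟨r, rfl⟩ := Nat.exists_eq_add_of_le hn
  rw [show n + r + 1 - n = r + 1 by omega, Omega_add h.shift₁, add_assoc n r 1, Omega_add h,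
    ← add_assoc n r 1]
  have hs := h.s_ne
  have hq := h.q_ne
  have hb := h.b₂_ne
  have n1 := h.root r
  have n2 := h.a₂₃.pow (n + (n + r) + 2)
  have n3 := qPoch_self_ne h.root r
  have n4 := qPoch_self_ne h.root n
  have n5 := (h.a₂₃.mul_pow hq (n + 1)).qPoch_ne (n + r + 1)
  have n6 := (h.a₃.self_mul hq).qPoch_ne n
  have e1 : qPoch (s ^ 2) (s ^ 2) (n + r + 1) =
      qPoch (s ^ 2) (s ^ 2) (n + r) * (1 - (s ^ 2) ^ (n + r + 1)) := by
    rw [qPoch_succ, pow_succ' (s ^ 2)]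
  have e2 : qPoch (s ^ 2) (s ^ 2) (r + 1) =
      qPoch (s ^ 2) (s ^ 2) r * (1 - (s ^ 2) ^ (r + 1)) := by
    rw [qPoch_succ, pow_succ' (s ^ 2)]
  have e3 : qPoch (s ^ 2) (b₂ ^ 2 * b₃ ^ 2 * (s ^ 2) ^ (n + 1)) (n + r + 1 + 1) =
      qPoch (s ^ 2) (b₂ ^ 2 * b₃ ^ 2 * (s ^ 2) ^ (n + 1)) (n + r + 1) *
        (1 - b₂ ^ 2 * b₃ ^ 2 * (s ^ 2) ^ (n + (n + r) + 2)) := by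
    rw [qPoch_succ]; ring
  have e4 : qPoch (s ^ 2) (s ^ 2 * b₁ ^ 2) (r + 1) =
      (1 - s ^ 2 * b₁ ^ 2) * qPoch (s ^ 2) (s ^ 2 * (s * b₁) ^ 2) r := by
    rw [qPoch_succ']; ring_nf
  have e5 : (s * b₁) ^ 2 * b₂ ^ 2 * b₃ ^ 2 * (s ^ 2) ^ (n + r + 2) =
      b₁ ^ 2 * b₂ ^ 2 * b₃ ^ 2 * (s ^ 2) ^ (n + r + 1 + 2) := by ring
  have e6 : (s * b₂) ^ ((n : ℤ) - r) = (s * b₂) ^ ((n : ℤ) - (r + 1 : ℕ)) * (s * b₂) := by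
    rw [← zpow_add_one₀ (mul_ne_zero hs hb)]; congr 1; push_cast; ring
  have n7 := zpow_ne_zero ((n : ℤ) - (r + 1 : ℕ)) (mul_ne_zero hs hb)
  rw [e1, e2, e3, e4, e5, e6]
  field_simp

theorem Omega_lower_b₁ {s b₁ b₂ b₃ : ℂ} (h : GenericTriple s b₁ b₂ b₃) {n M : ℕ}
    (hn : n ≤ M) :
    (1 - b₁ ^ 2 * b₂ ^ 2 * b₃ ^ 2 * (s ^ 2) ^ (n + M + 2)) * (1 - b₁ ^ 2 * (s ^ 2) ^ (M + 1 - n)) *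
      Omega s n b₁ b₂ b₃ M =
    (1 - b₁ ^ 2 * b₂ ^ 2 * b₃ ^ 2 * (s ^ 2) ^ (M + 2)) * (1 - s ^ 2 * b₁ ^ 2) *
      Omega s n (s * b₁) b₂ b₃ M := by
  obtain ⟨r, rfl⟩ := Nat.exists_eq_add_of_le hn
  rw [show n + r + 1 - n = r + 1 by omega, Omega_add h.shift₁, Omega_add h]
  have e4 := qPoch_shift (s ^ 2) (s ^ 2 * b₁ ^ 2) r
  have e5 := qPoch_shift (s ^ 2) (b₁ ^ 2 * b₂ ^ 2 * b₃ ^ 2 * (s ^ 2) ^ (n + r + 2)) n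
  rw [show (s * b₁) ^ 2 * b₂ ^ 2 * b₃ ^ 2 * (s ^ 2) ^ (n + r + 2) =
      b₁ ^ 2 * b₂ ^ 2 * b₃ ^ 2 * (s ^ 2) ^ (n + r + 2) * s ^ 2 by ring,
    show s ^ 2 * (s * b₁) ^ 2 = s ^ 2 * b₁ ^ 2 * s ^ 2 by ring,
    show b₁ ^ 2 * (s ^ 2) ^ (r + 1) = s ^ 2 * b₁ ^ 2 * (s ^ 2) ^ r by ring,
    show b₁ ^ 2 * b₂ ^ 2 * b₃ ^ 2 * (s ^ 2) ^ (n + (n + r) + 2) =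
      b₁ ^ 2 * b₂ ^ 2 * b₃ ^ 2 * (s ^ 2) ^ (n + r + 2) * (s ^ 2) ^ n by ring]
  set X := qPoch (s ^ 2) (s ^ 2 * b₁ ^ 2) r
  set Y := qPoch (s ^ 2) (b₁ ^ 2 * b₂ ^ 2 * b₃ ^ 2 * (s ^ 2) ^ (n + r + 2)) n
  set X' := qPoch (s ^ 2) (s ^ 2 * b₁ ^ 2 * s ^ 2) r
  set Y' := qPoch (s ^ 2) (b₁ ^ 2 * b₂ ^ 2 * b₃ ^ 2 * (s ^ 2) ^ (n + r + 2) * s ^ 2) n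
  simp only [div_eq_mul_inv]
  set u := (s * b₂) ^ ((n : ℤ) - r) * qPoch (s ^ 2) (s ^ 2 * b₃ ^ 2) n
  set v := qPoch (s ^ 2) (s ^ 2) (n + r) * (qPoch (s ^ 2) (s ^ 2) n * qPoch (s ^ 2) (s ^ 2) r)⁻¹ *
    ((1 - b₂ ^ 2 * b₃ ^ 2 * (s ^ 2) ^ (2 * n + 1)) *
        (qPoch (s ^ 2) (b₂ ^ 2 * b₃ ^ 2 * (s ^ 2) ^ (n + 1)) (n + r + 1))⁻¹)
  linear_combination (-v * qPoch (s ^ 2) (s ^ 2 * b₂ ^ 2) n * u⁻¹) *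
    (X * (1 - s ^ 2 * b₁ ^ 2 * (s ^ 2) ^ r) * e5 + (1 - b₁ ^ 2 * b₂ ^ 2 * b₃ ^ 2 *
      (s ^ 2) ^ (n + r + 2)) * Y' * e4)

theorem Omega_succ {s b₁ b₂ b₃ : ℂ} (h : GenericTriple s b₁ b₂ b₃) {n M : ℕ} (hn : n ≤ M) :
    (1 - (s ^ 2) ^ (n + 1)) * (1 - b₂ ^ 2 * b₃ ^ 2 * (s ^ 2) ^ (n + 2)) * (1 - s ^ 2 * b₃ ^ 2) *
      (s * b₂) * s ^ ((M : ℤ) - 2 * n) * Omega s (n + 1) b₁ b₂ b₃ (M + 1) =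
    (1 - (s ^ 2) ^ (M + 1)) * (1 - s ^ 2 * b₂ ^ 2) *
      (1 - b₁ ^ 2 * b₂ ^ 2 * b₃ ^ 2 * (s ^ 2) ^ (M + 3)) *
      Omega s n b₁ (s * b₂) (s * b₃) M := by
  obtain ⟨r, rfl⟩ := Nat.exists_eq_add_of_le hn
  have hO := Omega_add h (n + 1) r
  rw [show n + 1 + r = n + r + 1 by omega] at hO
  rw [Omega_add h.shift₂.shift₃, hO]
  have hs := h.s_ne
  have hq := h.q_ne
  have hb := h.b₂_ne
  have n1 := h.root n
  have n2 := h.a₂₃.pow (n + 2)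
  have n3 := qPoch_self_ne h.root r
  have n4 := qPoch_self_ne h.root n
  have n5 := (h.a₂₃.mul_pow hq (n + 3)).qPoch_ne (n + r + 1)
  have n6 := ((h.a₃.self_mul hq).mul_self hq).qPoch_ne n
  have n8 := (h.a₃.self_mul hq).one_sub
  have e1 : qPoch (s ^ 2) (s ^ 2) (n + r + 1) =
      qPoch (s ^ 2) (s ^ 2) (n + r) * (1 - (s ^ 2) ^ (n + r + 1)) := by
    rw [qPoch_succ, pow_succ' (s ^ 2)]
  have e2 : qPoch (s ^ 2) (s ^ 2) (n + 1) =
      qPoch (s ^ 2) (s ^ 2) n * (1 - (s ^ 2) ^ (n + 1)) := by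
    rw [qPoch_succ, pow_succ' (s ^ 2)]
  have e3 : qPoch (s ^ 2) (b₂ ^ 2 * b₃ ^ 2 * (s ^ 2) ^ (n + 1 + 1)) (n + r + 1 + 1) =
      (1 - b₂ ^ 2 * b₃ ^ 2 * (s ^ 2) ^ (n + 2)) *
      qPoch (s ^ 2) (b₂ ^ 2 * b₃ ^ 2 * (s ^ 2) ^ (n + 3)) (n + r + 1) := by
    rw [qPoch_succ']; ring_nf
  have e4 : qPoch (s ^ 2) (s ^ 2 * b₂ ^ 2) (n + 1) =
      (1 - s ^ 2 * b₂ ^ 2) * qPoch (s ^ 2) (s ^ 2 * (s * b₂) ^ 2) n := by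
    rw [qPoch_succ']; ring_nf
  have e4' : qPoch (s ^ 2) (s ^ 2 * b₃ ^ 2) (n + 1) =
      (1 - s ^ 2 * b₃ ^ 2) * qPoch (s ^ 2) (s ^ 2 * b₃ ^ 2 * s ^ 2) n := by
    rw [qPoch_succ']
  have e5 : qPoch (s ^ 2) (b₁ ^ 2 * b₂ ^ 2 * b₃ ^ 2 * (s ^ 2) ^ (n + r + 1 + 2)) (n + 1) =
      (1 - b₁ ^ 2 * b₂ ^ 2 * b₃ ^ 2 * (s ^ 2) ^ (n + r + 3)) *
      qPoch (s ^ 2) (b₁ ^ 2 * (s * b₂) ^ 2 * (s * b₃) ^ 2 * (s ^ 2) ^ (n + r + 2)) n := by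
    rw [qPoch_succ']; ring_nf
  have e6 : (s * (s * b₂)) ^ ((n : ℤ) - r) = (s * b₂) ^ (((n + 1 : ℕ) : ℤ) - r) /
      (s * b₂ * s ^ (((n + r : ℕ) : ℤ) - 2 * n)) := by
    rw [show ((n + r : ℕ) : ℤ) - 2 * n = - ((n : ℤ) - r) by push_cast; ring,
      show ((n + 1 : ℕ) : ℤ) - r = ((n : ℤ) - r) + 1 by push_cast; ring,
      zpow_add_one₀ (mul_ne_zero hs hb), mul_zpow s (s * b₂), zpow_neg]
    have := zpow_ne_zero ((n : ℤ) - r) hs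
    field_simp
  have e7 : (s * b₂) ^ 2 * (s * b₃) ^ 2 * (s ^ 2) ^ (n + 1) =
      b₂ ^ 2 * b₃ ^ 2 * (s ^ 2) ^ (n + 3) := by ring
  have e8 : (s * b₂) ^ 2 * (s * b₃) ^ 2 * (s ^ 2) ^ (2 * n + 1) =
      b₂ ^ 2 * b₃ ^ 2 * (s ^ 2) ^ (2 * (n + 1) + 1) := by ring
  have e9 : s ^ 2 * (s * b₃) ^ 2 = s ^ 2 * b₃ ^ 2 * s ^ 2 := by ring
  have n7 := zpow_ne_zero (((n + 1 : ℕ) : ℤ) - r) (mul_ne_zero hs hb)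
  have n9 := zpow_ne_zero (((n + r : ℕ) : ℤ) - 2 * n) hs
  rw [e1, e2, e3, e4, e4', e5, e6, e7, e8, e9]
  generalize qPoch (s ^ 2) (b₁ ^ 2 * (s * b₂) ^ 2 * (s * b₃) ^ 2 * (s ^ 2) ^ (n + r + 2)) n = X1
  generalize qPoch (s ^ 2) (s ^ 2 * (s * b₂) ^ 2) n = X2
  generalize qPoch (s ^ 2) (s ^ 2 * b₁ ^ 2) r = X3
  generalize qPoch (s ^ 2) (s ^ 2 * b₃ ^ 2 * s ^ 2) n = X4 at *
  generalize qPoch (s ^ 2) (b₂ ^ 2 * b₃ ^ 2 * (s ^ 2) ^ (n + 3)) (n + r + 1) = X5 at *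
  field_simp

theorem Omega_lower_b₁_b₂_M {s b₁ b₂ b₃ : ℂ} (h : GenericTriple s b₁ b₂ b₃) {n M : ℕ}
    (hn : n ≤ M) :
    (1 - (s ^ 2) ^ (M + 1 - n)) * (1 - b₂ ^ 2 * (s ^ 2) ^ (n + 1)) *
      (1 - b₁ ^ 2 * b₂ ^ 2 * b₃ ^ 2 * (s ^ 2) ^ (n + M + 3)) *
      (1 - b₂ ^ 2 * b₃ ^ 2 * (s ^ 2) ^ (n + 1)) * (1 - b₂ ^ 2 * b₃ ^ 2 * (s ^ 2) ^ (2 * n + 2)) *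
      Omega s n b₁ b₂ b₃ (M + 1) =
    (1 - (s ^ 2) ^ (M + 1)) * (1 - s ^ 2 * b₂ ^ 2) *
      (1 - b₁ ^ 2 * b₂ ^ 2 * b₃ ^ 2 * (s ^ 2) ^ (M + 3)) * (1 - s ^ 2 * b₁ ^ 2) *
      (b₂ * s ^ (2 * (n : ℤ) - M + 1)) * (1 - b₂ ^ 2 * b₃ ^ 2 * (s ^ 2) ^ (2 * n + 1)) *
      Omega s n (s * b₁) (s * b₂) b₃ M := by
  obtain ⟨r, rfl⟩ := Nat.exists_eq_add_of_le hn
  have hO := Omega_add h n (r + 1)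
  rw [← add_assoc n r 1] at hO
  rw [Omega_add h.shift₁.shift₂, hO, show n + r + 1 - n = r + 1 by omega]
  have hs := h.s_ne
  have hq := h.q_ne
  have hb := h.b₂_ne
  have n1 := h.root r
  have n2 := (h.a₂₃.mul_pow hq (n + 1)).one_sub
  have n3 := qPoch_self_ne h.root r
  have n4 := qPoch_self_ne h.root n
  have n5 := (h.a₂₃.mul_pow hq (n + 2)).qPoch_ne (n + r + 1)
  have n6 := (h.a₃.self_mul hq).qPoch_ne n
  have n10 := h.a₂₃.pow (2 * n + 2)
  have e1 : qPoch (s ^ 2) (s ^ 2) (n + r + 1) =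
      qPoch (s ^ 2) (s ^ 2) (n + r) * (1 - (s ^ 2) ^ (n + r + 1)) := by
    rw [qPoch_succ, pow_succ' (s ^ 2)]
  have e2 : qPoch (s ^ 2) (s ^ 2) (r + 1) =
      qPoch (s ^ 2) (s ^ 2) r * (1 - (s ^ 2) ^ (r + 1)) := by
    rw [qPoch_succ, pow_succ' (s ^ 2)]
  have e3 : qPoch (s ^ 2) (b₂ ^ 2 * b₃ ^ 2 * (s ^ 2) ^ (n + 1)) (n + r + 1 + 1) =
      (1 - b₂ ^ 2 * b₃ ^ 2 * (s ^ 2) ^ (n + 1)) *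
      qPoch (s ^ 2) (b₂ ^ 2 * b₃ ^ 2 * (s ^ 2) ^ (n + 2)) (n + r + 1) := by
    rw [qPoch_succ']; ring_nf
  have e4 : (1 - b₂ ^ 2 * (s ^ 2) ^ (n + 1)) * qPoch (s ^ 2) (s ^ 2 * b₂ ^ 2) n =
      (1 - s ^ 2 * b₂ ^ 2) * qPoch (s ^ 2) (s ^ 2 * (s * b₂) ^ 2) n := by
    rw [show s ^ 2 * (s * b₂) ^ 2 = s ^ 2 * b₂ ^ 2 * s ^ 2 by ring, qPoch_shift]; ring
  have e4' : qPoch (s ^ 2) (s ^ 2 * b₁ ^ 2) (r + 1) =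
      (1 - s ^ 2 * b₁ ^ 2) * qPoch (s ^ 2) (s ^ 2 * (s * b₁) ^ 2) r := by
    rw [qPoch_succ']; ring_nf
  have e5 : (1 - b₁ ^ 2 * b₂ ^ 2 * b₃ ^ 2 * (s ^ 2) ^ (n + (n + r) + 3)) *
      qPoch (s ^ 2) (b₁ ^ 2 * b₂ ^ 2 * b₃ ^ 2 * (s ^ 2) ^ (n + r + 1 + 2)) n =
      (1 - b₁ ^ 2 * b₂ ^ 2 * b₃ ^ 2 * (s ^ 2) ^ (n + r + 3)) *
      qPoch (s ^ 2) ((s * b₁) ^ 2 * (s * b₂) ^ 2 * b₃ ^ 2 * (s ^ 2) ^ (n + r + 2)) n := by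
    rw [show (s * b₁) ^ 2 * (s * b₂) ^ 2 * b₃ ^ 2 * (s ^ 2) ^ (n + r + 2) =
      b₁ ^ 2 * b₂ ^ 2 * b₃ ^ 2 * (s ^ 2) ^ (n + r + 3) * s ^ 2 by ring, qPoch_shift]; ring
  have e6 : (s * (s * b₂)) ^ ((n : ℤ) - r) = (s * b₂) ^ ((n : ℤ) - (r + 1 : ℕ)) *
      (b₂ * s ^ (2 * (n : ℤ) - (n + r : ℕ) + 1)) := by
    rw [show 2 * (n : ℤ) - (n + r : ℕ) + 1 = ((n : ℤ) - r) + 1 by push_cast; ring,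
      show (n : ℤ) - (r + 1 : ℕ) = ((n : ℤ) - r) - 1 by push_cast; ring,
      zpow_sub_one₀ (mul_ne_zero hs hb), zpow_add_one₀ hs, mul_zpow s (s * b₂)]
    field_simp
  have e7 : (s * b₂) ^ 2 * b₃ ^ 2 * (s ^ 2) ^ (n + 1) =
      b₂ ^ 2 * b₃ ^ 2 * (s ^ 2) ^ (n + 2) := by ring
  have e8 : (s * b₂) ^ 2 * b₃ ^ 2 * (s ^ 2) ^ (2 * n + 1) =
      b₂ ^ 2 * b₃ ^ 2 * (s ^ 2) ^ (2 * n + 2) := by ring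
  have n7 := zpow_ne_zero ((n : ℤ) - (r + 1 : ℕ)) (mul_ne_zero hs hb)
  have n9 := zpow_ne_zero (2 * (n : ℤ) - (n + r : ℕ) + 1) hs
  rw [e1, e2, e3, e4', e6, e7, e8]
  generalize s ^ (2 * (n : ℤ) - (n + r : ℕ) + 1) = Z at *
  generalize (s * b₂) ^ ((n : ℤ) - (r + 1 : ℕ)) = Z' at *
  generalize qPoch (s ^ 2) (b₁ ^ 2 * b₂ ^ 2 * b₃ ^ 2 * (s ^ 2) ^ (n + r + 1 + 2)) n = X1 at *
  generalize qPoch (s ^ 2) ((s * b₁) ^ 2 * (s * b₂) ^ 2 * b₃ ^ 2 * (s ^ 2) ^ (n + r + 2)) n = X1'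
    at *
  generalize qPoch (s ^ 2) (s ^ 2 * b₂ ^ 2) n = X2 at *
  generalize qPoch (s ^ 2) (s ^ 2 * (s * b₂) ^ 2) n = X2' at *
  generalize qPoch (s ^ 2) (s ^ 2 * (s * b₁) ^ 2) r = X3
  generalize qPoch (s ^ 2) (s ^ 2 * b₃ ^ 2) n = X4 at *
  generalize qPoch (s ^ 2) (b₂ ^ 2 * b₃ ^ 2 * (s ^ 2) ^ (n + 2)) (n + r + 1) = X5 at *
  generalize qPoch (s ^ 2) (s ^ 2) n = X6 at *
  generalize qPoch (s ^ 2) (s ^ 2) r = X7 at *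
  generalize qPoch (s ^ 2) (s ^ 2) (n + r) = X8 at *
  generalize 1 - b₂ ^ 2 * (s ^ 2) ^ (n + 1) = Y1 at *
  generalize 1 - b₂ ^ 2 * b₃ ^ 2 * (s ^ 2) ^ (n + 1) = Y2 at *
  generalize 1 - b₂ ^ 2 * b₃ ^ 2 * (s ^ 2) ^ (2 * n + 1) = Y3 at *
  generalize 1 - b₂ ^ 2 * b₃ ^ 2 * (s ^ 2) ^ (2 * n + 2) = Y4 at *
  generalize 1 - (s ^ 2) ^ (r + 1) = Y5 at *
  generalize 1 - (s ^ 2) ^ (n + r + 1) = Y6 at *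
  generalize 1 - b₁ ^ 2 * b₂ ^ 2 * b₃ ^ 2 * (s ^ 2) ^ (n + (n + r) + 3) = Y7 at *
  generalize 1 - b₁ ^ 2 * b₂ ^ 2 * b₃ ^ 2 * (s ^ 2) ^ (n + r + 3) = Y8 at *
  generalize 1 - s ^ 2 * b₂ ^ 2 = Y9 at *
  generalize 1 - s ^ 2 * b₁ ^ 2 = Y10 at *
  field_simp
  linear_combination (X8 * Y3 * Y6 * Y10 * X3) * (Y7 * X1 * e4 + Y9 * X2' * e5)

theorem Omega_succ' {s b₁ b₂ b₃ : ℂ} (h : GenericTriple s b₁ b₂ b₃) {n M : ℕ} (hn : n ≤ M) :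
    (1 - (s ^ 2) ^ (n + 1)) * (1 - b₁ ^ 2 * (s ^ 2) ^ (M + 1 - n)) *
      (1 - b₂ ^ 2 * b₃ ^ 2 * (s ^ 2) ^ (n + M + 3)) * (1 - b₃ ^ 2 * (s ^ 2) ^ (n + 1)) *
      (1 - b₂ ^ 2 * b₃ ^ 2 * (s ^ 2) ^ (2 * n + 2)) * b₂ *
      Omega s (n + 1) b₁ b₂ b₃ (M + 1) =
    (1 - (s ^ 2) ^ (M + 1)) * (1 - s ^ 2 * b₂ ^ 2) *
      (1 - b₁ ^ 2 * b₂ ^ 2 * b₃ ^ 2 * (s ^ 2) ^ (M + 3)) * (1 - s ^ 2 * b₁ ^ 2) *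
      (1 - b₂ ^ 2 * b₃ ^ 2 * (s ^ 2) ^ (2 * n + 3)) * s ^ (2 * (n : ℤ) - M - 1) *
      Omega s n (s * b₁) (s * b₂) b₃ M := by
  obtain ⟨r, rfl⟩ := Nat.exists_eq_add_of_le hn
  have hO := Omega_add h (n + 1) r
  rw [show n + 1 + r = n + r + 1 by omega] at hO
  rw [Omega_add h.shift₁.shift₂, hO, show n + r + 1 - n = r + 1 by omega]
  have hs := h.s_ne
  have hq := h.q_ne
  have hb := h.b₂_ne
  have n1 := h.root n
  have n2 := h.a₂₃.pow (n + (n + r) + 3)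
  have n3 := qPoch_self_ne h.root r
  have n4 := qPoch_self_ne h.root n
  have n5 := (h.a₂₃.mul_pow hq (n + 2)).qPoch_ne (n + r + 1)
  have n6 := (h.a₃.self_mul hq).qPoch_ne n
  have n8 := h.a₃.pow (n + 1)
  have n10 := h.a₂₃.pow (2 * n + 2)
  have e1 : qPoch (s ^ 2) (s ^ 2) (n + r + 1) =
      qPoch (s ^ 2) (s ^ 2) (n + r) * (1 - (s ^ 2) ^ (n + r + 1)) := by
    rw [qPoch_succ, pow_succ' (s ^ 2)]
  have e2 : qPoch (s ^ 2) (s ^ 2) (n + 1) =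
      qPoch (s ^ 2) (s ^ 2) n * (1 - (s ^ 2) ^ (n + 1)) := by
    rw [qPoch_succ, pow_succ' (s ^ 2)]
  have e3 : qPoch (s ^ 2) (b₂ ^ 2 * b₃ ^ 2 * (s ^ 2) ^ (n + 1 + 1)) (n + r + 1 + 1) =
      qPoch (s ^ 2) (b₂ ^ 2 * b₃ ^ 2 * (s ^ 2) ^ (n + 2)) (n + r + 1) *
        (1 - b₂ ^ 2 * b₃ ^ 2 * (s ^ 2) ^ (n + (n + r) + 3)) := by
    rw [qPoch_succ]; ring
  have e4 : qPoch (s ^ 2) (s ^ 2 * b₂ ^ 2) (n + 1) =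
      (1 - s ^ 2 * b₂ ^ 2) * qPoch (s ^ 2) (s ^ 2 * (s * b₂) ^ 2) n := by
    rw [qPoch_succ']; ring_nf
  have e4' : (1 - b₁ ^ 2 * (s ^ 2) ^ (r + 1)) * qPoch (s ^ 2) (s ^ 2 * b₁ ^ 2) r =
      (1 - s ^ 2 * b₁ ^ 2) * qPoch (s ^ 2) (s ^ 2 * (s * b₁) ^ 2) r := by
    rw [show s ^ 2 * (s * b₁) ^ 2 = s ^ 2 * b₁ ^ 2 * s ^ 2 by ring, qPoch_shift]; ring
  have e4'' : qPoch (s ^ 2) (s ^ 2 * b₃ ^ 2) (n + 1) =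
      qPoch (s ^ 2) (s ^ 2 * b₃ ^ 2) n * (1 - b₃ ^ 2 * (s ^ 2) ^ (n + 1)) := by
    rw [qPoch_succ]; ring
  have e5 : qPoch (s ^ 2) (b₁ ^ 2 * b₂ ^ 2 * b₃ ^ 2 * (s ^ 2) ^ (n + r + 1 + 2)) (n + 1) =
      (1 - b₁ ^ 2 * b₂ ^ 2 * b₃ ^ 2 * (s ^ 2) ^ (n + r + 3)) *
      qPoch (s ^ 2) ((s * b₁) ^ 2 * (s * b₂) ^ 2 * b₃ ^ 2 * (s ^ 2) ^ (n + r + 2)) n := by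
    rw [qPoch_succ']; ring_nf
  have e6 : (s * (s * b₂)) ^ ((n : ℤ) - r) = (s * b₂) ^ (((n + 1 : ℕ) : ℤ) - r) *
      s ^ (2 * (n : ℤ) - (n + r : ℕ) - 1) / b₂ := by
    rw [show 2 * (n : ℤ) - (n + r : ℕ) - 1 = ((n : ℤ) - r) - 1 by push_cast; ring,
      show ((n + 1 : ℕ) : ℤ) - r = ((n : ℤ) - r) + 1 by push_cast; ring,
      zpow_add_one₀ (mul_ne_zero hs hb), zpow_sub_one₀ hs, mul_zpow s (s * b₂)]
    field_simp
  have e7 : (s * b₂) ^ 2 * b₃ ^ 2 * (s ^ 2) ^ (n + 1) =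
      b₂ ^ 2 * b₃ ^ 2 * (s ^ 2) ^ (n + 2) := by ring
  have e8 : (s * b₂) ^ 2 * b₃ ^ 2 * (s ^ 2) ^ (2 * n + 1) =
      b₂ ^ 2 * b₃ ^ 2 * (s ^ 2) ^ (2 * n + 2) := by ring
  have e9 : 2 * (n + 1) + 1 = 2 * n + 3 := by ring
  have n7 := zpow_ne_zero (((n + 1 : ℕ) : ℤ) - r) (mul_ne_zero hs hb)
  have n9 := zpow_ne_zero (2 * (n : ℤ) - (n + r : ℕ) - 1) hs
  rw [e1, e2, e3, e4, e4'', e5, e6, e7, e8, e9]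
  generalize s ^ (2 * (n : ℤ) - (n + r : ℕ) - 1) = Z at *
  generalize (s * b₂) ^ (((n + 1 : ℕ) : ℤ) - r) = Z' at *
  generalize qPoch (s ^ 2) ((s * b₁) ^ 2 * (s * b₂) ^ 2 * b₃ ^ 2 * (s ^ 2) ^ (n + r + 2)) n = X1'
    at *
  generalize qPoch (s ^ 2) (s ^ 2 * (s * b₂) ^ 2) n = X2' at *
  generalize qPoch (s ^ 2) (s ^ 2 * (s * b₁) ^ 2) r = X3' at *
  generalize qPoch (s ^ 2) (s ^ 2 * b₁ ^ 2) r = X3 at *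
  generalize qPoch (s ^ 2) (s ^ 2 * b₃ ^ 2) n = X4 at *
  generalize qPoch (s ^ 2) (b₂ ^ 2 * b₃ ^ 2 * (s ^ 2) ^ (n + 2)) (n + r + 1) = X5 at *
  generalize qPoch (s ^ 2) (s ^ 2) n = X6 at *
  generalize qPoch (s ^ 2) (s ^ 2) r = X7 at *
  generalize qPoch (s ^ 2) (s ^ 2) (n + r) = X8 at *
  generalize 1 - b₃ ^ 2 * (s ^ 2) ^ (n + 1) = Y1 at *
  generalize 1 - b₁ ^ 2 * (s ^ 2) ^ (r + 1) = Y2 at *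
  generalize 1 - b₂ ^ 2 * b₃ ^ 2 * (s ^ 2) ^ (2 * n + 3) = Y3 at *
  generalize 1 - b₂ ^ 2 * b₃ ^ 2 * (s ^ 2) ^ (2 * n + 2) = Y4 at *
  generalize 1 - (s ^ 2) ^ (n + 1) = Y5 at *
  generalize 1 - (s ^ 2) ^ (n + r + 1) = Y6 at *
  generalize 1 - b₂ ^ 2 * b₃ ^ 2 * (s ^ 2) ^ (n + (n + r) + 3) = Y7 at *
  generalize 1 - b₁ ^ 2 * b₂ ^ 2 * b₃ ^ 2 * (s ^ 2) ^ (n + r + 3) = Y8 at *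
  generalize 1 - s ^ 2 * b₂ ^ 2 = Y9 at *
  generalize 1 - s ^ 2 * b₁ ^ 2 = Y10 at *
  field_simp
  linear_combination (X8 * Y6 * Y3 * Y9 * X2' * Y8 * X1') * e4'

theorem qRacah_lower_b₁_M {s b₁ b₂ b₃ : ℂ} (h : GenericTriple s b₁ b₂ b₃) (n x M : ℕ) :
    (1 - (s ^ 2) ^ (M + 1 - n)) * (1 - b₂ ^ 2 * b₃ ^ 2 * (s ^ 2) ^ (n + M + 2)) *
      (1 - b₁ ^ 2 * b₂ ^ 2 * (s ^ 2) ^ (2 * x + 1)) * qRacah s n x b₁ b₂ b₃ (M + 1) =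
    (1 - s ^ 2 * b₁ ^ 2) * (s * b₂) *
      ((s ^ 2) ^ x * (1 - (s ^ 2) ^ (M + 1 - x)) * (1 - b₁ ^ 2 * b₂ ^ 2 * (s ^ 2) ^ (x + 1)) *
          qRacah s n x (s * b₁) b₂ b₃ M +
        (1 - (s ^ 2) ^ x) * (1 - b₁ ^ 2 * b₂ ^ 2 * (s ^ 2) ^ (M + x + 2)) *
          qRacah s n (x - 1) (s * b₁) b₂ b₃ M) := by
  -- For `n > M` the truncated `M + 1 - n` is `0`, so the coefficient on the left vanishes even when
  -- `n = M + 1`, where the polynomial itself need not.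
  rcases lt_or_ge M n with hn | hn
  · rw [qRacah_of_lt_left s hn, qRacah_of_lt_left s hn, Nat.sub_eq_zero_of_le hn]
    simp
  rcases lt_or_ge (M + 1) x with hx | hx
  · rw [qRacah_of_lt_right s hx, qRacah_of_lt_right s (show M < x - 1 by omega),
      qRacah_of_lt_right s (show M < x by omega)]
    simp
  have hq := h.q_ne
  have e1 := one_sub_mul_qRacah s hn hx (s * b₁) b₂ b₃
  have e2 := one_sub_mul_qRacah_pred h.s_ne hn hx (s * b₁) b₂ b₃
  have e3 := Omega_lower_b₁_M h hn
  have e4 := racahPhi_lower_d₁_M (d₁ := b₁ ^ 2) (d₂ := b₂ ^ 2) (d₃ := b₃ ^ 2) hq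
    (pow_ne_zero x hq) h.root hn
  rw [qRacah_eq s (hn.trans (Nat.le_succ M)) hx]
  rw [mul_pow] at e1 e2
  have e5 : (s ^ 2) ^ x * (s ^ 2) ^ (M + 1 - x) = (s ^ 2) ^ (M + 1) := by
    rw [← pow_add]; congr 1; omega
  -- The series relation carries `1 - q^{M+1}` on its left side; it is cancelled only after the
  -- relation for `Omega` has been combined with it.
  rw [← mul_right_inj' (h.root M)]
  set p₁ := qRacah s n x (s * b₁) b₂ b₃ M
  set p₂ := qRacah s n (x - 1) (s * b₁) b₂ b₃ M
  set φ := racahPhi (s ^ 2) n ((s ^ 2) ^ x) (b₁ ^ 2) (b₂ ^ 2) (b₃ ^ 2) (M + 1)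
  set φ₁ := racahPhi (s ^ 2) n ((s ^ 2) ^ x) (s ^ 2 * b₁ ^ 2) (b₂ ^ 2) (b₃ ^ 2) M
  set K := (1 - s ^ 2 * b₁ ^ 2) * (s * b₂)
  set Ω := Omega s n (s * b₁) b₂ b₃ M
  set E := 1 - (s ^ 2) ^ (M + 1) with hE
  linear_combination (E * (1 - b₁ ^ 2 * b₂ ^ 2 * (s ^ 2) ^ (2 * x + 1)) * φ) * e3 +
    (E * K * Ω) * e4 -
    E * K * ((s ^ 2) ^ x * (1 - b₁ ^ 2 * b₂ ^ 2 * (s ^ 2) ^ (x + 1))) * e1 -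
    E * K * (1 - b₁ ^ 2 * b₂ ^ 2 * (s ^ 2) ^ (M + x + 2)) * e2 +
    (E * K * Ω * (1 - b₁ ^ 2 * b₂ ^ 2 * (s ^ 2) ^ (x + 1)) * φ₁) * e5

theorem qRacah_lower_b₁ {s b₁ b₂ b₃ : ℂ} (h : GenericTriple s b₁ b₂ b₃) (n : ℕ) {x M : ℕ}
    (hx : x ≤ M) :
    (1 - b₁ ^ 2 * b₂ ^ 2 * b₃ ^ 2 * (s ^ 2) ^ (n + M + 2)) * (1 - b₁ ^ 2 * (s ^ 2) ^ (M + 1 - n)) *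
      (1 - b₁ ^ 2 * b₂ ^ 2 * (s ^ 2) ^ (2 * x + 1)) * qRacah s n x b₁ b₂ b₃ M =
    (1 - s ^ 2 * b₁ ^ 2) *
      ((1 - b₁ ^ 2 * b₂ ^ 2 * b₃ ^ 2 * (s ^ 2) ^ (M + x + 2)) *
          (1 - b₁ ^ 2 * b₂ ^ 2 * (s ^ 2) ^ (x + 1)) * qRacah s n x (s * b₁) b₂ b₃ M +
        b₁ ^ 2 * b₂ ^ 2 * (s ^ 2) ^ (x + 1) * (1 - (s ^ 2) ^ x) *
          (1 - b₃ ^ 2 * (s ^ 2) ^ (M + 1 - x)) * qRacah s n (x - 1) (s * b₁) b₂ b₃ M) := by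
  rcases lt_or_ge M n with hn | hn
  · simp [qRacah_of_lt_left s hn]
  have hq := h.q_ne
  have e1 := qRacah_eq s hn hx (s * b₁) b₂ b₃
  have e2 := one_sub_mul_qRacah_pred h.s_ne hn (hx.trans (Nat.le_succ M)) (s * b₁) b₂ b₃
  have e3 := Omega_lower_b₁ h hn
  have e4 := racahPhi_lower_d₁ (d₁ := b₁ ^ 2) (d₂ := b₂ ^ 2) (d₃ := b₃ ^ 2) hq
    (pow_ne_zero x hq) h.a₁₂₃ n M
  rw [qRacah_eq s hn hx]
  rw [mul_pow] at e1 e2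
  have e5 : (s ^ 2) ^ x * (s ^ 2) ^ (M + 1 - x) = (s ^ 2) ^ (M + 1) := by
    rw [← pow_add]; congr 1; omega
  rw [← mul_right_inj' (h.a₁₂₃.pow (M + 2))]
  set p₁ := qRacah s n x (s * b₁) b₂ b₃ M
  set p₂ := qRacah s n (x - 1) (s * b₁) b₂ b₃ M
  set φ := racahPhi (s ^ 2) n ((s ^ 2) ^ x) (b₁ ^ 2) (b₂ ^ 2) (b₃ ^ 2) M
  set φ₁ := racahPhi (s ^ 2) n ((s ^ 2) ^ x) (s ^ 2 * b₁ ^ 2) (b₂ ^ 2) (b₃ ^ 2) M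
  set φ₂ := racahPhi (s ^ 2) n ((s ^ 2) ^ x / s ^ 2) (s ^ 2 * b₁ ^ 2) (b₂ ^ 2) (b₃ ^ 2) M
  set K := 1 - s ^ 2 * b₁ ^ 2
  set Ω := Omega s n (s * b₁) b₂ b₃ M
  set E := 1 - b₁ ^ 2 * b₂ ^ 2 * b₃ ^ 2 * (s ^ 2) ^ (M + 2) with hE
  linear_combination (E * (1 - b₁ ^ 2 * b₂ ^ 2 * (s ^ 2) ^ (2 * x + 1)) * φ) * e3 +
    (E * K * Ω) * e4 -
    E * K * ((1 - b₁ ^ 2 * b₂ ^ 2 * b₃ ^ 2 * (s ^ 2) ^ (M + x + 2)) *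
          (1 - b₁ ^ 2 * b₂ ^ 2 * (s ^ 2) ^ (x + 1))) * e1 -
    E * K * (b₁ ^ 2 * b₂ ^ 2 * (s ^ 2) ^ (x + 1) *
          (1 - b₃ ^ 2 * (s ^ 2) ^ (M + 1 - x))) * e2 +
    (E * K * Ω * φ₂ * (b₁ ^ 2 * b₂ ^ 2 * s ^ 2 * (1 - (s ^ 2) ^ x)) * b₃ ^ 2) * e5

theorem qRacah_succ {s b₁ b₂ b₃ : ℂ} (h : GenericTriple s b₁ b₂ b₃) (n x M : ℕ) :
    (1 - (s ^ 2) ^ (n + 1)) * (1 - b₂ ^ 2 * b₃ ^ 2 * (s ^ 2) ^ (n + 2)) * (1 - s ^ 2 * b₃ ^ 2) *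
      (s * b₂) * s ^ ((M : ℤ) - 2 * n) *
      (1 - b₁ ^ 2 * b₂ ^ 2 * (s ^ 2) ^ (2 * x + 1)) * qRacah s (n + 1) x b₁ b₂ b₃ (M + 1) =
    (1 - (s ^ 2) ^ (M + 1 - x)) * (1 - b₂ ^ 2 * (s ^ 2) ^ (x + 1)) *
      (1 - b₁ ^ 2 * b₂ ^ 2 * b₃ ^ 2 * (s ^ 2) ^ (M + x + 3)) *
      (1 - b₁ ^ 2 * b₂ ^ 2 * (s ^ 2) ^ (x + 1)) * qRacah s n x b₁ (s * b₂) (s * b₃) M -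
    s ^ 2 * b₂ ^ 2 * (1 - b₁ ^ 2 * b₂ ^ 2 * (s ^ 2) ^ (M + x + 2)) * (1 - b₁ ^ 2 * (s ^ 2) ^ x) *
      (1 - b₃ ^ 2 * (s ^ 2) ^ (M + 2 - x)) * (1 - (s ^ 2) ^ x) *
      qRacah s n (x - 1) b₁ (s * b₂) (s * b₃) M := by
  rcases lt_or_ge M n with hn | hn
  · simp [qRacah_of_lt_left s hn, qRacah_of_lt_left s (Nat.succ_lt_succ hn)]
  rcases lt_or_ge (M + 1) x with hx | hx
  · rw [qRacah_of_lt_right s hx, qRacah_of_lt_right s (show M < x - 1 by omega),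
      qRacah_of_lt_right s (show M < x by omega)]
    simp
  have hq := h.q_ne
  have e1 := one_sub_mul_qRacah s hn hx b₁ (s * b₂) (s * b₃)
  have e2 := one_sub_mul_qRacah_pred h.s_ne hn hx b₁ (s * b₂) (s * b₃)
  have e3 := Omega_succ h hn
  have e4 := racahPhi_succ (d₁ := b₁ ^ 2) (d₂ := b₂ ^ 2) (d₃ := b₃ ^ 2) hq
    (pow_ne_zero x hq) h.root h.a₂ h.a₁₂₃ hn
  rw [qRacah_eq s (Nat.succ_le_succ hn) hx]
  rw [mul_pow, mul_pow] at e1 e2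
  have e5 : (s ^ 2) ^ (M + 1) / (s ^ 2) ^ x = (s ^ 2) ^ (M + 1 - x) := by
    rw [div_eq_iff (pow_ne_zero x hq), ← pow_add]; congr 1; omega
  have e6 : (s ^ 2) ^ (M + 2) / (s ^ 2) ^ x = (s ^ 2) ^ (M + 2 - x) := by
    rw [div_eq_iff (pow_ne_zero x hq), ← pow_add]; congr 1; omega
  rw [mul_div_assoc, e5, e6] at e4
  set p₁ := qRacah s n x b₁ (s * b₂) (s * b₃) M
  set p₂ := qRacah s n (x - 1) b₁ (s * b₂) (s * b₃) M
  set φ := racahPhi (s ^ 2) (n + 1) ((s ^ 2) ^ x) (b₁ ^ 2) (b₂ ^ 2) (b₃ ^ 2) (M + 1)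
  set Ω := Omega s n b₁ (s * b₂) (s * b₃) M
  set Ω₁ := Omega s (n + 1) b₁ b₂ b₃ (M + 1)
  set w := (s ^ 2) ^ (M + 1 - x)
  set w' := (s ^ 2) ^ (M + 2 - x)
  linear_combination ((1 - b₁ ^ 2 * b₂ ^ 2 * (s ^ 2) ^ (2 * x + 1)) * φ) * e3 +
    Ω * e4 - ((1 - b₂ ^ 2 * (s ^ 2) ^ (x + 1)) *
      (1 - b₁ ^ 2 * b₂ ^ 2 * b₃ ^ 2 * (s ^ 2) ^ (M + x + 3)) *
      (1 - b₁ ^ 2 * b₂ ^ 2 * (s ^ 2) ^ (x + 1))) * e1 +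
    (s ^ 2 * b₂ ^ 2 * (1 - b₁ ^ 2 * b₂ ^ 2 * (s ^ 2) ^ (M + x + 2)) *
      (1 - b₁ ^ 2 * (s ^ 2) ^ x) * (1 - b₃ ^ 2 * w')) * e2

/-- In the step lowering `x` it contracts the two values of `P` at `a` and `a + 1` produced by
summation by parts. -/
theorem qRacah_raise_b₁ {s b₁ b₂ b₃ : ℂ} (h : GenericTriple s b₁ b₂ b₃) (n : ℕ) {x M : ℕ}
    (hx : x ≤ M) :
    (1 - b₂ ^ 2 * (s ^ 2) ^ (x + 1)) * (1 - b₁ ^ 2 * b₂ ^ 2 * b₃ ^ 2 * (s ^ 2) ^ (M + x + 3)) *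
      qRacah s n (x + 1) b₁ b₂ b₃ (M + 1) +
    s ^ 2 * b₂ ^ 2 * ((s ^ 2) ^ x - b₃ ^ 2 * (s ^ 2) ^ (M + 1)) * (1 - b₁ ^ 2 * (s ^ 2) ^ (x + 1)) *
      qRacah s n x b₁ b₂ b₃ (M + 1) =
    (1 - s ^ 2 * b₁ ^ 2) * (s * b₂) * (1 - b₁ ^ 2 * b₂ ^ 2 * (s ^ 2) ^ (2 * x + 2)) *
      qRacah s n x (s * b₁) b₂ b₃ M := by
  rcases lt_or_ge (M + 1) n with hn | hn
  · simp [qRacah_of_lt_left s hn, qRacah_of_lt_left s (show M < n by omega)]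
  have hq := h.q_ne
  -- As `x ≤ M`, the symbol `(q^{-x};q)_{M+1}` vanishes, so the boundary degree `n = M + 1` is
  -- covered as well.
  have hz : n ≤ M ∨ qPoch (s ^ 2) ((s ^ 2) ^ x)⁻¹ (M + 1) = 0 :=
    Or.inr (qPoch_inv_pow_eq_zero hq (Nat.lt_succ_of_le hx))
  have e4 := racahPhi_raise_d₁ (d₁ := b₁ ^ 2) (d₂ := b₂ ^ 2) (d₃ := b₃ ^ 2) hq
    (pow_ne_zero x hq) h.root h.a₂ h.a₁₂₃ hn hz
  rw [qRacah_eq s hn (Nat.succ_le_succ hx), qRacah_eq s hn (hx.trans (Nat.le_succ M)),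
    ← mul_right_inj' (h.root M), pow_succ _ x]
  set φ := racahPhi (s ^ 2) n ((s ^ 2) ^ x) (b₁ ^ 2) (b₂ ^ 2) (b₃ ^ 2) (M + 1)
  set φ' := racahPhi (s ^ 2) n ((s ^ 2) ^ x * s ^ 2) (b₁ ^ 2) (b₂ ^ 2) (b₃ ^ 2) (M + 1)
  set Ω := Omega s n b₁ b₂ b₃ (M + 1)
  rcases hn.lt_or_eq with hn' | rfl
  · have hn'' := Nat.lt_succ_iff.1 hn'
    have e3 := Omega_lower_b₁_M h hn''
    have e1 := qRacah_eq s hn'' hx (s * b₁) b₂ b₃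
    rw [mul_pow] at e1
    have e5 : (s ^ 2) ^ (M + 1) / (s ^ 2) ^ n = (s ^ 2) ^ (M + 1 - n) := by
      rw [div_eq_iff (pow_ne_zero n hq), ← pow_add]; congr 1; omega
    rw [e5] at e4
    rw [e1]
    linear_combination Ω * e4 + (1 - b₁ ^ 2 * b₂ ^ 2 * (s ^ 2) ^ (2 * x + 2)) *
      (racahPhi (s ^ 2) n ((s ^ 2) ^ x) (s ^ 2 * b₁ ^ 2) (b₂ ^ 2) (b₃ ^ 2) M) * e3
  · rw [div_self (pow_ne_zero _ hq)] at e4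
    rw [qRacah_of_lt_left s (Nat.lt_succ_self M)]
    linear_combination Ω * e4

/-! ### Lowering the variable: the dual of lowering the degree. -/

/-- This is `racahPhi_succ` with degree and variable exchanged by `racahPhi_swap`: shifting the
argument `z = q^n` to `z / q` now lowers the degree from `n` to `n - 1`. -/
theorem Omega_mul_racahPhi_succ {s b₁ b₂ b₃ : ℂ} (h : GenericTriple s b₁ b₂ b₃) {n x M : ℕ}
    (hn : n ≤ M + 1) (hx : x ≤ M) :
    (1 - (s ^ 2) ^ (M + 1)) * (1 - s ^ 2 * b₂ ^ 2) *
      (1 - b₁ ^ 2 * b₂ ^ 2 * b₃ ^ 2 * (s ^ 2) ^ (M + 3)) *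
      (1 - b₂ ^ 2 * b₃ ^ 2 * (s ^ 2) ^ (2 * n + 1)) * qRacah s n (x + 1) b₁ b₂ b₃ (M + 1) =
    Omega s n b₁ b₂ b₃ (M + 1) *
    ((1 - (s ^ 2) ^ (M + 1 - n)) * (1 - b₂ ^ 2 * (s ^ 2) ^ (n + 1)) *
      (1 - b₁ ^ 2 * b₂ ^ 2 * b₃ ^ 2 * (s ^ 2) ^ (n + M + 3)) *
      (1 - b₂ ^ 2 * b₃ ^ 2 * (s ^ 2) ^ (n + 1)) *
      racahPhi (s ^ 2) n ((s ^ 2) ^ x) (s ^ 2 * b₁ ^ 2) (s ^ 2 * b₂ ^ 2) (b₃ ^ 2) M -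
    s ^ 2 * b₂ ^ 2 * (1 - b₂ ^ 2 * b₃ ^ 2 * (s ^ 2) ^ (n + M + 2)) *
      (1 - b₃ ^ 2 * (s ^ 2) ^ n) * (1 - b₁ ^ 2 * (s ^ 2) ^ (M + 2 - n)) * (1 - (s ^ 2) ^ n) *
      racahPhi (s ^ 2) (n - 1) ((s ^ 2) ^ x) (s ^ 2 * b₁ ^ 2) (s ^ 2 * b₂ ^ 2) (b₃ ^ 2) M) := by
  have hq := h.q_ne
  have e4 := racahPhi_succ (d₁ := b₃ ^ 2) (d₂ := b₂ ^ 2) (d₃ := b₁ ^ 2) hq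
    (pow_ne_zero n hq) h.root h.a₂ h.swap.a₁₂₃ hx
  have e5 : (s ^ 2) ^ (M + 1) / (s ^ 2) ^ n = (s ^ 2) ^ (M + 1 - n) := by
    rw [div_eq_iff (pow_ne_zero n hq), ← pow_add]; congr 1; omega
  have e6 : (s ^ 2) ^ (M + 2) / (s ^ 2) ^ n = (s ^ 2) ^ (M + 2 - n) := by
    rw [div_eq_iff (pow_ne_zero n hq), ← pow_add]; congr 1; omega
  have e7 : (1 - (s ^ 2) ^ n) *
      racahPhi (s ^ 2) x ((s ^ 2) ^ n / s ^ 2) (b₃ ^ 2) (s ^ 2 * b₂ ^ 2) (s ^ 2 * b₁ ^ 2) M =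
      (1 - (s ^ 2) ^ n) *
      racahPhi (s ^ 2) (n - 1) ((s ^ 2) ^ x) (s ^ 2 * b₁ ^ 2) (s ^ 2 * b₂ ^ 2) (b₃ ^ 2) M := by
    rcases n with _ | n
    · simp
    · rw [pow_succ _ n, mul_div_cancel_right₀ _ hq, Nat.add_sub_cancel, racahPhi_swap hq]
  rw [mul_div_assoc, e5, e6] at e4
  rw [qRacah_eq s hn (Nat.succ_le_succ hx), racahPhi_swap hq,
    racahPhi_swap hq n x]
  set φ₁ := racahPhi (s ^ 2) x ((s ^ 2) ^ n) (b₃ ^ 2) (s ^ 2 * b₂ ^ 2) (s ^ 2 * b₁ ^ 2) M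
  set φ := racahPhi (s ^ 2) (x + 1) ((s ^ 2) ^ n) (b₃ ^ 2) (b₂ ^ 2) (b₁ ^ 2) (M + 1)
  linear_combination Omega s n b₁ b₂ b₃ (M + 1) * (e4 - (s ^ 2 * b₂ ^ 2 *
    (1 - b₂ ^ 2 * b₃ ^ 2 * (s ^ 2) ^ (n + M + 2)) *
      (1 - b₃ ^ 2 * (s ^ 2) ^ n) * (1 - b₁ ^ 2 * (s ^ 2) ^ (M + 2 - n))) * e7)

theorem Omega_mul_racahPhi {s b₁ b₂ b₃ : ℂ} (h : GenericTriple s b₁ b₂ b₃) {n x M : ℕ}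
    (hn : n ≤ M + 1) (hx : x ≤ M) :
    Omega s n b₁ b₂ b₃ (M + 1) *
    ((1 - (s ^ 2) ^ (M + 1 - n)) * (1 - b₂ ^ 2 * (s ^ 2) ^ (n + 1)) *
      (1 - b₁ ^ 2 * b₂ ^ 2 * b₃ ^ 2 * (s ^ 2) ^ (n + M + 3)) *
      (1 - b₂ ^ 2 * b₃ ^ 2 * (s ^ 2) ^ (n + 1)) *
      racahPhi (s ^ 2) n ((s ^ 2) ^ x) (s ^ 2 * b₁ ^ 2) (s ^ 2 * b₂ ^ 2) (b₃ ^ 2) M) =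
    (1 - (s ^ 2) ^ (M + 1)) * (1 - s ^ 2 * b₂ ^ 2) *
      (1 - b₁ ^ 2 * b₂ ^ 2 * b₃ ^ 2 * (s ^ 2) ^ (M + 3)) *
      (1 - b₂ ^ 2 * b₃ ^ 2 * (s ^ 2) ^ (2 * n + 1)) *
      ((1 - s ^ 2 * b₁ ^ 2) * (b₂ * s ^ (2 * (n : ℤ) - M - 1)) *
      (s ^ 2 * qRacah s n x (s * b₁) (s * b₂) b₃ M /
        (1 - b₂ ^ 2 * b₃ ^ 2 * (s ^ 2) ^ (2 * n + 2)))) := by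
  rcases hn.lt_or_eq with hn' | rfl
  · have hn'' := Nat.lt_succ_iff.1 hn'
    have e3 := Omega_lower_b₁_b₂_M h hn''
    have e6 : s ^ (2 * (n : ℤ) - M + 1) = s ^ (2 * (n : ℤ) - M - 1) * s ^ 2 := by
      rw [← zpow_natCast s 2, ← zpow_add₀ h.s_ne]; congr 1; push_cast; ring
    rw [e6] at e3
    rw [qRacah_eq s hn'' hx, mul_pow, mul_pow]
    have n1 := h.a₂₃.pow (2 * n + 2)
    generalize racahPhi (s ^ 2) n ((s ^ 2) ^ x) (s ^ 2 * b₁ ^ 2) (s ^ 2 * b₂ ^ 2) (b₃ ^ 2) M = φ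
    rw [mul_div_assoc', mul_div_assoc', eq_div_iff n1]
    linear_combination φ * e3
  · simp [qRacah_of_lt_left s (Nat.lt_succ_self M)]

theorem qRacah_zero_succ {s b₁ b₂ b₃ : ℂ} (h : GenericTriple s b₁ b₂ b₃) (x M : ℕ) :
    qRacah s 0 (x + 1) b₁ b₂ b₃ (M + 1) =
      (1 - s ^ 2 * b₁ ^ 2) * (b₂ * s ^ (2 * ((0 : ℕ) : ℤ) - M - 1)) *
      (s ^ 2 * qRacah s 0 x (s * b₁) (s * b₂) b₃ M /
        (1 - b₂ ^ 2 * b₃ ^ 2 * (s ^ 2) ^ (2 * 0 + 2))) := by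
  rcases lt_or_ge M x with hx | hx
  · simp [qRacah_of_lt_right s hx, qRacah_of_lt_right s (Nat.succ_lt_succ hx)]
  have e1 := Omega_mul_racahPhi_succ h (Nat.zero_le _) hx
  have e2 := Omega_mul_racahPhi h (Nat.zero_le _) hx
  have n1 := h.root M
  have n2 := (h.a₂.self_mul h.q_ne).one_sub
  have n3 := h.a₁₂₃.pow (M + 3)
  have n4 := h.a₂₃.pow (2 * 0 + 1)
  rw [← mul_right_inj' (mul_ne_zero (mul_ne_zero (mul_ne_zero n1 n2) n3) n4), ← e2, e1]
  simp

/-- The normalization makes the two coefficients values of one sequence in the degree: up to a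
factor, the right side is `q^{n+1} R(n+1) - q^n R(n)`. This exact difference is what allows
summation by parts over the degree. -/
theorem qRacah_succ_succ {s b₁ b₂ b₃ : ℂ} (h : GenericTriple s b₁ b₂ b₃) (n x M : ℕ) :
    qRacah s (n + 1) (x + 1) b₁ b₂ b₃ (M + 1) =
      (1 - s ^ 2 * b₁ ^ 2) * (b₂ * s ^ (2 * ((n + 1 : ℕ) : ℤ) - M - 1)) *
      (s ^ 2 * qRacah s (n + 1) x (s * b₁) (s * b₂) b₃ M /
        (1 - b₂ ^ 2 * b₃ ^ 2 * (s ^ 2) ^ (2 * (n + 1) + 2)) -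
      qRacah s n x (s * b₁) (s * b₂) b₃ M / (1 - b₂ ^ 2 * b₃ ^ 2 * (s ^ 2) ^ (2 * n + 2))) := by
  rcases lt_or_ge M x with hx | hx
  · simp [qRacah_of_lt_right s hx, qRacah_of_lt_right s (Nat.succ_lt_succ hx)]
  rcases lt_or_ge M n with hn | hn
  · simp [qRacah_of_lt_left s hn, qRacah_of_lt_left s (Nat.succ_lt_succ hn),
      qRacah_of_lt_left s (hn.trans (Nat.lt_succ_self n))]
  have e1 := Omega_mul_racahPhi_succ h (n := n + 1) (Nat.succ_le_succ hn) hx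
  have e2 := Omega_mul_racahPhi h (n := n + 1) (Nat.succ_le_succ hn) hx
  have e3 := Omega_succ' h hn
  have n1 := h.root M
  have n2 := (h.a₂.self_mul h.q_ne).one_sub
  have n3 := h.a₁₂₃.pow (M + 3)
  have n4 := h.a₂₃.pow (2 * (n + 1) + 1)
  have n5 := h.a₂₃.pow (2 * n + 2)
  have e6 : s ^ (2 * ((n + 1 : ℕ) : ℤ) - M - 1) = s ^ (2 * (n : ℤ) - M - 1) * s ^ 2 := by
    rw [← zpow_natCast s 2, ← zpow_add₀ h.s_ne]; congr 1; push_cast; ring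
  rw [← mul_right_inj' (mul_ne_zero (mul_ne_zero (mul_ne_zero n1 n2) n3) n4)]
  rw [e6] at e2 ⊢
  rw [show M + 2 - (n + 1) = M + 1 - n by omega, Nat.add_sub_cancel] at e1
  have e7 : (1 - (s ^ 2) ^ (M + 1)) * (1 - s ^ 2 * b₂ ^ 2) *
      (1 - b₁ ^ 2 * b₂ ^ 2 * b₃ ^ 2 * (s ^ 2) ^ (M + 3)) *
      (1 - b₂ ^ 2 * b₃ ^ 2 * (s ^ 2) ^ (2 * (n + 1) + 1)) *
      ((1 - s ^ 2 * b₁ ^ 2) * (b₂ * (s ^ (2 * (n : ℤ) - M - 1) * s ^ 2)) *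
        (qRacah s n x (s * b₁) (s * b₂) b₃ M / (1 - b₂ ^ 2 * b₃ ^ 2 * (s ^ 2) ^ (2 * n + 2)))) =
      Omega s (n + 1) b₁ b₂ b₃ (M + 1) *
      (s ^ 2 * b₂ ^ 2 * (1 - b₂ ^ 2 * b₃ ^ 2 * (s ^ 2) ^ (n + 1 + M + 2)) *
      (1 - b₃ ^ 2 * (s ^ 2) ^ (n + 1)) * (1 - b₁ ^ 2 * (s ^ 2) ^ (M + 1 - n)) *
      (1 - (s ^ 2) ^ (n + 1)) *
      racahPhi (s ^ 2) n ((s ^ 2) ^ x) (s ^ 2 * b₁ ^ 2) (s ^ 2 * b₂ ^ 2) (b₃ ^ 2) M) := by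
    rw [qRacah_eq s hn hx, mul_pow, mul_pow]
    generalize racahPhi (s ^ 2) n ((s ^ 2) ^ x) (s ^ 2 * b₁ ^ 2) (s ^ 2 * b₂ ^ 2) (b₃ ^ 2) M = φ
    rw [mul_div_assoc', mul_div_assoc', div_eq_iff n5]
    linear_combination -s ^ 2 * b₂ * φ * e3
  linear_combination e1 + e2 + e7

/-! ### Summation of the terminating very-well-poised `₆φ₅`. -/

/-- The summand of a terminating very-well-poised `₆φ₅` series. -/
noncomputable def wpTerm (q A u v w : ℂ) (m a : ℕ) : ℂ :=
  qPoch q q m / (qPoch q q a * qPoch q q (m - a)) *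
    ((1 - A * q ^ (2 * a)) / qPoch q (A * q ^ a) (m + 1)) *
    (qPoch q (A * u * q ^ m) a * qPoch q u (m - a)) * (qPoch q v (m - a) / qPoch q w (m - a)) *
    (v * q ^ m / q) ^ a

theorem wpTerm_lower {q A u v w : ℂ} (hq : q ≠ 0) (hr : ∀ m : ℕ, 1 - q ^ (m + 1) ≠ 0)
    (hA : Avoids q A) (hw : Avoids q w) (a r : ℕ) :
    (1 - q ^ (r + 1)) * (1 - A * q ^ (a + r + 1 + a)) * wpTerm q A u v w (a + r + 1) a =
      (1 - q ^ (a + r + 1)) * ((1 - u) * (1 - v) / (1 - w)) *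
        wpTerm q A (u * q) (v * q) (w * q) (a + r) a := by
  have n3 := qPoch_self_ne hr r
  have n4 := qPoch_self_ne hr a
  have n1 := hr r
  have n5 := (hA.mul_pow hq a).qPoch_ne (a + r + 1)
  have n6 := (hw.mul_self hq).qPoch_ne r
  have n7 := hw.one_sub
  have n8 := hA.pow (a + r + 1 + a)
  have e1 : qPoch q q (a + r + 1) = qPoch q q (a + r) * (1 - q ^ (a + r + 1)) := by
    rw [qPoch_succ, pow_succ' q]
  have e2 : qPoch q q (r + 1) = qPoch q q r * (1 - q ^ (r + 1)) := by
    rw [qPoch_succ, pow_succ' q]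
  have e3 : qPoch q (A * q ^ a) (a + r + 1 + 1) =
      qPoch q (A * q ^ a) (a + r + 1) * (1 - A * q ^ (a + r + 1 + a)) := by
    rw [qPoch_succ]; ring
  rw [wpTerm, wpTerm, show a + r + 1 - a = r + 1 by omega, Nat.add_sub_cancel_left, e1, e2, e3,
    qPoch_succ' q u, qPoch_succ' q v, qPoch_succ' q w,
    show A * (u * q) * q ^ (a + r) = A * u * q ^ (a + r + 1) by ring,
    show v * q * q ^ (a + r) / q = v * q ^ (a + r + 1) / q by ring]
  generalize (v * q ^ (a + r + 1) / q) ^ a = Z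
  generalize qPoch q (A * u * q ^ (a + r + 1)) a = X1
  generalize qPoch q (A * q ^ a) (a + r + 1) = X2 at *
  generalize qPoch q (w * q) r = X3 at *
  generalize qPoch q (v * q) r = X4 at *
  generalize qPoch q (u * q) r = X5 at *
  field_simp

theorem wpTerm_succ {q A u v w : ℂ} (hq : q ≠ 0) (hr : ∀ m : ℕ, 1 - q ^ (m + 1) ≠ 0)
    (hA : Avoids q A) (hw : Avoids q w) (a r : ℕ) :
    q ^ r * (1 - q ^ (a + 1)) * (1 - A * q ^ (a + 1)) * wpTerm q A u v w (a + r + 1) (a + 1) =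
      (1 - q ^ (a + r + 1)) * ((1 - A * u * q ^ (a + r + 1)) * (v * q ^ (2 * (a + r)))) *
        wpTerm q (A * q ^ 2) u v w (a + r) a := by
  have n3 := qPoch_self_ne hr r
  have n4 := qPoch_self_ne hr a
  have n1 := hr a
  have n5 := (hA.mul_pow hq (a + 2)).qPoch_ne (a + r + 1)
  have n6 := hw.qPoch_ne r
  have n8 := hA.pow (a + 1)
  have e1 : qPoch q q (a + r + 1) = qPoch q q (a + r) * (1 - q ^ (a + r + 1)) := by
    rw [qPoch_succ, pow_succ' q]
  have e2 : qPoch q q (a + 1) = qPoch q q a * (1 - q ^ (a + 1)) := by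
    rw [qPoch_succ, pow_succ' q]
  have e3 : qPoch q (A * q ^ (a + 1)) (a + r + 1 + 1) =
      (1 - A * q ^ (a + 1)) * qPoch q (A * q ^ (a + 2)) (a + r + 1) := by
    rw [qPoch_succ']; ring_nf
  have e4 : qPoch q (A * u * q ^ (a + r + 1)) (a + 1) =
      (1 - A * u * q ^ (a + r + 1)) * qPoch q (A * u * q ^ (a + r + 2)) a := by
    rw [qPoch_succ']; ring_nf
  have e5 : q ^ r * (v * q ^ (a + r + 1) / q) ^ (a + 1) =
      (v * q ^ (2 * (a + r))) * (v * q ^ (a + r) / q) ^ a := by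
    rw [show v * q ^ (a + r + 1) / q = (v * q ^ (a + r) / q) * q by ring, mul_pow,
      pow_succ (v * q ^ (a + r) / q)]
    field_simp
    ring
  rw [wpTerm, wpTerm, show a + r + 1 - (a + 1) = r by omega, Nat.add_sub_cancel_left, e1, e2, e3,
    e4, show A * q ^ 2 * u * q ^ (a + r) = A * u * q ^ (a + r + 2) by ring,
    show A * q ^ 2 * q ^ a = A * q ^ (a + 2) by ring,
    show A * q ^ 2 * q ^ (2 * a) = A * q ^ (2 * (a + 1)) by ring]
  generalize (v * q ^ (a + r + 1) / q) ^ (a + 1) = Z at *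
  generalize (v * q ^ (a + r) / q) ^ a = Z' at *
  generalize v * q ^ (2 * (a + r)) = Y at *
  generalize qPoch q (A * u * q ^ (a + r + 2)) a = X1
  generalize qPoch q (A * q ^ (a + 2)) (a + r + 1) = X2 at *
  generalize 1 - A * u * q ^ (a + r + 1) = Y1
  generalize 1 - A * q ^ (2 * (a + 1)) = Y2
  generalize 1 - q ^ (a + r + 1) = Y3
  generalize 1 - A * q ^ (a + 1) = Y4 at *
  generalize 1 - q ^ (a + 1) = Y5 at *
  generalize q ^ r = Q at *
  field_simp
  linear_combination (qPoch q q (a + r) * Y3 * Y2 * Y1 * X1 * qPoch q u r * qPoch q v r) * e5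

/-- Induction on `m`. The factor `(1 - q^{m+1})(1 - A q^{m+1})` is split so that one part vanishes
at `a = m + 1` and the other at `a = 0`. By `wpTerm_lower` and `wpTerm_succ` the parts are sums of
length `m`, one with `u, v` multiplied by `q` and one with `A` multiplied by `q²`; both satisfy the
balancing condition for `m`. -/
theorem sum_wpTerm {q : ℂ} (hq : q ≠ 0) (hr : ∀ m : ℕ, 1 - q ^ (m + 1) ≠ 0) (m : ℕ) :
    ∀ {A u v g : ℂ}, A * u * g * v * q ^ (2 * m) = q → Avoids q A → Avoids q (u * g) →
    ∑ a ∈ Finset.range (m + 1), wpTerm q A u v (u * g) m a =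
      (u * v * q ^ m / q) ^ m * qPoch q g m / qPoch q (u * g) m := by
  induction m with
  | zero =>
    intro A u v g _ hA _
    have := hA.one_sub
    simp [wpTerm, qPoch_zero, qPoch_succ, this]
  | succ m ih =>
    intro A u v g hv hA hw
    have n1 := hr m
    have n2 := hA.pow (m + 1)
    have n3 := hw.one_sub
    set w := u * g with hwd
    have h1 := @ih A (u * q) (v * q) g (by linear_combination hv) hA
      (by rw [mul_right_comm]; exact hw.mul_self hq)
    have h2 := @ih (A * q ^ 2) u v g (by linear_combination hv) (hA.mul_pow hq 2) hw
    rw [mul_right_comm u q g, ← hwd] at h1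
    rw [← hwd] at h2
    let t := wpTerm q A u v w (m + 1)
    let K := (1 - q ^ (m + 1)) * (1 - A * q ^ (m + 1))
    -- With `r = m + 1 - a`, the identity used is `(1 - q^{m+1})(1 - A q^{m+1}) = (1 - q^r)(1 - A
    -- q^{m+1+a}) + q^r (1 - q^a)(1 - A q^a)`.
    have e : K * ∑ a ∈ Finset.range (m + 2), t a =
        (∑ a ∈ Finset.range (m + 2), (1 - q ^ (m + 1 - a)) * (1 - A * q ^ (m + 1 + a)) * t a) +
        ∑ a ∈ Finset.range (m + 2), q ^ (m + 1 - a) * (1 - q ^ a) * (1 - A * q ^ a) * t a := by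
      rw [Finset.mul_sum, ← Finset.sum_add_distrib]
      refine Finset.sum_congr rfl fun a ha => ?_
      obtain ⟨r, hr'⟩ := Nat.exists_eq_add_of_le (Nat.lt_succ_iff.1 (Finset.mem_range.1 ha))
      simp only [K]
      rw [hr', Nat.add_sub_cancel_left]
      ring
    have e1 : ∑ a ∈ Finset.range (m + 2),
        (1 - q ^ (m + 1 - a)) * (1 - A * q ^ (m + 1 + a)) * t a =
        (1 - q ^ (m + 1)) * ((1 - u) * (1 - v) / (1 - w)) *
        ∑ a ∈ Finset.range (m + 1), wpTerm q A (u * q) (v * q) (w * q) m a := by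
      rw [Finset.sum_range_succ, Nat.sub_self, pow_zero, sub_self, zero_mul, zero_mul, add_zero,
        Finset.mul_sum]
      refine Finset.sum_congr rfl fun a ha => ?_
      obtain ⟨r, rfl⟩ := Nat.exists_eq_add_of_le (Nat.lt_succ_iff.1 (Finset.mem_range.1 ha))
      rw [← wpTerm_lower hq hr hA hw, show a + r + 1 - a = r + 1 by omega]
    have e2 : ∑ a ∈ Finset.range (m + 2), q ^ (m + 1 - a) * (1 - q ^ a) * (1 - A * q ^ a) * t a =
        (1 - q ^ (m + 1)) * ((1 - A * u * q ^ (m + 1)) * (v * q ^ (2 * m))) *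
        ∑ a ∈ Finset.range (m + 1), wpTerm q (A * q ^ 2) u v w m a := by
      rw [Finset.sum_range_succ', pow_zero, sub_self, mul_zero, zero_mul, zero_mul, add_zero,
        Finset.mul_sum]
      refine Finset.sum_congr rfl fun a ha => ?_
      obtain ⟨r, rfl⟩ := Nat.exists_eq_add_of_le (Nat.lt_succ_iff.1 (Finset.mem_range.1 ha))
      rw [← wpTerm_succ hq hr hA hw, show a + r + 1 - (a + 1) = r by omega]
    rw [e1, e2, h1, h2] at e
    change ∑ a ∈ Finset.range (m + 2), t a = _
    rw [← mul_right_inj' (mul_ne_zero n1 n2)]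
    change K * _ = _
    rw [e]
    have n4 := hw.qPoch_ne m
    have n5 := hw.pow m
    have n6 := (hw.mul_self hq).qPoch_ne m
    have e3 : qPoch q w (m + 1) = qPoch q w m * (1 - w * q ^ m) := qPoch_succ _ _ _
    have e4 : (1 - w) * qPoch q (w * q) m = qPoch q w m * (1 - w * q ^ m) := qPoch_shift _ _ _
    have e5 : (u * q * (v * q) * q ^ m / q) ^ m = (u * v * q ^ m / q) ^ m * q ^ (2 * m) := by
      rw [show u * q * (v * q) * q ^ m / q = (u * v * q ^ m / q) * q ^ 2 by ring, mul_pow,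
        ← pow_mul]
    have e6 : (u * v * q ^ (m + 1) / q) ^ (m + 1) =
        (u * v * q ^ m / q) ^ m * (q ^ (2 * m) * u * v) := by
      rw [show u * v * q ^ (m + 1) / q = (u * v * q ^ m / q) * q by ring, mul_pow,
        pow_succ (u * v * q ^ m / q), two_mul, pow_add]
      field_simp
      ring
    have e7 : qPoch q (w * q) m = qPoch q w m * (1 - w * q ^ m) / (1 - w) := by
      rw [← e4, mul_div_cancel_left₀ _ n3]
    rw [e3, e5, e6, e7, qPoch_succ q g]
    generalize (u * v * q ^ m / q) ^ m = P
    clear e e1 e2 e3 e4 e5 e6 e7 h1 h2 ih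
    -- The balancing condition enters the comparison of the two closed forms only here.
    have key : (1 - u) * (1 - v) + v * (1 - A * u * q ^ (m + 1)) * (1 - w * q ^ m) =
        (1 - A * q ^ (m + 1)) * (u * v) * (1 - g * q ^ m) := by
      have hv' : A * u * g * v * (q * (q ^ m) ^ 2) = 1 := by
        rw [← mul_right_inj' hq]
        linear_combination hv
      rw [hwd, pow_succ]
      linear_combination (u - 1) * hv'
    field_simp
    linear_combination (P * qPoch q g m) * key

/-! ### Generic quintuples and their symmetries. -/

/-- Square roots of generic parameters satisfying `q^{2N+3} c₀c₁c₂c₃c₄ = 1`. -/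
structure GenericQuintuple (s : ℂ) (N : ℕ) (b₀ b₁ b₂ b₃ b₄ : ℂ) : Prop where
  prod_eq : s ^ (2 * N + 3) * b₀ * b₁ * b₂ * b₃ * b₄ = 1
  root : ∀ m : ℕ, 1 - (s ^ 2) ^ (m + 1) ≠ 0
  a₀ : Avoids (s ^ 2) (b₀ ^ 2)
  a₁ : Avoids (s ^ 2) (b₁ ^ 2)
  a₂ : Avoids (s ^ 2) (b₂ ^ 2)
  a₃ : Avoids (s ^ 2) (b₃ ^ 2)
  a₄ : Avoids (s ^ 2) (b₄ ^ 2)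
  a₀₁ : Avoids (s ^ 2) (b₀ ^ 2 * b₁ ^ 2)
  a₁₂ : Avoids (s ^ 2) (b₁ ^ 2 * b₂ ^ 2)
  a₂₃ : Avoids (s ^ 2) (b₂ ^ 2 * b₃ ^ 2)
  a₃₄ : Avoids (s ^ 2) (b₃ ^ 2 * b₄ ^ 2)
  a₄₀ : Avoids (s ^ 2) (b₄ ^ 2 * b₀ ^ 2)

namespace GenericQuintuple

variable {s b₀ b₁ b₂ b₃ b₄ : ℂ} {N : ℕ}

theorem rotate (h : GenericQuintuple s N b₀ b₁ b₂ b₃ b₄) :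
    GenericQuintuple s N b₁ b₂ b₃ b₄ b₀ where
  prod_eq := by linear_combination h.prod_eq
  root := h.root
  a₀ := h.a₁
  a₁ := h.a₂
  a₂ := h.a₃
  a₃ := h.a₄
  a₄ := h.a₀
  a₀₁ := h.a₁₂
  a₁₂ := h.a₂₃
  a₂₃ := h.a₃₄
  a₃₄ := h.a₄₀
  a₄₀ := h.a₀₁

theorem reflect (h : GenericQuintuple s N b₀ b₁ b₂ b₃ b₄) :
    GenericQuintuple s N b₄ b₃ b₂ b₁ b₀ where
  prod_eq := by linear_combination h.prod_eq
  root := h.root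
  a₀ := h.a₄
  a₁ := h.a₃
  a₂ := h.a₂
  a₃ := h.a₁
  a₄ := h.a₀
  a₀₁ := by rw [mul_comm]; exact h.a₃₄
  a₁₂ := by rw [mul_comm]; exact h.a₂₃
  a₂₃ := by rw [mul_comm]; exact h.a₁₂
  a₃₄ := by rw [mul_comm]; exact h.a₀₁
  a₄₀ := by rw [mul_comm]; exact h.a₄₀

theorem s_ne (h : GenericQuintuple s N b₀ b₁ b₂ b₃ b₄) : s ≠ 0 := by
  rintro rfl
  simpa using h.prod_eq

theorem q_ne (h : GenericQuintuple s N b₀ b₁ b₂ b₃ b₄) : s ^ 2 ≠ 0 := pow_ne_zero _ h.s_ne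

theorem b₀_ne (h : GenericQuintuple s N b₀ b₁ b₂ b₃ b₄) : b₀ ≠ 0 := by
  rintro rfl
  simpa using h.prod_eq

theorem b₁_ne (h : GenericQuintuple s N b₀ b₁ b₂ b₃ b₄) : b₁ ≠ 0 := h.rotate.b₀_ne

theorem b₂_ne (h : GenericQuintuple s N b₀ b₁ b₂ b₃ b₄) : b₂ ≠ 0 := h.rotate.b₁_ne

theorem b₃_ne (h : GenericQuintuple s N b₀ b₁ b₂ b₃ b₄) : b₃ ≠ 0 := h.rotate.b₂_ne

theorem b₄_ne (h : GenericQuintuple s N b₀ b₁ b₂ b₃ b₄) : b₄ ≠ 0 := h.rotate.b₃_ne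

theorem prod_sq_eq (h : GenericQuintuple s N b₀ b₁ b₂ b₃ b₄) :
    (s ^ 2) ^ (2 * N + 3) * b₀ ^ 2 * b₁ ^ 2 * b₂ ^ 2 * b₃ ^ 2 * b₄ ^ 2 = 1 := by
  linear_combination (s ^ (2 * N + 3) * b₀ * b₁ * b₂ * b₃ * b₄ + 1) * h.prod_eq

/-- Only the condition on `c₀c₁c₂` is not among the hypotheses: by the constraint this product is
the inverse of `c₃c₄q^{2N+3}`, and avoiding all integral powers of `q` is stable under inversion. -/
theorem triple (h : GenericQuintuple s N b₀ b₁ b₂ b₃ b₄) : GenericTriple s b₀ b₁ b₂ where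
  s_ne := h.s_ne
  b₁_ne := h.b₀_ne
  b₂_ne := h.b₁_ne
  b₃_ne := h.b₂_ne
  root := h.root
  a₁ := h.a₀
  a₂ := h.a₁
  a₃ := h.a₂
  a₁₂ := h.a₀₁
  a₂₃ := h.a₁₂
  a₁₂₃ := by
    have h1 := (h.a₃₄.mul_pow h.q_ne (2 * N + 3)).inv h.q_ne (mul_ne_zero
      (mul_ne_zero (pow_ne_zero _ h.b₃_ne) (pow_ne_zero _ h.b₄_ne)) (pow_ne_zero _ h.q_ne))
    rwa [inv_eq_of_mul_eq_one_right (a := b₃ ^ 2 * b₄ ^ 2 * (s ^ 2) ^ (2 * N + 3))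
      (b := b₀ ^ 2 * b₁ ^ 2 * b₂ ^ 2) (by linear_combination h.prod_sq_eq)] at h1

/-- The two new factors `s` compensate the drop from `s^{2N+5}` to `s^{2N+3}`. Such shifts of
neighbouring parameters are the moves of the induction. -/
theorem shift₀₁ (h : GenericQuintuple s (N + 1) b₀ b₁ b₂ b₃ b₄) :
    GenericQuintuple s N (s * b₀) (s * b₁) b₂ b₃ b₄ where
  prod_eq := by linear_combination h.prod_eq
  root := h.root
  a₀ := by rw [mul_pow]; exact h.a₀.self_mul h.q_ne
  a₁ := by rw [mul_pow]; exact h.a₁.self_mul h.q_ne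
  a₂ := h.a₂
  a₃ := h.a₃
  a₄ := h.a₄
  a₀₁ := by
    rw [mul_pow, mul_pow, mul_mul_mul_comm, mul_assoc]
    exact (h.a₀₁.self_mul h.q_ne).self_mul h.q_ne
  a₁₂ := by rw [mul_pow, mul_assoc]; exact h.a₁₂.self_mul h.q_ne
  a₂₃ := h.a₂₃
  a₃₄ := h.a₃₄
  a₄₀ := by rw [mul_pow, mul_left_comm]; exact h.a₄₀.self_mul h.q_ne

theorem shift₁₂ (h : GenericQuintuple s (N + 1) b₀ b₁ b₂ b₃ b₄) :
    GenericQuintuple s N b₀ (s * b₁) (s * b₂) b₃ b₄ :=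
  h.rotate.shift₀₁.rotate.rotate.rotate.rotate

theorem shift₃₄ (h : GenericQuintuple s (N + 1) b₀ b₁ b₂ b₃ b₄) :
    GenericQuintuple s N b₀ b₁ b₂ (s * b₃) (s * b₄) :=
  h.rotate.rotate.rotate.shift₀₁.rotate.rotate

theorem shift₄₀ (h : GenericQuintuple s (N + 1) b₀ b₁ b₂ b₃ b₄) :
    GenericQuintuple s N (s * b₀) b₁ b₂ b₃ (s * b₄) :=
  h.rotate.rotate.rotate.rotate.shift₀₁.rotate

end GenericQuintuple

/-! ### Lowering `j` in a product of two neighbouring factors. -/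

/-- Two factors of the convolution, with the first degree lowered by one. -/
theorem qRacah_succ_mul_qRacah {s b₀ b₁ b₂ b₃ b₄ : ℂ} {N : ℕ}
    (h : GenericQuintuple s (N + 1) b₀ b₁ b₂ b₃ b₄) (j : ℕ) {a x y k : ℕ} (ha : a ≤ N)
    (hk : x + y + k = N + 1) :
    (s ^ 2) ^ a * ((1 - (s ^ 2) ^ (j + 1)) * (1 - b₀ ^ 2 * b₄ ^ 2 * (s ^ 2) ^ (j + 2)) *
      (1 - s ^ 2 * b₄ ^ 2) * (s * b₀) * s ^ (((N - a : ℕ) : ℤ) - 2 * j)) *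
      ((1 - b₀ ^ 2 * b₁ ^ 2 * (s ^ 2) ^ (2 * y + 1)) *
        (1 - b₃ ^ 2 * b₄ ^ 2 * (s ^ 2) ^ (2 * x + 1))) *
      (qRacah s (j + 1) y b₁ b₀ b₄ (N + 1 - a) * qRacah s a x b₄ b₃ b₂ (N + 1 - y)) =
    -(b₀ ^ 2 * b₁ ^ 2 * b₄ ^ 2 * (s ^ 2) ^ (N + y + 3)) * (1 - b₀ ^ 2 * (s ^ 2) ^ (y + 1)) *
      (1 - b₀ ^ 2 * b₁ ^ 2 * (s ^ 2) ^ (y + 1)) * (1 - s ^ 2 * b₄ ^ 2) * (s * b₃) *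
      qRacah s j y b₁ (s * b₀) (s * b₄) (N - a) *
      ((s ^ 2) ^ x * (1 - (s ^ 2) ^ k) * (1 - b₃ ^ 2 * b₄ ^ 2 * (s ^ 2) ^ (x + 1)) *
          qRacah s a x (s * b₄) b₃ b₂ (N - y) +
        (1 - (s ^ 2) ^ x) * (1 - b₃ ^ 2 * b₄ ^ 2 * (s ^ 2) ^ (2 * x + k + 1)) *
          qRacah s a (x - 1) (s * b₄) b₃ b₂ (N - y)) +
    s ^ 2 * b₀ ^ 2 * (b₀ ^ 2 * b₁ ^ 2 * (s ^ 2) ^ (N + y + 2)) * (1 - b₁ ^ 2 * (s ^ 2) ^ y) *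
      (1 - (s ^ 2) ^ y) * (1 - s ^ 2 * b₄ ^ 2) * qRacah s j (y - 1) b₁ (s * b₀) (s * b₄) (N - a) *
      ((1 - b₂ ^ 2 * b₃ ^ 2 * b₄ ^ 2 * (s ^ 2) ^ (2 * x + k + 2)) *
          (1 - b₃ ^ 2 * b₄ ^ 2 * (s ^ 2) ^ (x + 1)) * qRacah s a x (s * b₄) b₃ b₂ (N - (y - 1)) +
        b₃ ^ 2 * b₄ ^ 2 * (s ^ 2) ^ (x + 1) * (1 - (s ^ 2) ^ x) *
          (1 - b₂ ^ 2 * (s ^ 2) ^ (k + 1)) *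
          qRacah s a (x - 1) (s * b₄) b₃ b₂ (N - (y - 1))) := by
  -- For `y > 0`, `N - (y - 1)` equals `N + 1 - y`; for `y = 0` the truncated expressions differ,
  -- but the coefficient `1 - q^y` vanishes.
  have hR : (1 - (s ^ 2) ^ y) * qRacah s a x (s * b₄) b₃ b₂ (N - (y - 1)) =
      (1 - (s ^ 2) ^ y) * qRacah s a x (s * b₄) b₃ b₂ (N + 1 - y) := by
    rcases y with _ | y
    · simp
    · simp
  have hR' : (1 - (s ^ 2) ^ y) * qRacah s a (x - 1) (s * b₄) b₃ b₂ (N - (y - 1)) =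
      (1 - (s ^ 2) ^ y) * qRacah s a (x - 1) (s * b₄) b₃ b₂ (N + 1 - y) := by
    rcases y with _ | y
    · simp
    · simp
  rcases lt_or_ge (N + 1 - y) a with ha' | ha'
  · rw [qRacah_of_lt_left s ha'] at hR hR' ⊢
    rw [qRacah_of_lt_left s (show N - y < a by omega), qRacah_of_lt_left s (show N - y < a by omega)]
    linear_combination (exp := 1) -(s ^ 2 * b₀ ^ 2 * (b₀ ^ 2 * b₁ ^ 2 * (s ^ 2) ^ (N + y + 2)) *
      (1 - b₁ ^ 2 * (s ^ 2) ^ y) *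
      (1 - s ^ 2 * b₄ ^ 2) * qRacah s j (y - 1) b₁ (s * b₀) (s * b₄) (N - a)) *
      ((1 - b₂ ^ 2 * b₃ ^ 2 * b₄ ^ 2 * (s ^ 2) ^ (2 * x + k + 2)) *
          (1 - b₃ ^ 2 * b₄ ^ 2 * (s ^ 2) ^ (x + 1)) * hR +
        b₃ ^ 2 * b₄ ^ 2 * (s ^ 2) ^ (x + 1) * (1 - (s ^ 2) ^ x) *
          (1 - b₂ ^ 2 * (s ^ 2) ^ (k + 1)) * hR')
  obtain ⟨r, hr⟩ : ∃ r, a + r = x + k := Nat.exists_eq_add_of_le (by omega) |>.imp fun _ h => h.symm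
  have tQ : GenericTriple s b₁ b₀ b₄ := h.rotate.rotate.rotate.rotate.triple.swap
  have tR : GenericTriple s b₄ b₃ b₂ := h.reflect.triple
  have eQ := qRacah_succ tQ j y (N - a)
  have eR : (1 - (s ^ 2) ^ r) * (1 - b₃ ^ 2 * b₂ ^ 2 * (s ^ 2) ^ (2 * a + r + 1)) *
      (1 - b₄ ^ 2 * b₃ ^ 2 * (s ^ 2) ^ (2 * x + 1)) * qRacah s a x b₄ b₃ b₂ (N + 1 - y) =
    (1 - s ^ 2 * b₄ ^ 2) * (s * b₃) *
      ((s ^ 2) ^ x * (1 - (s ^ 2) ^ k) * (1 - b₄ ^ 2 * b₃ ^ 2 * (s ^ 2) ^ (x + 1)) *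
          qRacah s a x (s * b₄) b₃ b₂ (N - y) +
        (1 - (s ^ 2) ^ x) * (1 - b₄ ^ 2 * b₃ ^ 2 * (s ^ 2) ^ (2 * x + k + 1)) *
          qRacah s a (x - 1) (s * b₄) b₃ b₂ (N - y)) := by
    -- If `y = N + 1`, the truncated `N - y` is no longer one less than `N + 1 - y`. Then `x = k = r
    -- = 0`, and every coefficient in the relation vanishes.
    rcases lt_or_ge N y with hy | hy
    · obtain rfl : x = 0 := by omega
      obtain rfl : k = 0 := by omega
      obtain rfl : r = 0 := by omega
      simp
    · have := qRacah_lower_b₁_M tR a x (N - y)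
      rwa [show N - y + 1 = N + 1 - y by omega, show N + 1 - y - a = r by omega,
        show N + 1 - y - x = k by omega, show a + (N - y) + 2 = 2 * a + r + 1 by omega,
        show N - y + x + 2 = 2 * x + k + 1 by omega] at this
  have eR' := qRacah_lower_b₁ tR a (x := x) (M := N + 1 - y) (by omega)
  rw [show a + (N + 1 - y) + 2 = 2 * a + r + 2 by omega, show N + 1 - y + 1 - a = r + 1 by omega,
    show N + 1 - y + x + 2 = 2 * x + k + 2 by omega,
    show N + 1 - y + 1 - x = k + 1 by omega] at eR'
  rw [show N - a + 1 = N + 1 - a by omega, show N + 1 - a - y = r by omega,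
    show N - a + y + 3 = 2 * y + r + 2 by omega, show N - a + y + 2 = 2 * y + r + 1 by omega,
    show N - a + 2 - y = r + 1 by omega] at eQ
  have hp := h.prod_sq_eq
  -- The decisive use of the constraint: `hp1` and `hp2` turn the `a`-dependent coefficients of the
  -- relation `eQ` into those multiplying `R` in `eR` and `eR'`. The first term of `eQ` is thereby
  -- matched to the relation that lowers the size, the second to the one that keeps it.
  have hp1 : (s ^ 2) ^ a * (1 - b₁ ^ 2 * b₀ ^ 2 * b₄ ^ 2 * (s ^ 2) ^ (2 * y + r + 2)) =
      -(b₀ ^ 2 * b₁ ^ 2 * b₄ ^ 2 * (s ^ 2) ^ (N + y + 3)) *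
        (1 - b₃ ^ 2 * b₂ ^ 2 * (s ^ 2) ^ (2 * a + r + 1)) := by
    have e1 : (s ^ 2) ^ (N + y + 3) = (s ^ 2) ^ a * (s ^ 2) ^ (2 * y + r + 2) := by
      rw [← pow_add]; congr 1; omega
    have e2 : (s ^ 2) ^ (2 * (N + 1) + 3) =
        (s ^ 2) ^ (2 * y + r + 2) * (s ^ 2) ^ (2 * a + r + 1) := by
      rw [← pow_add]; congr 1; omega
    rw [e2] at hp
    rw [e1]
    linear_combination (-(s ^ 2) ^ a) * hp
  have hp2 : (s ^ 2) ^ a * (1 - b₁ ^ 2 * b₀ ^ 2 * (s ^ 2) ^ (2 * y + r + 1)) =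
      -(b₀ ^ 2 * b₁ ^ 2 * (s ^ 2) ^ (N + y + 2)) *
        (1 - b₄ ^ 2 * b₃ ^ 2 * b₂ ^ 2 * (s ^ 2) ^ (2 * a + r + 2)) := by
    have e1 : (s ^ 2) ^ (N + y + 2) = (s ^ 2) ^ a * (s ^ 2) ^ (2 * y + r + 1) := by
      rw [← pow_add]; congr 1; omega
    have e2 : (s ^ 2) ^ (2 * (N + 1) + 3) =
        (s ^ 2) ^ (2 * y + r + 1) * (s ^ 2) ^ (2 * a + r + 2) := by
      rw [← pow_add]; congr 1; omega
    rw [e2] at hp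
    rw [e1]
    linear_combination (-(s ^ 2) ^ a) * hp
  clear hp
  rw [show b₁ ^ 2 * b₀ ^ 2 = b₀ ^ 2 * b₁ ^ 2 by ring] at eQ hp1 hp2
  rw [show b₄ ^ 2 * b₃ ^ 2 * b₂ ^ 2 = b₂ ^ 2 * b₃ ^ 2 * b₄ ^ 2 by ring] at eR' hp2
  rw [show b₄ ^ 2 * b₃ ^ 2 = b₃ ^ 2 * b₄ ^ 2 by ring] at eR eR'
  generalize 1 - b₀ ^ 2 * b₁ ^ 2 * b₄ ^ 2 * (s ^ 2) ^ (2 * y + r + 2) = f1 at *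
  generalize 1 - b₃ ^ 2 * b₂ ^ 2 * (s ^ 2) ^ (2 * a + r + 1) = f2 at *
  generalize 1 - b₀ ^ 2 * b₁ ^ 2 * (s ^ 2) ^ (2 * y + r + 1) = f3 at *
  generalize 1 - b₂ ^ 2 * b₃ ^ 2 * b₄ ^ 2 * (s ^ 2) ^ (2 * a + r + 2) = f4 at *
  generalize b₀ ^ 2 * b₁ ^ 2 * b₄ ^ 2 * (s ^ 2) ^ (N + y + 3) = g1 at *
  generalize b₀ ^ 2 * b₁ ^ 2 * (s ^ 2) ^ (N + y + 2) = g2 at *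
  generalize 1 - b₀ ^ 2 * b₁ ^ 2 * (s ^ 2) ^ (y + 1) = f5 at *
  generalize 1 - b₀ ^ 2 * b₁ ^ 2 * (s ^ 2) ^ (2 * y + 1) = f6 at *
  generalize 1 - b₃ ^ 2 * b₄ ^ 2 * (s ^ 2) ^ (2 * x + 1) = f7 at *
  generalize 1 - b₃ ^ 2 * b₄ ^ 2 * (s ^ 2) ^ (x + 1) = f8 at *
  generalize 1 - b₃ ^ 2 * b₄ ^ 2 * (s ^ 2) ^ (2 * x + k + 1) = f9 at *
  generalize 1 - b₂ ^ 2 * b₃ ^ 2 * b₄ ^ 2 * (s ^ 2) ^ (2 * x + k + 2) = f10 at *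
  generalize 1 - b₂ ^ 2 * (s ^ 2) ^ (k + 1) = f11 at *
  generalize b₃ ^ 2 * b₄ ^ 2 * (s ^ 2) ^ (x + 1) = g3 at *
  generalize (1 - (s ^ 2) ^ (j + 1)) * (1 - b₀ ^ 2 * b₄ ^ 2 * (s ^ 2) ^ (j + 2)) *
    (1 - s ^ 2 * b₄ ^ 2) * (s * b₀) * s ^ (((N - a : ℕ) : ℤ) - 2 * j) = κ at *
  generalize 1 - s ^ 2 * b₄ ^ 2 = f12 at *
  generalize 1 - b₀ ^ 2 * (s ^ 2) ^ (y + 1) = f13 at *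
  generalize 1 - b₁ ^ 2 * (s ^ 2) ^ y = f14 at *
  generalize 1 - b₄ ^ 2 * (s ^ 2) ^ (r + 1) = f15 at *
  generalize 1 - (s ^ 2) ^ r = f16 at *
  generalize 1 - (s ^ 2) ^ y = f17 at *
  generalize 1 - (s ^ 2) ^ x = f18 at *
  generalize 1 - (s ^ 2) ^ k = f19 at *
  generalize s ^ 2 * b₀ ^ 2 = g4 at *
  generalize (s ^ 2) ^ a = g5 at *
  generalize (s ^ 2) ^ x = g6 at *
  generalize s * b₃ = g7 at *
  generalize qRacah s j y b₁ (s * b₀) (s * b₄) (N - a) = Q₁ at *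
  generalize qRacah s j (y - 1) b₁ (s * b₀) (s * b₄) (N - a) = Q₂ at *
  generalize qRacah s a x b₄ b₃ b₂ (N + 1 - y) = R at *
  linear_combination g5 * f7 * R * eQ + f16 * f13 * f5 * f7 * Q₁ * R * hp1 -
    g4 * f14 * f15 * f17 * f7 * Q₂ * R * hp2 - g1 * f13 * f5 * Q₁ * eR +
    g4 * g2 * f14 * f17 * Q₂ * eR' - g4 * g2 * f14 * f12 * Q₂ * f10 * f8 * hR -
    g4 * g2 * f14 * f12 * Q₂ * g3 * f18 * f11 * hR'

/-! ### Weights and the convolution. -/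

/-- The weight `(qc₁;q)_n / (qc₂;q)_n * t^n`, with `c₁ = b₁²` and `c₂ = b₂²`. -/
noncomputable def weight (s : ℂ) (n : ℕ) (b₁ b₂ t : ℂ) : ℂ :=
  qPoch (s ^ 2) (s ^ 2 * b₁ ^ 2) n / qPoch (s ^ 2) (s ^ 2 * b₂ ^ 2) n * t ^ n

theorem weight_zero (s b₁ b₂ t : ℂ) : weight s 0 b₁ b₂ t = 1 := by
  simp [weight, qPoch_zero]

/-- Shifting two parameters often multiplies the base of a weight by `s` or its inverse; the
resulting power of `s` absorbs the power left over from a normalization. -/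
theorem weight_mul_right (s : ℂ) (n : ℕ) (b₁ b₂ u t : ℂ) :
    weight s n b₁ b₂ (u * t) = u ^ n * weight s n b₁ b₂ t := by
  rw [weight, weight, mul_pow]
  ring

theorem qPoch_self_mul_shift (q A : ℂ) (n : ℕ) :
    (1 - A * q ^ n) * qPoch q A n = (1 - A) * qPoch q (q * A) n := by
  rw [mul_comm q A, ← qPoch_succ', qPoch_succ, mul_comm]

section

variable {s b₁ b₂ : ℂ}

theorem weight_shift_left (t : ℂ) (n : ℕ) :
    (1 - b₁ ^ 2 * (s ^ 2) ^ (n + 1)) * weight s n b₁ b₂ t =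
      (1 - s ^ 2 * b₁ ^ 2) * weight s n (s * b₁) b₂ t := by
  have := qPoch_self_mul_shift (s ^ 2) (s ^ 2 * b₁ ^ 2) n
  rw [weight, weight, mul_pow s b₁]
  linear_combination (t ^ n / qPoch (s ^ 2) (s ^ 2 * b₂ ^ 2) n) * this

theorem weight_shift_right (hs : s ≠ 0) (h : Avoids (s ^ 2) (b₂ ^ 2)) (t : ℂ) (n : ℕ) :
    (1 - s ^ 2 * b₂ ^ 2) * weight s n b₁ b₂ t =
      (1 - b₂ ^ 2 * (s ^ 2) ^ (n + 1)) * weight s n b₁ (s * b₂) t := by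
  have hq := pow_ne_zero 2 hs
  have := qPoch_self_mul_shift (s ^ 2) (s ^ 2 * b₂ ^ 2) n
  have h1 := (h.self_mul hq).qPoch_ne n
  have h2 := ((h.self_mul hq).self_mul hq).qPoch_ne n
  rw [weight, weight, mul_pow s b₂]
  generalize qPoch (s ^ 2) (s ^ 2 * b₂ ^ 2) n = X at *
  generalize qPoch (s ^ 2) (s ^ 2 * (s ^ 2 * b₂ ^ 2)) n = Y at *
  field_simp
  linear_combination -(t ^ n * qPoch (s ^ 2) (s ^ 2 * b₁ ^ 2) n) * this

theorem weight_succ_shift_left (hs : s ≠ 0) (h : Avoids (s ^ 2) (b₂ ^ 2)) (t : ℂ) (n : ℕ) :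
    (1 - b₂ ^ 2 * (s ^ 2) ^ (n + 1)) * weight s (n + 1) b₁ b₂ t =
      (1 - s ^ 2 * b₁ ^ 2) * t * weight s n (s * b₁) b₂ t := by
  have hq := pow_ne_zero 2 hs
  have h1 := (h.self_mul hq).qPoch_ne n
  have h2 : 1 - s ^ 2 * b₂ ^ 2 * (s ^ 2) ^ n ≠ 0 := ((h.self_mul hq).mul_pow hq n).one_sub
  rw [weight, weight, mul_pow s b₁, qPoch_succ', qPoch_succ (s ^ 2) (s ^ 2 * b₂ ^ 2),
    mul_comm (s ^ 2) (s ^ 2 * b₁ ^ 2), show b₂ ^ 2 * (s ^ 2) ^ (n + 1) = s ^ 2 * b₂ ^ 2 *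
    (s ^ 2) ^ n by ring]
  generalize qPoch (s ^ 2) (s ^ 2 * b₂ ^ 2) n = X at *
  generalize qPoch (s ^ 2) (s ^ 2 * b₁ ^ 2 * s ^ 2) n = Y at *
  generalize s ^ 2 * b₂ ^ 2 * (s ^ 2) ^ n = Z at *
  field_simp
  ring

theorem weight_succ_shift_right (hs : s ≠ 0) (h : Avoids (s ^ 2) (b₂ ^ 2)) (t : ℂ) (n : ℕ) :
    (1 - s ^ 2 * b₂ ^ 2) * weight s (n + 1) b₁ b₂ t =
      (1 - b₁ ^ 2 * (s ^ 2) ^ (n + 1)) * t * weight s n b₁ (s * b₂) t := by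
  have hq := pow_ne_zero 2 hs
  have h2 : 1 - s ^ 2 * b₂ ^ 2 ≠ 0 := (h.self_mul hq).one_sub
  have h1 := ((h.self_mul hq).self_mul hq).qPoch_ne n
  rw [weight, weight, mul_pow s b₂, qPoch_succ, qPoch_succ' (s ^ 2) (s ^ 2 * b₂ ^ 2),
    mul_comm (s ^ 2 * b₂ ^ 2) (s ^ 2)]
  field_simp
  ring

theorem weight_succ_shift (hs : s ≠ 0) (h : Avoids (s ^ 2) (b₂ ^ 2)) (t : ℂ) (n : ℕ) :
    (1 - s ^ 2 * b₂ ^ 2) * weight s (n + 1) b₁ b₂ t =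
      (1 - s ^ 2 * b₁ ^ 2) * t * weight s n (s * b₁) (s * b₂) t := by
  have hq := pow_ne_zero 2 hs
  have h2 : 1 - s ^ 2 * b₂ ^ 2 ≠ 0 := (h.self_mul hq).one_sub
  have h1 := ((h.self_mul hq).self_mul hq).qPoch_ne n
  rw [weight, weight, mul_pow s b₂, mul_pow s b₁, qPoch_succ',
    qPoch_succ' (s ^ 2) (s ^ 2 * b₂ ^ 2), mul_comm (s ^ 2 * b₂ ^ 2) (s ^ 2),
    mul_comm (s ^ 2 * b₁ ^ 2) (s ^ 2)]
  field_simp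
  ring

end

/-- The convolution of `q`-Racah polynomials in the pentagon identity. -/
noncomputable def convolution (s b₀ b₁ b₂ b₃ b₄ : ℂ) (N i j x y : ℕ) : ℂ :=
  ∑ a ∈ Finset.range (N + 1), qRacah s i a b₃ b₂ b₁ (N - j) * qRacah s j y b₁ b₀ b₄ (N - a) *
    qRacah s a x b₄ b₃ b₂ (N - y) * weight s a b₂ b₃ (b₁ * b₃ / (b₄ * b₂))

/-- The pentagon identity for given degrees and variables. -/
def PentagonAt (s b₀ b₁ b₂ b₃ b₄ : ℂ) (N i j x y : ℕ) : Prop :=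
  convolution s b₀ b₁ b₂ b₃ b₄ N i j x y *
    (weight s i b₁ b₂ (b₀ * b₂ / (b₁ * b₃)) * weight s j b₄ b₀ (b₀ * b₃ / (b₁ * b₄)) *
      weight s y b₀ b₁ (b₄ * b₁ / (b₂ * b₀)) * weight s x b₃ b₄ (b₂ * b₄ / (b₀ * b₃))) =
  qRacah s j x b₃ b₄ b₀ (N - i) * qRacah s i y b₀ b₁ b₂ (N - x)

/-- Outside the admissible range both sides vanish by convention. The induction hypothesis can thus
be invoked without range conditions, for example at `x + y = N + 1` for size `N`. -/
theorem pentagonAt_of_lt_left (s b₀ b₁ b₂ b₃ b₄ : ℂ) {N i j : ℕ} (x y : ℕ) (hij : N < i + j) :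
    PentagonAt s b₀ b₁ b₂ b₃ b₄ N i j x y := by
  rw [PentagonAt, convolution, Finset.sum_eq_zero, zero_mul, eq_comm]
  · rcases lt_or_ge (N - i) j with h | h
    · rw [qRacah_of_lt_left s h, zero_mul]
    · rw [qRacah_of_lt_left s (show N - x < i by omega), mul_zero]
  · intro a _
    rcases lt_or_ge (N - j) i with h | h
    · simp [qRacah_of_lt_left s h]
    · simp [qRacah_of_lt_left s (show N - a < j by omega)]

theorem pentagonAt_of_lt_right (s b₀ b₁ b₂ b₃ b₄ : ℂ) {N x y : ℕ} (i j : ℕ) (hxy : N < x + y) :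
    PentagonAt s b₀ b₁ b₂ b₃ b₄ N i j x y := by
  rw [PentagonAt, convolution, Finset.sum_eq_zero, zero_mul, eq_comm]
  · rcases lt_or_ge (N - x) y with h | h
    · rw [qRacah_of_lt_right s h, mul_zero]
    · rw [qRacah_of_lt_right s (show N - i < x by omega), zero_mul]
  · intro a _
    rcases lt_or_ge (N - y) x with h | h
    · simp [qRacah_of_lt_right s h]
    · simp [qRacah_of_lt_right s (show N - a < y by omega)]

/-! ### The induction step in `j`. -/

theorem convolution_succ {s b₀ b₁ b₂ b₃ b₄ : ℂ} {N : ℕ}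
    (h : GenericQuintuple s (N + 1) b₀ b₁ b₂ b₃ b₄) (i j : ℕ) {x y k : ℕ}
    (hk : x + y + k = N + 1) :
    (1 - (s ^ 2) ^ (j + 1)) * (1 - b₀ ^ 2 * b₄ ^ 2 * (s ^ 2) ^ (j + 2)) *
      (1 - s ^ 2 * b₄ ^ 2) * (s * b₀) * s ^ ((N : ℤ) - 2 * j) *
      ((1 - b₀ ^ 2 * b₁ ^ 2 * (s ^ 2) ^ (2 * y + 1)) *
        (1 - b₃ ^ 2 * b₄ ^ 2 * (s ^ 2) ^ (2 * x + 1))) *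
      convolution s b₀ b₁ b₂ b₃ b₄ (N + 1) i (j + 1) x y =
    -(b₀ ^ 2 * b₁ ^ 2 * b₄ ^ 2 * (s ^ 2) ^ (N + y + 3)) * (1 - b₀ ^ 2 * (s ^ 2) ^ (y + 1)) *
      (1 - b₀ ^ 2 * b₁ ^ 2 * (s ^ 2) ^ (y + 1)) * (1 - s ^ 2 * b₄ ^ 2) * (s * b₃) *
      ((s ^ 2) ^ x * (1 - (s ^ 2) ^ k) * (1 - b₃ ^ 2 * b₄ ^ 2 * (s ^ 2) ^ (x + 1)) *
          convolution s (s * b₀) b₁ b₂ b₃ (s * b₄) N i j x y +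
        (1 - (s ^ 2) ^ x) * (1 - b₃ ^ 2 * b₄ ^ 2 * (s ^ 2) ^ (2 * x + k + 1)) *
          convolution s (s * b₀) b₁ b₂ b₃ (s * b₄) N i j (x - 1) y) +
    s ^ 2 * b₀ ^ 2 * (b₀ ^ 2 * b₁ ^ 2 * (s ^ 2) ^ (N + y + 2)) * (1 - b₁ ^ 2 * (s ^ 2) ^ y) *
      (1 - (s ^ 2) ^ y) * (1 - s ^ 2 * b₄ ^ 2) *
      ((1 - b₂ ^ 2 * b₃ ^ 2 * b₄ ^ 2 * (s ^ 2) ^ (2 * x + k + 2)) *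
          (1 - b₃ ^ 2 * b₄ ^ 2 * (s ^ 2) ^ (x + 1)) *
          convolution s (s * b₀) b₁ b₂ b₃ (s * b₄) N i j x (y - 1) +
        b₃ ^ 2 * b₄ ^ 2 * (s ^ 2) ^ (x + 1) * (1 - (s ^ 2) ^ x) *
          (1 - b₂ ^ 2 * (s ^ 2) ^ (k + 1)) *
          convolution s (s * b₀) b₁ b₂ b₃ (s * b₄) N i j (x - 1) (y - 1)) := by
  have hs := h.s_ne
  -- The sum for size `N + 1` has one more index, `a = N + 1`; there `Q` has positive degree and
  -- size `0`, so the term vanishes.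
  have hlast : qRacah s (j + 1) y b₁ b₀ b₄ (N + 1 - (N + 1)) = 0 :=
    qRacah_of_lt_left s (by omega) ..
  simp only [convolution]
  rw [Finset.sum_range_succ _ (N + 1), hlast]
  simp only [mul_zero, zero_mul, add_zero, mul_add, Finset.mul_sum]
  rw [← Finset.sum_add_distrib, ← Finset.sum_add_distrib, ← Finset.sum_add_distrib]
  refine Finset.sum_congr rfl fun a ha => ?_
  have ha : a ≤ N := Nat.lt_succ_iff.1 (Finset.mem_range.1 ha)
  have key := qRacah_succ_mul_qRacah h j ha hk
  have hw : weight s a b₂ b₃ (b₁ * b₃ / (b₄ * b₂)) =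
      s ^ a * weight s a b₂ b₃ (b₁ * b₃ / (s * b₄ * b₂)) := by
    rw [← weight_mul_right]
    congr 1
    field_simp
  -- The only remaining `a`-dependence of the coefficients is this power of `s`, which the change of
  -- weight in `hw` compensates exactly.
  have hz : s ^ ((N : ℤ) - 2 * j) * s ^ a = (s ^ 2) ^ a * s ^ (((N - a : ℕ) : ℤ) - 2 * j) := by
    rw [← pow_mul, ← zpow_natCast, ← zpow_natCast, ← zpow_add₀ hs, ← zpow_add₀ hs]
    congr 1
    push_cast [ha]
    ring
  rw [hw, show N + 1 - (j + 1) = N - j by omega]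
  generalize weight s a b₂ b₃ (b₁ * b₃ / (s * b₄ * b₂)) = w
  generalize qRacah s i a b₃ b₂ b₁ (N - j) = P
  generalize (1 - (s ^ 2) ^ (j + 1)) * (1 - b₀ ^ 2 * b₄ ^ 2 * (s ^ 2) ^ (j + 2)) *
    (1 - s ^ 2 * b₄ ^ 2) * (s * b₀) = κ at *
  generalize (1 - b₀ ^ 2 * b₁ ^ 2 * (s ^ 2) ^ (2 * y + 1)) *
    (1 - b₃ ^ 2 * b₄ ^ 2 * (s ^ 2) ^ (2 * x + 1)) = κ' at *
  generalize -(b₀ ^ 2 * b₁ ^ 2 * b₄ ^ 2 * (s ^ 2) ^ (N + y + 3)) * (1 - b₀ ^ 2 * (s ^ 2) ^ (y + 1)) *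
    (1 - b₀ ^ 2 * b₁ ^ 2 * (s ^ 2) ^ (y + 1)) * (1 - s ^ 2 * b₄ ^ 2) * (s * b₃) = f at *
  generalize s ^ 2 * b₀ ^ 2 * (b₀ ^ 2 * b₁ ^ 2 * (s ^ 2) ^ (N + y + 2)) *
    (1 - b₁ ^ 2 * (s ^ 2) ^ y) * (1 - (s ^ 2) ^ y) * (1 - s ^ 2 * b₄ ^ 2) = g at *
  generalize 1 - b₃ ^ 2 * b₄ ^ 2 * (s ^ 2) ^ (x + 1) = f8 at *
  generalize 1 - b₃ ^ 2 * b₄ ^ 2 * (s ^ 2) ^ (2 * x + k + 1) = f9 at *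
  generalize 1 - b₂ ^ 2 * b₃ ^ 2 * b₄ ^ 2 * (s ^ 2) ^ (2 * x + k + 2) = f10 at *
  generalize 1 - b₂ ^ 2 * (s ^ 2) ^ (k + 1) = f11 at *
  generalize b₃ ^ 2 * b₄ ^ 2 * (s ^ 2) ^ (x + 1) = f12 at *
  generalize s ^ ((N : ℤ) - 2 * j) = z at *
  generalize s ^ (((N - a : ℕ) : ℤ) - 2 * j) = z' at *
  linear_combination P * w * key + κ * κ' * P * w * (qRacah s (j + 1) y b₁ b₀ b₄ (N + 1 - a) *
    qRacah s a x b₄ b₃ b₂ (N + 1 - y)) * hz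

/-- Left and right sides obey four-term recurrences with the same shifts of variables. Once the
weights are included, the coefficients are proportional by a common factor, so the induction
hypothesis at the four shifted pairs suffices. -/
theorem PentagonAt.succ {s b₀ b₁ b₂ b₃ b₄ : ℂ} {N : ℕ}
    (h : GenericQuintuple s (N + 1) b₀ b₁ b₂ b₃ b₄) {i j : ℕ} (hi : i ≤ N)
    (ih : ∀ x y, PentagonAt s (s * b₀) b₁ b₂ b₃ (s * b₄) N i j x y) (x y : ℕ) :
    PentagonAt s b₀ b₁ b₂ b₃ b₄ (N + 1) i (j + 1) x y := by
  rcases lt_or_ge (N + 1) (x + y) with hxy | hxy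
  · exact pentagonAt_of_lt_right s _ _ _ _ _ _ _ hxy
  obtain ⟨k, hk⟩ : ∃ k, x + y + k = N + 1 := ⟨_, Nat.add_sub_cancel' hxy⟩
  have hs := h.s_ne
  have hq := h.q_ne
  have hb0 := h.b₀_ne
  have hb1 := h.b₁_ne
  have hb2 := h.b₂_ne
  have hb3 := h.b₃_ne
  have hb4 := h.b₄_ne
  have eL := convolution_succ h i j hk
  -- The reflection `k ↦ 4 - k` of the parameters maps the product `Q R` to the product on the
  -- right, with `i` in place of `a` and with `x` and `y` exchanged.
  have eR := qRacah_succ_mul_qRacah h.reflect j hi (show y + x + k = N + 1 by omega)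
  have i1 := ih x y
  have i2 := ih (x - 1) y
  have i3 := ih x (y - 1)
  have i4 := ih (x - 1) (y - 1)
  unfold PentagonAt at i1 i2 i3 i4 ⊢
  have hwi : weight s i b₁ b₂ (s * b₀ * b₂ / (b₁ * b₃)) =
      s ^ i * weight s i b₁ b₂ (b₀ * b₂ / (b₁ * b₃)) := by
    rw [← weight_mul_right]
    congr 1
    field_simp
  have hwj := weight_succ_shift (b₁ := b₄) hs h.a₀ (b₀ * b₃ / (b₁ * b₄)) j
  have hwy := weight_shift_left (s := s) (b₁ := b₀) (b₂ := b₁) (b₄ * b₁ / (b₂ * b₀)) y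
  have hwx := weight_shift_right (b₁ := b₃) hs h.a₄ (b₂ * b₄ / (b₀ * b₃)) x
  have hwy' : (1 - (s ^ 2) ^ y) * ((1 - b₁ ^ 2 * (s ^ 2) ^ y) *
      weight s y b₀ b₁ (b₄ * b₁ / (b₂ * b₀))) = (1 - (s ^ 2) ^ y) * ((1 - s ^ 2 * b₀ ^ 2) *
        (b₄ * b₁ / (b₂ * b₀)) * weight s (y - 1) (s * b₀) b₁ (b₄ * b₁ / (b₂ * b₀))) := by
    rcases y with _ | y
    · simp
    · rw [weight_succ_shift_left hs h.a₁, Nat.add_sub_cancel]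
  have hwx' : (1 - (s ^ 2) ^ x) * ((1 - s ^ 2 * b₄ ^ 2) *
      weight s x b₃ b₄ (b₂ * b₄ / (b₀ * b₃))) = (1 - (s ^ 2) ^ x) * ((1 - b₃ ^ 2 * (s ^ 2) ^ x) *
        (b₂ * b₄ / (b₀ * b₃)) * weight s (x - 1) b₃ (s * b₄) (b₂ * b₄ / (b₀ * b₃))) := by
    rcases x with _ | x
    · simp
    · rw [weight_succ_shift_right hs h.a₄, Nat.add_sub_cancel]
  rw [show s * b₀ * b₃ / (b₁ * (s * b₄)) = b₀ * b₃ / (b₁ * b₄) by field_simp,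
    show s * b₄ * b₁ / (b₂ * (s * b₀)) = b₄ * b₁ / (b₂ * b₀) by field_simp,
    show b₂ * (s * b₄) / (s * b₀ * b₃) = b₂ * b₄ / (b₀ * b₃) by field_simp, hwi] at i1 i2 i3 i4
  have hpos : s ^ ((N : ℤ) - 2 * j) * s ^ i = (s ^ 2) ^ i * s ^ (((N - i : ℕ) : ℤ) - 2 * j) := by
    rw [← pow_mul, ← zpow_natCast, ← zpow_natCast, ← zpow_add₀ hs, ← zpow_add₀ hs]
    congr 1
    push_cast [hi]
    ring
  have hN : (s ^ 2) ^ N * s ^ 2 = (s ^ 2) ^ x * (s ^ 2) ^ y * (s ^ 2) ^ k := by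
    rw [← pow_succ, ← hk, pow_add, pow_add]
  have hp := h.prod_eq
  rw [← hk] at hp
  have hD : (s ^ 2) ^ i * ((1 - (s ^ 2) ^ (j + 1)) * (1 - b₀ ^ 2 * b₄ ^ 2 * (s ^ 2) ^ (j + 2)) *
      (1 - s ^ 2 * b₀ ^ 2) * (s * b₄) * s ^ (((N - i : ℕ) : ℤ) - 2 * j)) *
      ((1 - b₃ ^ 2 * b₄ ^ 2 * (s ^ 2) ^ (2 * x + 1)) *
        (1 - b₀ ^ 2 * b₁ ^ 2 * (s ^ 2) ^ (2 * y + 1))) ≠ 0 := by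
    have h40 : 1 - b₀ ^ 2 * b₄ ^ 2 * (s ^ 2) ^ (j + 2) ≠ 0 := by
      rw [mul_comm (b₀ ^ 2)]
      exact (h.a₄₀.mul_pow hq _).one_sub
    exact mul_ne_zero (mul_ne_zero (pow_ne_zero _ hq) (mul_ne_zero (mul_ne_zero (mul_ne_zero
      (mul_ne_zero (h.root j) h40) (h.a₀.self_mul hq).one_sub) (mul_ne_zero hs hb4))
      (zpow_ne_zero _ hs))) (mul_ne_zero (h.a₃₄.mul_pow hq _).one_sub (h.a₀₁.mul_pow hq _).one_sub)
  -- Comparison of the four pairs of coefficients: `g1` and `g4` are formal, whereas `g2` and `g3`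
  -- need the constraint.
  have g1 : b₃ ^ 2 * (b₀ ^ 2 * b₁ ^ 2 * b₄ ^ 2 * (s ^ 2) ^ (N + y + 3)) * (s ^ 2) ^ x =
      b₁ ^ 2 * (b₃ ^ 2 * b₄ ^ 2 * b₀ ^ 2 * (s ^ 2) ^ (N + x + 3)) * (s ^ 2) ^ y := by ring
  have g2 : -((b₀ ^ 2 * b₁ ^ 2 * b₄ ^ 2 * (s ^ 2) ^ (N + y + 3)) * s * b₃ * b₂ * b₄) *
      (1 - b₃ ^ 2 * b₄ ^ 2 * (s ^ 2) ^ (2 * x + k + 1)) =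
      b₀ * b₁ * (s ^ 2 * b₄ ^ 2) * (b₃ ^ 2 * b₄ ^ 2 * (s ^ 2) ^ (N + x + 2)) *
        (1 - b₂ ^ 2 * b₁ ^ 2 * b₀ ^ 2 * (s ^ 2) ^ (2 * y + k + 2)) := by
    linear_combination (s * b₀ * b₁ * b₄ ^ 2 * (s ^ 2) ^ (N + y + 3) * (b₀ * b₁ * b₂ * b₃ * b₄) +
      b₀ * b₁ * b₄ ^ 4 * b₃ ^ 2 * s ^ 2 * (s ^ 2) ^ (N + x + 2)) * hp
  have g3 : b₃ * (s ^ 2 * b₀ ^ 2) * (b₀ ^ 2 * b₁ ^ 2 * (s ^ 2) ^ (N + y + 2)) * b₄ *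
      (1 - b₂ ^ 2 * b₃ ^ 2 * b₄ ^ 2 * (s ^ 2) ^ (2 * x + k + 2)) =
      -(b₁ * s * (b₃ ^ 2 * b₄ ^ 2 * b₀ ^ 2 * (s ^ 2) ^ (N + x + 3)) * b₂ * b₀) *
        (1 - b₀ ^ 2 * b₁ ^ 2 * (s ^ 2) ^ (2 * y + k + 1)) := by
    linear_combination -(b₃ * b₄ * s ^ 2 * b₀ ^ 4 * b₁ ^ 2 * (s ^ 2) ^ (N + y + 2) +
      s * (b₀ * b₁ * b₂ * b₃ * b₄) * b₀ ^ 2 * b₃ * b₄ * (s ^ 2) ^ (N + x + 3)) * hp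
  have g4 : (s ^ 2 * b₀ ^ 2) * (b₀ ^ 2 * b₁ ^ 2 * (s ^ 2) ^ (N + y + 2)) *
      (b₃ ^ 2 * b₄ ^ 2 * (s ^ 2) ^ (x + 1)) * b₄ ^ 2 =
      (s ^ 2 * b₄ ^ 2) * (b₃ ^ 2 * b₄ ^ 2 * (s ^ 2) ^ (N + x + 2)) *
      (b₀ ^ 2 * b₁ ^ 2 * (s ^ 2) ^ (y + 1)) * b₀ ^ 2 := by ring
  have hwj₂ : (1 - s ^ 2 * b₀ ^ 2) * b₁ * b₄ * weight s (j + 1) b₄ b₀ (b₀ * b₃ / (b₁ * b₄)) =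
      (1 - s ^ 2 * b₄ ^ 2) * b₀ * b₃ *
        weight s j (s * b₄) (s * b₀) (b₀ * b₃ / (b₁ * b₄)) := by
    have e : b₀ * b₃ / (b₁ * b₄) * (b₁ * b₄) = b₀ * b₃ := by field_simp
    linear_combination b₁ * b₄ * hwj + (1 - s ^ 2 * b₄ ^ 2) *
      weight s j (s * b₄) (s * b₀) (b₀ * b₃ / (b₁ * b₄)) * e
  have hwy₂ : (1 - (s ^ 2) ^ y) * (1 - b₁ ^ 2 * (s ^ 2) ^ y) * b₂ * b₀ *
      weight s y b₀ b₁ (b₄ * b₁ / (b₂ * b₀)) = (1 - (s ^ 2) ^ y) * (1 - s ^ 2 * b₀ ^ 2) *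
        b₄ * b₁ * weight s (y - 1) (s * b₀) b₁ (b₄ * b₁ / (b₂ * b₀)) := by
    have e : b₄ * b₁ / (b₂ * b₀) * (b₂ * b₀) = b₄ * b₁ := by field_simp
    linear_combination b₂ * b₀ * hwy' + (1 - (s ^ 2) ^ y) * (1 - s ^ 2 * b₀ ^ 2) *
      weight s (y - 1) (s * b₀) b₁ (b₄ * b₁ / (b₂ * b₀)) * e
  have hwx₂ : (1 - (s ^ 2) ^ x) * (1 - s ^ 2 * b₄ ^ 2) * b₀ * b₃ *
      weight s x b₃ b₄ (b₂ * b₄ / (b₀ * b₃)) = (1 - (s ^ 2) ^ x) * (1 - b₃ ^ 2 * (s ^ 2) ^ x) *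
        b₂ * b₄ * weight s (x - 1) b₃ (s * b₄) (b₂ * b₄ / (b₀ * b₃)) := by
    have e : b₂ * b₄ / (b₀ * b₃) * (b₀ * b₃) = b₂ * b₄ := by field_simp
    linear_combination b₀ * b₃ * hwx' + (1 - (s ^ 2) ^ x) * (1 - b₃ ^ 2 * (s ^ 2) ^ x) *
      weight s (x - 1) b₃ (s * b₄) (b₂ * b₄ / (b₀ * b₃)) * e
  clear hwj hwy' hwx' hwi ih hp hN h
  rw [mul_comm (b₄ ^ 2) (b₃ ^ 2), mul_comm (b₁ ^ 2) (b₀ ^ 2), mul_comm (b₄ ^ 2) (b₀ ^ 2)] at eR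
  generalize weight s i b₁ b₂ (b₀ * b₂ / (b₁ * b₃)) = Wi at *
  generalize weight s (j + 1) b₄ b₀ (b₀ * b₃ / (b₁ * b₄)) = Wj at *
  generalize weight s j (s * b₄) (s * b₀) (b₀ * b₃ / (b₁ * b₄)) = Wj' at *
  generalize weight s y b₀ b₁ (b₄ * b₁ / (b₂ * b₀)) = Wy at *
  generalize weight s y (s * b₀) b₁ (b₄ * b₁ / (b₂ * b₀)) = Wy' at *
  generalize weight s (y - 1) (s * b₀) b₁ (b₄ * b₁ / (b₂ * b₀)) = Wy'' at *
  generalize weight s x b₃ b₄ (b₂ * b₄ / (b₀ * b₃)) = Wx at *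
  generalize weight s x b₃ (s * b₄) (b₂ * b₄ / (b₀ * b₃)) = Wx' at *
  generalize weight s (x - 1) b₃ (s * b₄) (b₂ * b₄ / (b₀ * b₃)) = Wx'' at *
  generalize b₀ ^ 2 * b₁ ^ 2 * b₄ ^ 2 * (s ^ 2) ^ (N + y + 3) = p1 at *
  generalize b₃ ^ 2 * b₄ ^ 2 * b₀ ^ 2 * (s ^ 2) ^ (N + x + 3) = p2 at *
  generalize b₀ ^ 2 * b₁ ^ 2 * (s ^ 2) ^ (N + y + 2) = p3 at *
  generalize b₃ ^ 2 * b₄ ^ 2 * (s ^ 2) ^ (N + x + 2) = p4 at *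
  generalize 1 - b₃ ^ 2 * b₄ ^ 2 * (s ^ 2) ^ (2 * x + k + 1) = f1 at *
  generalize 1 - b₂ ^ 2 * b₁ ^ 2 * b₀ ^ 2 * (s ^ 2) ^ (2 * y + k + 2) = f2 at *
  generalize 1 - b₂ ^ 2 * b₃ ^ 2 * b₄ ^ 2 * (s ^ 2) ^ (2 * x + k + 2) = f3 at *
  generalize 1 - b₀ ^ 2 * b₁ ^ 2 * (s ^ 2) ^ (2 * y + k + 1) = f4 at *
  generalize b₃ ^ 2 * b₄ ^ 2 * (s ^ 2) ^ (x + 1) = p5 at *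
  generalize b₀ ^ 2 * b₁ ^ 2 * (s ^ 2) ^ (y + 1) = p6 at *
  generalize 1 - b₂ ^ 2 * (s ^ 2) ^ (k + 1) = f5 at *
  generalize 1 - p5 = f6 at *
  generalize 1 - p6 = f7 at *
  generalize 1 - b₁ ^ 2 * (s ^ 2) ^ y = f8 at *
  generalize 1 - b₃ ^ 2 * (s ^ 2) ^ x = f9 at *
  generalize 1 - b₀ ^ 2 * (s ^ 2) ^ (y + 1) = f10 at *
  generalize 1 - b₄ ^ 2 * (s ^ 2) ^ (x + 1) = f11 at *
  generalize 1 - b₃ ^ 2 * b₄ ^ 2 * (s ^ 2) ^ (2 * x + 1) = f12 at *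
  generalize 1 - b₀ ^ 2 * b₁ ^ 2 * (s ^ 2) ^ (2 * y + 1) = f13 at *
  generalize 1 - b₀ ^ 2 * b₄ ^ 2 * (s ^ 2) ^ (j + 2) = f14 at *
  generalize 1 - (s ^ 2) ^ (j + 1) = f15 at *
  generalize 1 - s ^ 2 * b₀ ^ 2 = f16 at *
  generalize 1 - s ^ 2 * b₄ ^ 2 = f17 at *
  generalize s ^ 2 * b₀ ^ 2 = p7 at *
  generalize s ^ 2 * b₄ ^ 2 = p8 at *
  generalize 1 - (s ^ 2) ^ x = f18 at *
  generalize 1 - (s ^ 2) ^ y = f19 at *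
  generalize 1 - (s ^ 2) ^ k = f20 at *
  generalize (s ^ 2) ^ x = X at *
  generalize (s ^ 2) ^ y = Y at *
  generalize (s ^ 2) ^ i = I at *
  generalize s ^ i = I' at *
  generalize s ^ ((N : ℤ) - 2 * j) = z at *
  generalize s ^ (((N - i : ℕ) : ℤ) - 2 * j) = z' at *
  -- In the following four identities the weights are included. As the reflection exchanges `x` and
  -- `y`, the second and third terms of the two recurrences are matched crosswise.
  have I1 : b₃ * (p1 * f10 * f7 * f17 * (s * b₃) * (X * f20 * f6)) * (Wy * Wx) =
      b₁ * (p2 * f11 * f6 * f16 * (s * b₁) * (Y * f20 * f7)) * (Wy' * Wx') := by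
    linear_combination b₃ ^ 2 * p1 * f7 * s * X * f20 * f6 * (f17 * Wx * hwy + f16 * Wy' * hwx) +
      f7 * s * f20 * f6 * f16 * f11 * Wy' * Wx' * g1
  have I2 : b₀ * (b₃ * (-p1 * f10 * f7 * f17 * (s * b₃) * (f18 * f1)) * (Wy * Wx)) =
      b₀ * (b₁ * (p8 * p4 * f9 * f18 * f16 * (f2 * f7)) * (Wy' * Wx'')) := by
    linear_combination -b₀ * b₃ ^ 2 * p1 * f7 * f17 * s * f18 * f1 * Wx * hwy -
      b₃ * p1 * f7 * s * f1 * f16 * Wy' * hwx₂ + f7 * f16 * Wy' * f18 * f9 * Wx'' * g2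
  have I3 : (b₂ * b₀) * (b₃ * (p7 * p3 * f8 * f19 * f17 * (f3 * f6)) * (Wy * Wx)) =
      (b₂ * b₀) * (b₁ * (-p2 * f11 * f6 * f16 * (s * b₁) * (f19 * f4)) * (Wy'' * Wx')) := by
    linear_combination b₂ * b₀ * b₃ * p7 * p3 * f8 * f19 * f3 * f6 * Wy * hwx +
      b₃ * p7 * p3 * f3 * f6 * f11 * Wx' * hwy₂ + f6 * f11 * Wx' * f19 * f16 * b₁ * Wy'' * g3
  have I4 : (b₂ * b₀) * (b₀ * b₃) * (b₃ * (p7 * p3 * f8 * f19 * f17 * (p5 * f18 * f5)) * (Wy * Wx)) =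
      (b₂ * b₀) * (b₀ * b₃) * (b₁ * (p8 * p4 * f9 * f18 * f16 * (p6 * f19 * f5)) * (Wy'' * Wx'')) := by
    linear_combination b₀ * b₃ ^ 2 * p7 * p3 * f17 * p5 * f18 * f5 * Wx * hwy₂ +
      b₃ * p7 * p3 * f19 * f16 * b₄ * b₁ * Wy'' * p5 * f5 * hwx₂ +
      b₃ * f19 * f16 * b₁ * Wy'' * f5 * f18 * f9 * b₂ * Wx'' * g4
  have I2' := mul_left_cancel₀ hb0 I2
  have I3' := mul_left_cancel₀ (mul_ne_zero hb2 hb0) I3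
  have I4' := mul_left_cancel₀ (mul_ne_zero (mul_ne_zero hb2 hb0) (mul_ne_zero hb0 hb3)) I4
  clear I2 I3 I4 g1 g2 g3 g4
  generalize convolution s b₀ b₁ b₂ b₃ b₄ (N + 1) i (j + 1) x y = C at *
  generalize convolution s (s * b₀) b₁ b₂ b₃ (s * b₄) N i j x y = C1 at *
  generalize convolution s (s * b₀) b₁ b₂ b₃ (s * b₄) N i j (x - 1) y = C2 at *
  generalize convolution s (s * b₀) b₁ b₂ b₃ (s * b₄) N i j x (y - 1) = C3 at *
  generalize convolution s (s * b₀) b₁ b₂ b₃ (s * b₄) N i j (x - 1) (y - 1) = C4 at *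
  refine mul_left_cancel₀ (mul_ne_zero hb1 hD) ?_
  linear_combination I * z' * f15 * f14 * s * f12 * f13 * C * Wi * Wy * Wx * hwj₂ -
    f15 * f14 * s * f12 * f13 * C * Wi * Wy * Wx * f17 * b₀ * b₃ * Wj' * hpos +
    I' * b₃ * Wi * Wj' * Wy * Wx * eL -
    I' * Wi * Wj' * (C1 * I1 - C2 * I2' - C3 * I3' - C4 * I4') - b₁ * eR -
    b₁ * p2 * f11 * f6 * f16 * (s * b₁) * (Y * f20 * f7 * i1 + f19 * f4 * i3) +
    b₁ * p8 * p4 * f9 * f18 * f16 * (f2 * f7 * i2 + p6 * f19 * f5 * i4)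

/-! ### Degree zero, and the step in `x` for `j = 0`. -/

/-- In degree zero the series is `1`, so the polynomial is constant in `x` on its range and equals
its normalization. -/
theorem qRacah_zero_left {s b₁ b₂ b₃ : ℂ} (h : GenericTriple s b₁ b₂ b₃) {x M : ℕ} (hx : x ≤ M) :
    qRacah s 0 x b₁ b₂ b₃ M = qPoch (s ^ 2) (s ^ 2 * b₁ ^ 2) M * (s * b₂) ^ M /
      qPoch (s ^ 2) (b₂ ^ 2 * b₃ ^ 2 * (s ^ 2) ^ 2) M := by
  have hO := Omega_add h 0 M
  have h1 : 1 - b₂ ^ 2 * b₃ ^ 2 * s ^ 2 ≠ 0 := (h.a₂₃.mul_self h.q_ne).one_sub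
  have h2 := qPoch_self_ne h.root M
  have h3 : s * b₂ ≠ 0 := mul_ne_zero h.s_ne h.b₂_ne
  have h4 := (h.a₂₃.mul_pow h.q_ne 2).qPoch_ne M
  rw [qRacah_eq s (Nat.zero_le _) hx, racahPhi_zero, mul_one]
  rw [zero_add, zero_add, qPoch_succ', mul_zero, zero_add, pow_one, Nat.cast_zero,
    zero_sub, zpow_neg, zpow_natCast, qPoch_zero, qPoch_zero, qPoch_zero, qPoch_zero,
    mul_assoc (b₂ ^ 2 * b₃ ^ 2), ← sq (s ^ 2)] at hO
  rw [hO]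
  generalize qPoch (s ^ 2) (b₂ ^ 2 * b₃ ^ 2 * (s ^ 2) ^ 2) M = X at *
  generalize qPoch (s ^ 2) (s ^ 2) M = Y at *
  field_simp

theorem qRacah_zero_mul_shift {s b₁ b₂ b₃ : ℂ} (h : GenericTriple s b₁ b₂ b₃) {x M : ℕ}
    (hx : x ≤ M) :
    qRacah s 0 x b₁ b₂ b₃ M * (1 - b₂ ^ 2 * b₃ ^ 2 * (s ^ 2) ^ 2) =
      qRacah s 0 x b₁ b₂ (s * b₃) M * (1 - b₂ ^ 2 * b₃ ^ 2 * (s ^ 2) ^ (M + 2)) := by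
  have h4 := (h.a₂₃.mul_pow h.q_ne 2).qPoch_ne M
  have h5 := (h.a₂₃.mul_pow h.q_ne 3).qPoch_ne M
  have key := qPoch_shift (s ^ 2) (b₂ ^ 2 * b₃ ^ 2 * (s ^ 2) ^ 2) M
  rw [qRacah_zero_left h hx, qRacah_zero_left h.shift₃ hx,
    show b₂ ^ 2 * (s * b₃) ^ 2 * (s ^ 2) ^ 2 = b₂ ^ 2 * b₃ ^ 2 * (s ^ 2) ^ 3 by ring,
    add_comm M 2, pow_add, ← mul_assoc]
  rw [mul_assoc _ ((s ^ 2) ^ 2) (s ^ 2), ← pow_succ] at key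
  generalize qPoch (s ^ 2) (b₂ ^ 2 * b₃ ^ 2 * (s ^ 2) ^ 2) M = X at *
  generalize qPoch (s ^ 2) (b₂ ^ 2 * b₃ ^ 2 * (s ^ 2) ^ (2 + 1)) M = Y at *
  rw [div_mul_eq_mul_div, div_mul_eq_mul_div, div_eq_div_iff h4 h5]
  linear_combination qPoch (s ^ 2) (s ^ 2 * b₁ ^ 2) M * (s * b₂) ^ M * key

theorem qRacah_zero_succ_mul_shift {s b₁ b₂ b₃ : ℂ} (h : GenericTriple s b₁ b₂ b₃) {x M : ℕ}
    (hx : x ≤ M) :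
    qRacah s 0 x b₁ b₂ b₃ (M + 1) * (1 - b₂ ^ 2 * b₃ ^ 2 * (s ^ 2) ^ 2) =
      qRacah s 0 x b₁ b₂ (s * b₃) M * ((1 - b₁ ^ 2 * (s ^ 2) ^ (M + 1)) * (s * b₂)) := by
  have h4 := (h.a₂₃.mul_pow h.q_ne 2).one_sub
  have h5 := (h.a₂₃.mul_pow h.q_ne 3).qPoch_ne M
  rw [qRacah_zero_left h (show x ≤ M + 1 by omega), qRacah_zero_left h.shift₃ hx,
    show b₂ ^ 2 * (s * b₃) ^ 2 * (s ^ 2) ^ 2 = b₂ ^ 2 * b₃ ^ 2 * (s ^ 2) ^ 3 by ring,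
    qPoch_succ, qPoch_succ', mul_assoc _ ((s ^ 2) ^ 2) (s ^ 2), ← pow_succ]
  generalize qPoch (s ^ 2) (b₂ ^ 2 * b₃ ^ 2 * (s ^ 2) ^ (2 + 1)) M = Y at *
  generalize 1 - b₂ ^ 2 * b₃ ^ 2 * (s ^ 2) ^ 2 = Z at *
  field_simp
  ring

/-- The convolution with its last variable lowered by one, in degree zero. -/
theorem convolution_zero_succ {s b₀ b₁ b₂ b₃ b₄ : ℂ} {N : ℕ}
    (h : GenericQuintuple s (N + 1) b₀ b₁ b₂ b₃ b₄) (i : ℕ) {x y : ℕ} (hy : y ≤ N) :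
    (1 - b₀ ^ 2 * b₄ ^ 2 * (s ^ 2) ^ 2) * s ^ N *
        convolution s b₀ b₁ b₂ b₃ b₄ (N + 1) i 0 (x + 1) y =
      (1 - s ^ 2 * b₄ ^ 2) * b₃ ^ 2 * b₁ * b₀ ^ 2 * b₄ * (s ^ 2) ^ (N + 3) * s ^ y *
        convolution s b₀ b₁ b₂ (s * b₃) (s * b₄) N i 0 x y := by
  have hs := h.s_ne
  have hq := h.q_ne
  have hb2 := h.b₂_ne
  have hb4 := h.b₄_ne
  have tR : GenericTriple s b₄ b₃ b₂ := h.reflect.triple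
  have tP : GenericTriple s b₃ b₂ b₁ := h.reflect.rotate.triple
  have tQ : GenericTriple s b₁ b₀ b₄ := h.rotate.rotate.rotate.rotate.triple.swap
  set t := b₁ * b₃ / (b₄ * b₂) with ht
  have htb : t * (b₄ * b₂) = b₁ * b₃ := div_mul_cancel₀ _ (mul_ne_zero hb4 hb2)
  clear_value t
  set F : ℕ → ℂ := fun a => qRacah s i a b₃ b₂ b₁ (N + 1) * qRacah s 0 y b₁ b₀ b₄ (N + 1 - a) *
    weight s a b₂ b₃ t with hF
  -- This division makes the expansion of `Rₐ(x + 1)` an exact difference of `q^a R a`.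
  set R : ℕ → ℂ := fun a => qRacah s a x (s * b₄) (s * b₃) b₂ (N - y) /
    (1 - b₃ ^ 2 * b₂ ^ 2 * (s ^ 2) ^ (2 * a + 2)) with hR
  -- Summation by parts: the difference in `a` passes from `R` to `F = P Q w`. There is no boundary
  -- term at the top because `R (N + 1) = 0`, and the term at `a = 0` is supplied by
  -- `qRacah_zero_succ`.
  have hsum : s ^ (N + 1) * convolution s b₀ b₁ b₂ b₃ b₄ (N + 1) i 0 (x + 1) y =
      (1 - s ^ 2 * b₄ ^ 2) * b₃ * s ^ y * s ^ 2 *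
        ∑ a ∈ Finset.range (N + 1), (s ^ 2) ^ a * (R a * (F a - F (a + 1))) := by
    have hz : ∀ a : ℕ, s ^ (2 * (a : ℤ) - (N - y : ℕ) - 1) * s ^ (N + 1) = (s ^ 2) ^ a * s ^ y := by
      intro a
      rw [← pow_mul, ← zpow_natCast, ← zpow_natCast, ← zpow_natCast, ← zpow_add₀ hs, ← zpow_add₀ hs]
      congr 1
      push_cast [hy]
      ring
    have e0 : qRacah s 0 (x + 1) b₄ b₃ b₂ (N + 1 - y) * s ^ (N + 1) =
        (1 - s ^ 2 * b₄ ^ 2) * b₃ * s ^ y * s ^ 2 * R 0 := by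
      rw [show N + 1 - y = N - y + 1 by omega, qRacah_zero_succ tR]
      simp only [hR]
      linear_combination (1 - s ^ 2 * b₄ ^ 2) * b₃ * s ^ 2 * (qRacah s 0 x (s * b₄) (s * b₃) b₂ (N - y) /
        (1 - b₃ ^ 2 * b₂ ^ 2 * (s ^ 2) ^ (2 * 0 + 2))) * hz 0
    have e1 : ∀ a, qRacah s (a + 1) (x + 1) b₄ b₃ b₂ (N + 1 - y) * s ^ (N + 1) =
        (1 - s ^ 2 * b₄ ^ 2) * b₃ * s ^ y * s ^ 2 *
          ((s ^ 2) ^ (a + 1) * R (a + 1) - (s ^ 2) ^ a * R a) := by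
      intro a
      rw [show N + 1 - y = N - y + 1 by omega, qRacah_succ_succ tR]
      simp only [hR]
      linear_combination (1 - s ^ 2 * b₄ ^ 2) * b₃ * (s ^ 2 *
        qRacah s (a + 1) x (s * b₄) (s * b₃) b₂ (N - y) /
          (1 - b₃ ^ 2 * b₂ ^ 2 * (s ^ 2) ^ (2 * (a + 1) + 2)) -
        qRacah s a x (s * b₄) (s * b₃) b₂ (N - y) /
          (1 - b₃ ^ 2 * b₂ ^ 2 * (s ^ 2) ^ (2 * a + 2))) * hz (a + 1)
    have eN : R (N + 1) = 0 := by
      simp only [hR]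
      rw [qRacah_of_lt_left s (by omega), zero_div]
    have e2 : ∑ a ∈ Finset.range (N + 1), (s ^ 2) ^ a * R a * F a =
        ∑ a ∈ Finset.range (N + 1), (s ^ 2) ^ (a + 1) * R (a + 1) * F (a + 1) + R 0 * F 0 := by
      have := Finset.sum_range_succ' (fun a => (s ^ 2) ^ a * R a * F a) (N + 1)
      rw [Finset.sum_range_succ, eN] at this
      simpa using this
    have e3 : ∑ a ∈ Finset.range (N + 1), (s ^ 2) ^ a * (R a * (F a - F (a + 1))) =
        ∑ a ∈ Finset.range (N + 1), (s ^ 2) ^ a * R a * F a -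
          ∑ a ∈ Finset.range (N + 1), (s ^ 2) ^ a * R a * F (a + 1) := by
      rw [← Finset.sum_sub_distrib]
      exact Finset.sum_congr rfl fun a _ => by ring
    rw [e3, e2, convolution, ← ht, Finset.sum_range_succ', mul_add, Nat.sub_zero]
    have e4 : s ^ (N + 1) * ∑ a ∈ Finset.range (N + 1), qRacah s i (a + 1) b₃ b₂ b₁ (N + 1) *
        qRacah s 0 y b₁ b₀ b₄ (N + 1 - (a + 1)) * qRacah s (a + 1) (x + 1) b₄ b₃ b₂ (N + 1 - y) *
        weight s (a + 1) b₂ b₃ t = (1 - s ^ 2 * b₄ ^ 2) * b₃ * s ^ y * s ^ 2 *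
        (∑ a ∈ Finset.range (N + 1), (s ^ 2) ^ (a + 1) * R (a + 1) * F (a + 1) -
          ∑ a ∈ Finset.range (N + 1), (s ^ 2) ^ a * R a * F (a + 1)) := by
      rw [← Finset.sum_sub_distrib, Finset.mul_sum, Finset.mul_sum]
      refine Finset.sum_congr rfl fun a _ => ?_
      linear_combination F (a + 1) * e1 a
    rw [e4]
    linear_combination F 0 * e0
  -- The product formula for `Q` and the weight shifts express `F a` and `F (a + 1)` through common
  -- factors. By the constraint (`s1`, `s2`) the coefficients of the two values of `P` become those
  -- of `qRacah_raise_b₁`.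
  have hterm : ∀ a ∈ Finset.range (N + 1), (s ^ 2) ^ a * (R a * (F a - F (a + 1))) *
      ((1 - s ^ 2 * b₃ ^ 2) * (1 - b₀ ^ 2 * b₄ ^ 2 * (s ^ 2) ^ 2)) =
      t * b₀ ^ 2 * b₄ ^ 2 * (s ^ 2) ^ (N + 2) * (1 - s ^ 2 * b₃ ^ 2) * (s * b₂) *
      (qRacah s i a (s * b₃) b₂ b₁ N * qRacah s 0 y b₁ b₀ (s * b₄) (N - a) *
        qRacah s a x (s * b₄) (s * b₃) b₂ (N - y) * weight s a b₂ (s * b₃) t) := by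
    intro a ha
    have ha : a ≤ N := Nat.lt_succ_iff.1 (Finset.mem_range.1 ha)
    rcases lt_or_ge (N - y) a with hya | hya
    · simp [hR, qRacah_of_lt_left s hya]
    have hR' : R a * (1 - b₃ ^ 2 * b₂ ^ 2 * (s ^ 2) ^ (2 * a + 2)) =
        qRacah s a x (s * b₄) (s * b₃) b₂ (N - y) :=
      div_mul_cancel₀ _ (by rw [mul_comm (b₃ ^ 2)]; exact (h.a₂₃.mul_pow hq _).one_sub)
    have e1 := qRacah_raise_b₁ tP i ha
    have e2 := qRacah_zero_mul_shift tQ (show y ≤ N - a by omega)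
    have e3 := qRacah_zero_succ_mul_shift tQ (show y ≤ N - a by omega)
    have e4 := weight_shift_right (b₁ := b₂) hs h.a₃ t a
    have e5 := weight_succ_shift_right (b₁ := b₂) hs h.a₃ t a
    have hZ : (s ^ 2) ^ N = (s ^ 2) ^ (N - a) * (s ^ 2) ^ a := by
      rw [← pow_add, Nat.sub_add_cancel ha]
    have hp : t * b₀ * b₂ ^ 2 * b₄ ^ 2 * ((s ^ 2) ^ (N - a) * (s ^ 2) ^ a) * s ^ 5 = 1 := by
      rw [← hZ]
      linear_combination h.prod_eq + b₀ * b₂ * b₄ * (s ^ 2) ^ N * s ^ 5 * htb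
    have s1 : (s ^ 2) ^ a * ((1 - b₁ ^ 2 * (s ^ 2) ^ (N - a + 1)) * (s * b₀)) =
        t * b₀ ^ 2 * b₄ ^ 2 * (s ^ 2) ^ (N + 2) *
          (s ^ 2 * b₂ ^ 2 * ((s ^ 2) ^ a - b₁ ^ 2 * (s ^ 2) ^ (N + 1))) := by
      rw [pow_add _ N 1, pow_add _ N 2, hZ, pow_add _ (N - a)]
      linear_combination -(b₀ * s * (s ^ 2) ^ a * (1 - b₁ ^ 2 * (s ^ 2) ^ (N - a) * s ^ 2)) * hp
    have s2 : (s ^ 2) ^ a * ((1 - b₀ ^ 2 * b₄ ^ 2 * (s ^ 2) ^ (N - a + 2)) * t) =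
        -(t * b₀ ^ 2 * b₄ ^ 2 * (s ^ 2) ^ (N + 2) *
          (1 - b₃ ^ 2 * b₂ ^ 2 * b₁ ^ 2 * (s ^ 2) ^ (N + a + 3))) := by
      rw [pow_add _ (N + a) 3, pow_add _ N a, pow_add _ N 2, hZ, pow_add _ (N - a)]
      generalize (s ^ 2) ^ (N - a) = Z at *
      generalize (s ^ 2) ^ a = A at *
      linear_combination -(A * t) * (t * b₀ * b₂ ^ 2 * b₄ ^ 2 * (Z * A) * s ^ 5 + 1) * hp +
        t * b₀ ^ 2 * b₄ ^ 2 * Z ^ 2 * A ^ 3 * s ^ 10 * b₂ ^ 2 * (t * (b₄ * b₂) + b₁ * b₃) * htb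
    simp only [hF, show N + 1 - (a + 1) = N - a by omega, show N + 1 - a = N - a + 1 by omega]
    generalize 1 - b₁ ^ 2 * (s ^ 2) ^ (N - a + 1) = f1 at *
    generalize 1 - b₀ ^ 2 * b₄ ^ 2 * (s ^ 2) ^ (N - a + 2) = f2 at *
    generalize 1 - b₃ ^ 2 * b₂ ^ 2 * b₁ ^ 2 * (s ^ 2) ^ (N + a + 3) = f3 at *
    generalize 1 - b₂ ^ 2 * (s ^ 2) ^ (a + 1) = f4 at *
    generalize 1 - b₃ ^ 2 * (s ^ 2) ^ (a + 1) = f5 at *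
    generalize 1 - b₃ ^ 2 * b₂ ^ 2 * (s ^ 2) ^ (2 * a + 2) = f6 at *
    generalize 1 - s ^ 2 * b₃ ^ 2 = f7 at *
    generalize 1 - b₀ ^ 2 * b₄ ^ 2 * (s ^ 2) ^ 2 = f8 at *
    generalize (s ^ 2) ^ (N + 2) = p at *
    generalize s ^ 2 * b₂ ^ 2 * ((s ^ 2) ^ a - b₁ ^ 2 * (s ^ 2) ^ (N + 1)) = g at *
    generalize (s ^ 2) ^ a = A at *
    generalize weight s a b₂ b₃ t = w₀ at *
    generalize weight s (a + 1) b₂ b₃ t = w₁ at *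
    generalize weight s a b₂ (s * b₃) t = w at *
    generalize qRacah s 0 y b₁ b₀ (s * b₄) (N - a) = Q at *
    generalize qRacah s i a b₃ b₂ b₁ (N + 1) = P₀ at *
    generalize qRacah s i (a + 1) b₃ b₂ b₁ (N + 1) = P₁ at *
    generalize qRacah s i a (s * b₃) b₂ b₁ N = P at *
    linear_combination A * R a * (P₀ * (w₀ * f7 * e3 + Q * (f1 * (s * b₀)) * e4) -
        P₁ * (w₁ * f7 * e2 + Q * f2 * e5)) +
      R a * Q * w * (P₀ * f5 * s1 - P₁ * f4 * s2 + t * b₀ ^ 2 * b₄ ^ 2 * p * e1) +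
      t * b₀ ^ 2 * b₄ ^ 2 * p * f7 * (s * b₂) * Q * w * P * hR'
  have hsum' := Finset.sum_congr rfl hterm
  rw [← Finset.sum_mul, ← Finset.mul_sum] at hsum'
  have hU : convolution s b₀ b₁ b₂ (s * b₃) (s * b₄) N i 0 x y = ∑ a ∈ Finset.range (N + 1),
      qRacah s i a (s * b₃) b₂ b₁ N * qRacah s 0 y b₁ b₀ (s * b₄) (N - a) *
        qRacah s a x (s * b₄) (s * b₃) b₂ (N - y) * weight s a b₂ (s * b₃) t := by
    rw [convolution, show b₁ * (s * b₃) / (s * b₄ * b₂) = t by rw [ht]; field_simp, Nat.sub_zero]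
  rw [← hU] at hsum'
  refine mul_left_cancel₀ (mul_ne_zero hs (h.a₃.self_mul hq).one_sub) ?_
  linear_combination (1 - s ^ 2 * b₃ ^ 2) * (1 - b₀ ^ 2 * b₄ ^ 2 * (s ^ 2) ^ 2) * hsum +
    (1 - s ^ 2 * b₄ ^ 2) * b₃ * s ^ y * s ^ 2 * hsum' +
    (1 - s ^ 2 * b₄ ^ 2) * b₃ * s ^ y * s ^ 3 * (1 - s ^ 2 * b₃ ^ 2) * b₀ ^ 2 * b₄ *
      (s ^ 2) ^ (N + 2) * convolution s b₀ b₁ b₂ (s * b₃) (s * b₄) N i 0 x y * htb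

/-- On the right only the degree-zero factor changes: the other has size `N + 1 - (x + 1) = N - x`.
Both sides therefore pass to the shifted parameters by a single scalar, and one instance of the
induction hypothesis suffices. -/
theorem PentagonAt.zero_succ {s b₀ b₁ b₂ b₃ b₄ : ℂ} {N : ℕ}
    (h : GenericQuintuple s (N + 1) b₀ b₁ b₂ b₃ b₄) {i x y : ℕ}
    (ih : PentagonAt s b₀ b₁ b₂ (s * b₃) (s * b₄) N i 0 x y) :
    PentagonAt s b₀ b₁ b₂ b₃ b₄ (N + 1) i 0 (x + 1) y := by
  rcases lt_or_ge N y with hy | hy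
  · exact pentagonAt_of_lt_right s _ _ _ _ _ _ _ (by omega)
  rcases lt_or_ge (N + 1) i with hi | hi
  · exact pentagonAt_of_lt_left s _ _ _ _ _ _ _ (by omega)
  have hs := h.s_ne
  have hq := h.q_ne
  have hb0 := h.b₀_ne
  have hb1 := h.b₁_ne
  have hb2 := h.b₂_ne
  have hb3 := h.b₃_ne
  have hb4 := h.b₄_ne
  have eL := convolution_zero_succ h i (x := x) hy
  have hd : 1 - b₀ ^ 2 * b₄ ^ 2 * (s ^ 2) ^ 2 ≠ 0 := by
    rw [mul_comm (b₀ ^ 2)]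
    exact (h.a₄₀.mul_pow hq _).one_sub
  have eR : (1 - b₀ ^ 2 * b₄ ^ 2 * (s ^ 2) ^ 2) * s ^ N *
      (qRacah s 0 (x + 1) b₃ b₄ b₀ (N + 1 - i) * qRacah s i y b₀ b₁ b₂ (N - x)) =
      (1 - s ^ 2 * b₃ ^ 2) * b₄ * s * s ^ i *
      (qRacah s 0 x (s * b₃) (s * b₄) b₀ (N - i) * qRacah s i y b₀ b₁ b₂ (N - x)) := by
    rcases hi.eq_or_lt with rfl | hi
    · rw [qRacah_of_lt_left s (show N - x < N + 1 by omega)]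
      ring
    have hi : i ≤ N := Nat.lt_succ_iff.1 hi
    have tG : GenericTriple s b₃ b₄ b₀ := h.rotate.rotate.rotate.triple
    have hz : s ^ (2 * ((0 : ℕ) : ℤ) - (N - i : ℕ) - 1) * s ^ N * s = s ^ i := by
      rw [← zpow_natCast, ← zpow_natCast, ← zpow_add₀ hs, ← zpow_add_one₀ hs]
      congr 1
      push_cast [hi]
      ring
    have e := qRacah_zero_succ tG x (N - i)
    rw [show N - i + 1 = N + 1 - i by omega, mul_zero, zero_add, mul_comm (b₄ ^ 2)] at e
    rw [e]
    generalize 1 - b₀ ^ 2 * b₄ ^ 2 * (s ^ 2) ^ 2 = f at *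
    field_simp
    linear_combination (1 - s ^ 2 * b₃ ^ 2) * qRacah s 0 x (s * b₃) (s * b₄) b₀ (N - i) *
      qRacah s i y b₀ b₁ b₂ (N - x) * hz
  unfold PentagonAt at ih ⊢
  rw [show N + 1 - (x + 1) = N - x by omega, weight_zero]
  rw [weight_zero] at ih
  have hwi : weight s i b₁ b₂ (b₀ * b₂ / (b₁ * b₃)) =
      s ^ i * weight s i b₁ b₂ (b₀ * b₂ / (b₁ * (s * b₃))) := by
    rw [← weight_mul_right]
    congr 1
    field_simp
  have hwy : weight s y b₀ b₁ (s * b₄ * b₁ / (b₂ * b₀)) =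
      s ^ y * weight s y b₀ b₁ (b₄ * b₁ / (b₂ * b₀)) := by
    rw [← weight_mul_right]
    congr 1
    field_simp
  have hwx := weight_succ_shift (b₁ := b₃) hs h.a₄ (b₂ * b₄ / (b₀ * b₃)) x
  have ht : b₂ * b₄ / (b₀ * b₃) * (b₀ * b₃) = b₂ * b₄ := div_mul_cancel₀ _ (mul_ne_zero hb0 hb3)
  rw [hwy, show b₂ * (s * b₄) / (b₀ * (s * b₃)) = b₂ * b₄ / (b₀ * b₃) by field_simp] at ih
  rw [hwi]
  have hp := h.prod_eq
  generalize b₂ * b₄ / (b₀ * b₃) = t at *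
  generalize weight s i b₁ b₂ (b₀ * b₂ / (b₁ * (s * b₃))) = Wi at *
  generalize weight s y b₀ b₁ (b₄ * b₁ / (b₂ * b₀)) = Wy at *
  generalize weight s (x + 1) b₃ b₄ t = Wx at *
  generalize weight s x (s * b₃) (s * b₄) t = Wx' at *
  generalize convolution s b₀ b₁ b₂ b₃ b₄ (N + 1) i 0 (x + 1) y = C at *
  generalize convolution s b₀ b₁ b₂ (s * b₃) (s * b₄) N i 0 x y = C' at *
  refine mul_left_cancel₀ (mul_ne_zero hd (pow_ne_zero N hs)) ?_
  rw [eR, ← ih]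
  linear_combination (s ^ i * Wi * Wy * Wx) * eL +
    b₃ ^ 2 * b₁ * b₀ ^ 2 * b₄ * (s ^ 2) ^ (N + 3) * s ^ y * C' * s ^ i * Wi * Wy * hwx +
    b₃ * b₁ * b₀ * b₄ * (s ^ 2) ^ (N + 3) * s ^ y * C' * s ^ i * Wi * Wy *
      (1 - s ^ 2 * b₃ ^ 2) * Wx' * ht +
    (1 - s ^ 2 * b₃ ^ 2) * b₄ * s * s ^ i * C' * Wi * s ^ y * Wy * Wx' * hp

/-! ### Variable zero, and the step in `i` for `j = x = 0`. -/

theorem qRacah_zero_right {s b₁ b₂ b₃ : ℂ} (h : GenericTriple s b₁ b₂ b₃) (n r : ℕ) :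
    qRacah s n 0 b₁ b₂ b₃ (n + r) = Omega s n b₁ b₂ b₃ (n + r) := by
  rw [qRacah_eq s (Nat.le_add_right n r) (Nat.zero_le _), racahPhi_swap h.q_ne, racahPhi_zero,
    mul_one]

theorem qRacah_zero_right_mul_shift {s b₁ b₂ b₃ : ℂ} (h : GenericTriple s b₁ b₂ b₃) (n r : ℕ) :
    qRacah s n 0 b₁ b₂ b₃ (n + r) * ((1 - b₂ ^ 2 * b₃ ^ 2 * (s ^ 2) ^ (n + 1)) *
      (1 - b₁ ^ 2 * b₂ ^ 2 * b₃ ^ 2 * (s ^ 2) ^ (2 * n + r + 2)) * (1 - s ^ 2 * b₃ ^ 2) *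
      (1 - b₂ ^ 2 * b₃ ^ 2 * (s ^ 2) ^ (2 * n + 2))) =
    qRacah s n 0 b₁ b₂ (s * b₃) (n + r) * ((1 - b₂ ^ 2 * b₃ ^ 2 * (s ^ 2) ^ (2 * n + 1)) *
      (1 - b₂ ^ 2 * b₃ ^ 2 * (s ^ 2) ^ (2 * n + r + 2)) *
      (1 - b₁ ^ 2 * b₂ ^ 2 * b₃ ^ 2 * (s ^ 2) ^ (n + r + 2)) *
      (1 - b₃ ^ 2 * (s ^ 2) ^ (n + 1))) := by
  have hq := h.q_ne
  have e1 := qPoch_shift (s ^ 2) (b₂ ^ 2 * b₃ ^ 2 * (s ^ 2) ^ (n + 1)) (n + r + 1)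
  have e2 := qPoch_shift (s ^ 2) (b₁ ^ 2 * b₂ ^ 2 * b₃ ^ 2 * (s ^ 2) ^ (n + r + 2)) n
  have e3 := qPoch_shift (s ^ 2) (s ^ 2 * b₃ ^ 2) n
  rw [mul_assoc _ _ (s ^ 2), ← pow_succ, mul_assoc (b₂ ^ 2 * b₃ ^ 2) _ ((s ^ 2) ^ (n + r + 1)),
    ← pow_add, show n + 1 + (n + r + 1) = 2 * n + r + 2 by ring] at e1
  rw [mul_assoc _ _ (s ^ 2), ← pow_succ, mul_assoc _ ((s ^ 2) ^ (n + r + 2)) _,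
    ← pow_add, show n + r + 2 + n = 2 * n + r + 2 by ring] at e2
  rw [show s ^ 2 * b₃ ^ 2 * (s ^ 2) ^ n = b₃ ^ 2 * (s ^ 2) ^ (n + 1) by ring] at e3
  have n1 := (h.a₂₃.mul_pow hq (n + 1)).qPoch_ne (n + r + 1)
  have n2 := (h.a₂₃.mul_pow hq (n + 1 + 1)).qPoch_ne (n + r + 1)
  have n3 := (h.a₃.self_mul hq).qPoch_ne n
  have n4 := ((h.a₃.self_mul hq).mul_self hq).qPoch_ne n
  have n5 := qPoch_self_ne h.root n
  have n6 := qPoch_self_ne h.root r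
  have n7 : (s * b₂) ^ ((n : ℤ) - r) ≠ 0 := zpow_ne_zero _ (mul_ne_zero h.s_ne h.b₂_ne)
  rw [qRacah_zero_right h, qRacah_zero_right h.shift₃, Omega_add h, Omega_add h.shift₃,
    show b₂ ^ 2 * (s * b₃) ^ 2 * (s ^ 2) ^ (2 * n + 1) =
      b₂ ^ 2 * b₃ ^ 2 * (s ^ 2) ^ (2 * n + 2) by ring,
    show b₂ ^ 2 * (s * b₃) ^ 2 * (s ^ 2) ^ (n + 1) = b₂ ^ 2 * b₃ ^ 2 * (s ^ 2) ^ (n + 1 + 1) by ring,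
    show b₁ ^ 2 * b₂ ^ 2 * (s * b₃) ^ 2 * (s ^ 2) ^ (n + r + 2) =
      b₁ ^ 2 * b₂ ^ 2 * b₃ ^ 2 * (s ^ 2) ^ (n + r + 2 + 1) by ring,
    show s ^ 2 * (s * b₃) ^ 2 = s ^ 2 * b₃ ^ 2 * s ^ 2 by ring]
  generalize qPoch (s ^ 2) (b₂ ^ 2 * b₃ ^ 2 * (s ^ 2) ^ (n + 1)) (n + r + 1) = X₁ at *
  generalize qPoch (s ^ 2) (b₂ ^ 2 * b₃ ^ 2 * (s ^ 2) ^ (n + 1 + 1)) (n + r + 1) = X₂ at *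
  generalize qPoch (s ^ 2) (b₁ ^ 2 * b₂ ^ 2 * b₃ ^ 2 * (s ^ 2) ^ (n + r + 2)) n = X₃ at *
  generalize qPoch (s ^ 2) (b₁ ^ 2 * b₂ ^ 2 * b₃ ^ 2 * (s ^ 2) ^ (n + r + 2 + 1)) n = X₄ at *
  generalize qPoch (s ^ 2) (s ^ 2 * b₃ ^ 2) n = X₅ at *
  generalize qPoch (s ^ 2) (s ^ 2 * b₃ ^ 2 * s ^ 2) n = X₆ at *
  generalize qPoch (s ^ 2) (s ^ 2) n = X₇ at *
  generalize qPoch (s ^ 2) (s ^ 2) r = X₈ at *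
  generalize (s * b₂) ^ ((n : ℤ) - r) = X₉ at *
  generalize qPoch (s ^ 2) (s ^ 2) (n + r) = X₁₀ at *
  generalize qPoch (s ^ 2) (s ^ 2 * b₂ ^ 2) n = X₁₁ at *
  generalize qPoch (s ^ 2) (s ^ 2 * b₁ ^ 2) r = X₁₂ at *
  generalize 1 - b₂ ^ 2 * b₃ ^ 2 * (s ^ 2) ^ (n + 1) = f₁ at *
  generalize 1 - b₂ ^ 2 * b₃ ^ 2 * (s ^ 2) ^ (2 * n + r + 2) = f₂ at *
  generalize 1 - b₁ ^ 2 * b₂ ^ 2 * b₃ ^ 2 * (s ^ 2) ^ (n + r + 2) = f₃ at *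
  generalize 1 - b₁ ^ 2 * b₂ ^ 2 * b₃ ^ 2 * (s ^ 2) ^ (2 * n + r + 2) = f₄ at *
  generalize 1 - s ^ 2 * b₃ ^ 2 = f₅ at *
  generalize 1 - b₃ ^ 2 * (s ^ 2) ^ (n + 1) = f₆ at *
  generalize 1 - b₂ ^ 2 * b₃ ^ 2 * (s ^ 2) ^ (2 * n + 2) = f₇ at *
  generalize 1 - b₂ ^ 2 * b₃ ^ 2 * (s ^ 2) ^ (2 * n + 1) = f₈ at *
  field_simp
  linear_combination X₁₀ * f₈ * X₁₁ * X₁₂ * f₇ *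
    (f₅ * X₆ * X₃ * f₄ * e1 - X₁ * f₂ * f₅ * X₆ * e2 + X₁ * f₂ * X₄ * f₃ * e3)

theorem qRacah_succ_zero_right_mul_shift {s b₁ b₂ b₃ : ℂ} (h : GenericTriple s b₁ b₂ b₃)
    (n r : ℕ) :
    qRacah s (n + 1) 0 b₁ b₂ b₃ (n + r) * ((1 - (s ^ 2) ^ (n + 1)) * (1 - b₁ ^ 2 * (s ^ 2) ^ r) *
      (s * b₂) ^ 2 * (1 - s ^ 2 * b₃ ^ 2) * (1 - b₂ ^ 2 * b₃ ^ 2 * (s ^ 2) ^ (2 * n + 2))) =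
    qRacah s n 0 b₁ b₂ (s * b₃) (n + r) * ((1 - b₂ ^ 2 * b₃ ^ 2 * (s ^ 2) ^ (2 * n + 3)) *
      (1 - (s ^ 2) ^ r) * (1 - b₂ ^ 2 * (s ^ 2) ^ (n + 1)) *
      (1 - b₁ ^ 2 * b₂ ^ 2 * b₃ ^ 2 * (s ^ 2) ^ (n + r + 2))) := by
  rcases r with _ | r
  · simp [qRacah_of_lt_left s (Nat.lt_succ_self n)]
  have hq := h.q_ne
  have e2 := qPoch_succ' (s ^ 2) (b₁ ^ 2 * b₂ ^ 2 * b₃ ^ 2 * (s ^ 2) ^ (n + (r + 1) + 2)) n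
  have e3 := qPoch_succ' (s ^ 2) (s ^ 2 * b₃ ^ 2) n
  have e4 := qPoch_succ (s ^ 2) (s ^ 2) n
  have e5 := qPoch_succ (s ^ 2) (s ^ 2) r
  have e6 := qPoch_succ (s ^ 2) (s ^ 2 * b₂ ^ 2) n
  have e7 := qPoch_succ (s ^ 2) (s ^ 2 * b₁ ^ 2) r
  rw [mul_assoc _ _ (s ^ 2), ← pow_succ] at e2
  rw [← pow_succ'] at e4 e5
  rw [show s ^ 2 * b₂ ^ 2 * (s ^ 2) ^ n = b₂ ^ 2 * (s ^ 2) ^ (n + 1) by ring] at e6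
  rw [show s ^ 2 * b₁ ^ 2 * (s ^ 2) ^ r = b₁ ^ 2 * (s ^ 2) ^ (r + 1) by ring] at e7
  have hsb := mul_ne_zero h.s_ne h.b₂_ne
  have hz : (s * b₂) ^ (((n + 1 : ℕ) : ℤ) - r) = (s * b₂) ^ ((n : ℤ) - (r + 1 : ℕ)) * (s * b₂) ^ 2 := by
    rw [← zpow_natCast, ← zpow_add₀ hsb]
    congr 1
    push_cast
    ring
  have n2 := (h.a₂₃.mul_pow hq (n + 1 + 1)).qPoch_ne (n + (r + 1) + 1)
  have n3 := (h.a₃.self_mul hq).one_sub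
  have n4 := ((h.a₃.self_mul hq).mul_self hq).qPoch_ne n
  have n5 := qPoch_self_ne h.root n
  have n6 := qPoch_self_ne h.root r
  have n7 : (s * b₂) ^ ((n : ℤ) - (r + 1 : ℕ)) ≠ 0 := zpow_ne_zero _ hsb
  have n8 := h.root n
  have n9 := h.root r
  have e0 := qRacah_zero_right h (n + 1) r
  have e0' := Omega_add h (n + 1) r
  rw [show n + 1 + r = n + (r + 1) by ring] at e0 e0'
  rw [e0, qRacah_zero_right h.shift₃, e0', Omega_add h.shift₃,
    show b₂ ^ 2 * (s * b₃) ^ 2 * (s ^ 2) ^ (2 * n + 1) =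
      b₂ ^ 2 * b₃ ^ 2 * (s ^ 2) ^ (2 * n + 2) by ring,
    show b₂ ^ 2 * (s * b₃) ^ 2 * (s ^ 2) ^ (n + 1) = b₂ ^ 2 * b₃ ^ 2 * (s ^ 2) ^ (n + 1 + 1) by ring,
    show b₁ ^ 2 * b₂ ^ 2 * (s * b₃) ^ 2 * (s ^ 2) ^ (n + (r + 1) + 2) =
      b₁ ^ 2 * b₂ ^ 2 * b₃ ^ 2 * (s ^ 2) ^ (n + (r + 1) + 2 + 1) by ring,
    show s ^ 2 * (s * b₃) ^ 2 = s ^ 2 * b₃ ^ 2 * s ^ 2 by ring,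
    show 2 * (n + 1) + 1 = 2 * n + 3 by ring, hz, e2, e3, e4, e5, e6, e7]
  generalize qPoch (s ^ 2) (b₂ ^ 2 * b₃ ^ 2 * (s ^ 2) ^ (n + 1 + 1)) (n + (r + 1) + 1) = X₂ at *
  generalize qPoch (s ^ 2) (b₁ ^ 2 * b₂ ^ 2 * b₃ ^ 2 * (s ^ 2) ^ (n + (r + 1) + 2 + 1)) n = X₄ at *
  generalize qPoch (s ^ 2) (s ^ 2 * b₃ ^ 2 * s ^ 2) n = X₆ at *
  generalize qPoch (s ^ 2) (s ^ 2) n = X₇ at *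
  generalize qPoch (s ^ 2) (s ^ 2) r = X₈ at *
  generalize (s * b₂) ^ ((n : ℤ) - (r + 1 : ℕ)) = X₉ at *
  generalize qPoch (s ^ 2) (s ^ 2) (n + (r + 1)) = X₁₀ at *
  generalize qPoch (s ^ 2) (s ^ 2 * b₂ ^ 2) n = X₁₁ at *
  generalize qPoch (s ^ 2) (s ^ 2 * b₁ ^ 2) r = X₁₂ at *
  generalize 1 - s ^ 2 * b₃ ^ 2 = f₅ at *
  generalize 1 - (s ^ 2) ^ (n + 1) = f₉ at *
  generalize 1 - (s ^ 2) ^ (r + 1) = f₁₀ at *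
  generalize hsb' : s * b₂ = σ at *
  field_simp

theorem qRacah_zero_right_pred_mul {s b₁ b₂ b₃ : ℂ} (h : GenericTriple s b₁ b₂ b₃)
    (n r : ℕ) :
    qRacah s n 0 b₁ b₂ b₃ (n + r - 1) * ((1 - (s ^ 2) ^ (n + r)) *
      (1 - b₁ ^ 2 * b₂ ^ 2 * b₃ ^ 2 * (s ^ 2) ^ (2 * n + r + 1)) * (1 - b₁ ^ 2 * (s ^ 2) ^ r) *
      (s * b₂)) =
    qRacah s n 0 b₁ b₂ b₃ (n + r) * ((1 - (s ^ 2) ^ r) *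
      (1 - b₂ ^ 2 * b₃ ^ 2 * (s ^ 2) ^ (2 * n + r + 1)) *
      (1 - b₁ ^ 2 * b₂ ^ 2 * b₃ ^ 2 * (s ^ 2) ^ (n + r + 1))) := by
  -- For `r = 0` the right side has the factor `1 - q^0`. On the left the degree exceeds the size `n
  -- - 1`, except for `n = 0`, where the factor `1 - q^{n+r}` vanishes.
  rcases r with _ | r
  · rcases n with _ | n
    · simp
    · simp [qRacah_of_lt_left s (Nat.lt_succ_self n)]
  have hq := h.q_ne
  have e1 := qPoch_succ (s ^ 2) (b₂ ^ 2 * b₃ ^ 2 * (s ^ 2) ^ (n + 1)) (n + r + 1)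
  have e2 := qPoch_shift (s ^ 2) (b₁ ^ 2 * b₂ ^ 2 * b₃ ^ 2 * (s ^ 2) ^ (n + r + 2)) n
  have e4 := qPoch_succ (s ^ 2) (s ^ 2) (n + r)
  have e5 := qPoch_succ (s ^ 2) (s ^ 2) r
  have e7 := qPoch_succ (s ^ 2) (s ^ 2 * b₁ ^ 2) r
  rw [mul_assoc _ _ (s ^ 2), ← pow_succ, mul_assoc _ ((s ^ 2) ^ (n + r + 2)) _,
    ← pow_add, show n + r + 2 + n = 2 * n + (r + 1) + 1 by ring] at e2
  rw [mul_assoc _ ((s ^ 2) ^ (n + 1)), ← pow_add,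
    show n + 1 + (n + r + 1) = 2 * n + (r + 1) + 1 by ring] at e1
  rw [← pow_succ'] at e4 e5
  rw [show s ^ 2 * b₁ ^ 2 * (s ^ 2) ^ r = b₁ ^ 2 * (s ^ 2) ^ (r + 1) by ring] at e7
  have hsb := mul_ne_zero h.s_ne h.b₂_ne
  have hz : (s * b₂) ^ ((n : ℤ) - r) = (s * b₂) ^ ((n : ℤ) - (r + 1 : ℕ)) * (s * b₂) := by
    rw [← zpow_add_one₀ hsb]
    congr 1
    push_cast
    ring
  have n1 := (h.a₂₃.mul_pow hq (n + 1)).qPoch_ne (n + r + 1)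
  have n2 := (h.a₂₃.mul_pow hq (2 * n + (r + 1) + 1)).one_sub
  have n3 := (h.a₃.self_mul hq).qPoch_ne n
  have n5 := qPoch_self_ne h.root n
  have n6 := qPoch_self_ne h.root r
  have n7 : (s * b₂) ^ ((n : ℤ) - (r + 1 : ℕ)) ≠ 0 := zpow_ne_zero _ hsb
  have n9 := h.root r
  rw [show n + (r + 1) - 1 = n + r by omega, qRacah_zero_right h, qRacah_zero_right h, Omega_add h,
    Omega_add h, show n + (r + 1) + 1 = n + r + 1 + 1 by ring, e1, hz,
    show n + (r + 1) + 2 = n + r + 2 + 1 by ring, show n + (r + 1) = n + r + 1 by ring, e4, e5, e7,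
    show n + r + 1 + 1 = n + r + 2 by ring]
  generalize qPoch (s ^ 2) (b₂ ^ 2 * b₃ ^ 2 * (s ^ 2) ^ (n + 1)) (n + r + 1) = X₂ at *
  generalize qPoch (s ^ 2) (b₁ ^ 2 * b₂ ^ 2 * b₃ ^ 2 * (s ^ 2) ^ (n + r + 2)) n = X₃ at *
  generalize qPoch (s ^ 2) (b₁ ^ 2 * b₂ ^ 2 * b₃ ^ 2 * (s ^ 2) ^ (n + r + 2 + 1)) n = X₄ at *
  generalize qPoch (s ^ 2) (s ^ 2 * b₃ ^ 2) n = X₆ at *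
  generalize qPoch (s ^ 2) (s ^ 2) n = X₇ at *
  generalize qPoch (s ^ 2) (s ^ 2) r = X₈ at *
  generalize (s * b₂) ^ ((n : ℤ) - (r + 1 : ℕ)) = X₉ at *
  generalize qPoch (s ^ 2) (s ^ 2) (n + r) = X₁₀ at *
  generalize qPoch (s ^ 2) (s ^ 2 * b₂ ^ 2) n = X₁₁ at *
  generalize qPoch (s ^ 2) (s ^ 2 * b₁ ^ 2) r = X₁₂ at *
  generalize 1 - b₁ ^ 2 * b₂ ^ 2 * b₃ ^ 2 * (s ^ 2) ^ (2 * n + (r + 1) + 1) = f₁ at *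
  generalize 1 - b₂ ^ 2 * b₃ ^ 2 * (s ^ 2) ^ (2 * n + (r + 1) + 1) = f₂ at *
  generalize 1 - b₁ ^ 2 * b₂ ^ 2 * b₃ ^ 2 * (s ^ 2) ^ (n + r + 2) = f₃ at *
  generalize 1 - (s ^ 2) ^ (r + 1) = f₁₀ at *
  generalize hsb' : s * b₂ = σ at *
  field_simp
  linear_combination -(X₁₀ * X₁₁ * X₁₂ * (1 - b₂ ^ 2 * b₃ ^ 2 * (s ^ 2) ^ (2 * n + 1)) *
    (1 - (s ^ 2) ^ (n + r + 1)) * (1 - b₁ ^ 2 * (s ^ 2) ^ (r + 1))) * e2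

/-- What remains of the recurrence for each `a` after division by the products, with `A, R, Y`
standing for `q^a, q^r, q^y`. The constraint makes all quantities nonzero and determines `b₁`; with
`b₁` and `t` eliminated it is an identity of rational functions. -/
theorem pentagon_scalar_identity {s A R Y b₀ b₁ b₂ b₃ b₄ t : ℂ} (hp : s ^ 3 * A * R * Y * b₀ * b₁ * b₂ * b₃ * b₄ = 1)
  (ht : t * (b₄ * b₂) = b₁ * b₃) :
  b₀ * b₄ * (1 - b₀ ^ 2 * b₁ ^ 2 * (Y ^ 2 * s ^ 2)) *
    (-((1 - Y * R) * (b₁ ^ 2 * b₂ ^ 2 * b₃ ^ 2 * (A ^ 2 * R * Y * s ^ 4)) * (s * b₀) *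
      (1 - b₃ ^ 2 * b₂ ^ 2 * (A ^ 2 * R * s ^ 4)) * (1 - b₂ ^ 2 * (A * s ^ 2)) *
      (1 - b₄ ^ 2 * R) * b₃ ^ 2 * s) -
     b₂ ^ 2 * (1 - b₃ ^ 2 * b₂ ^ 2 * (A ^ 2 * R * Y * s ^ 4)) * (1 - b₃ ^ 2 * (A * s ^ 2)) * t *
      (1 - R) * (1 - b₄ ^ 2 * b₃ ^ 2 * b₂ ^ 2 * (A ^ 2 * R * s ^ 4)) * s) =
  (1 - b₃ ^ 2 * b₂ ^ 2 * (A ^ 2 * s ^ 4)) * b₃ ^ 2 *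
    (b₄ * (1 - b₀ ^ 2 * b₁ ^ 2 * b₂ ^ 2 * (A * R * Y ^ 2 * s ^ 4)) *
      (1 - b₀ ^ 2 * b₁ ^ 2 * (Y * s ^ 2)) * (1 - R) * (1 - b₃ ^ 2 * b₂ ^ 2 * (A ^ 2 * R * s ^ 4)) +
     b₃ * s ^ 3 * b₀ * b₁ * b₂ * (b₀ ^ 2 * b₁ ^ 2 * (A * R * Y ^ 2 * s ^ 2)) *
      (1 - b₂ ^ 2 * (A * R * s ^ 2)) * (1 - Y) *
      (1 - b₄ ^ 2 * b₃ ^ 2 * b₂ ^ 2 * (A ^ 2 * R * s ^ 4)) * (1 - b₄ ^ 2 * R)) := by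
  have n : ∀ z : ℂ, z ∣ s ^ 3 * A * R * Y * b₀ * b₁ * b₂ * b₃ * b₄ → z ≠ 0 := by
    rintro z ⟨w, hw⟩ rfl
    rw [hp] at hw
    simp at hw
  have hs : s ≠ 0 := n s ⟨s ^ 2 * A * R * Y * b₀ * b₁ * b₂ * b₃ * b₄, by ring⟩
  have hA : A ≠ 0 := n A ⟨s ^ 3 * R * Y * b₀ * b₁ * b₂ * b₃ * b₄, by ring⟩
  have hR : R ≠ 0 := n R ⟨s ^ 3 * A * Y * b₀ * b₁ * b₂ * b₃ * b₄, by ring⟩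
  have hY : Y ≠ 0 := n Y ⟨s ^ 3 * A * R * b₀ * b₁ * b₂ * b₃ * b₄, by ring⟩
  have h0 : b₀ ≠ 0 := n b₀ ⟨s ^ 3 * A * R * Y * b₁ * b₂ * b₃ * b₄, by ring⟩
  have h2 : b₂ ≠ 0 := n b₂ ⟨s ^ 3 * A * R * Y * b₀ * b₁ * b₃ * b₄, by ring⟩
  have h3 : b₃ ≠ 0 := n b₃ ⟨s ^ 3 * A * R * Y * b₀ * b₁ * b₂ * b₄, by ring⟩
  have h4 : b₄ ≠ 0 := n b₄ ⟨s ^ 3 * A * R * Y * b₀ * b₁ * b₂ * b₃, by ring⟩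
  obtain rfl : t = b₁ * b₃ / (b₄ * b₂) := eq_div_of_mul_eq (mul_ne_zero h4 h2) ht
  obtain rfl : b₁ = 1 / (s ^ 3 * A * R * Y * b₀ * b₂ * b₃ * b₄) := by
    rw [eq_div_iff (by simp [hs, hA, hR, hY, h0, h2, h3, h4])]
    linear_combination hp
  field_simp
  ring

theorem qRacah_zero_left_eq {s b₁ b₂ b₃ : ℂ} (h : GenericTriple s b₁ b₂ b₃) {x M : ℕ}
    (hx : x ≤ M) : qRacah s 0 x b₁ b₂ b₃ M = qRacah s 0 0 b₁ b₂ b₃ M := by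
  rw [qRacah_zero_left h hx, qRacah_zero_left h M.zero_le]

theorem qRacah_zero_succ_mul_shift_left {s b₁ b₂ b₃ : ℂ} (h : GenericTriple s b₁ b₂ b₃) {x M : ℕ}
    (hx : x ≤ M + 1) :
    qRacah s 0 x b₁ b₂ b₃ (M + 1) * (1 - b₂ ^ 2 * b₃ ^ 2 * (s ^ 2) ^ (M + 2)) =
      qRacah s 0 0 (s * b₁) b₂ b₃ M * ((1 - s ^ 2 * b₁ ^ 2) * (s * b₂)) := by
  have h1 := (h.a₂₃.mul_pow h.q_ne (M + 2)).one_sub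
  have h4 := (h.a₂₃.mul_pow h.q_ne 2).qPoch_ne M
  rw [qRacah_zero_left h hx, qRacah_zero_left h.shift₁ M.zero_le, qPoch_succ', qPoch_succ,
    show s ^ 2 * (s * b₁) ^ 2 = s ^ 2 * b₁ ^ 2 * s ^ 2 by ring,
    mul_assoc _ ((s ^ 2) ^ 2), ← pow_add, add_comm 2 M]
  generalize qPoch (s ^ 2) (b₂ ^ 2 * b₃ ^ 2 * (s ^ 2) ^ 2) M = X at *
  generalize 1 - b₂ ^ 2 * b₃ ^ 2 * (s ^ 2) ^ (M + 2) = f at *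
  generalize qPoch (s ^ 2) (s ^ 2 * b₁ ^ 2 * s ^ 2) M = Y at *
  field_simp
  ring

theorem qRacah_zero_mul_shift_left {s b₁ b₂ b₃ : ℂ} (h : GenericTriple s b₁ b₂ b₃) {x M : ℕ}
    (hx : x ≤ M) :
    qRacah s 0 x b₁ b₂ b₃ M * (1 - b₁ ^ 2 * (s ^ 2) ^ (M + 1)) =
      qRacah s 0 0 (s * b₁) b₂ b₃ M * (1 - s ^ 2 * b₁ ^ 2) := by
  have key := qPoch_shift (s ^ 2) (s ^ 2 * b₁ ^ 2) M
  rw [qRacah_zero_left h hx, qRacah_zero_left h.shift₁ M.zero_le,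
    show s ^ 2 * (s * b₁) ^ 2 = s ^ 2 * b₁ ^ 2 * s ^ 2 by ring]
  linear_combination -((s * b₂) ^ M / qPoch (s ^ 2) (b₂ ^ 2 * b₃ ^ 2 * (s ^ 2) ^ 2) M) * key

/-- The termwise recurrence behind the convolution with `j = x = 0`. -/
theorem zero_zero_term_recurrence {s b₀ b₁ b₂ b₃ b₄ t : ℂ} {N : ℕ}
    (h : GenericQuintuple s (N + 1) b₀ b₁ b₂ b₃ b₄) (ht : t * (b₄ * b₂) = b₁ * b₃)
    {a y k : ℕ} (ha : a ≤ N) (hk : y + k = N + 1) :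
    b₀ * b₄ * (1 - b₀ ^ 2 * b₁ ^ 2 * (s ^ 2) ^ (2 * y + 1)) *
      ((1 - (s ^ 2) ^ (N + 1 - a)) * (1 - b₂ ^ 2 * (s ^ 2) ^ (a + 1)) *
        (1 - b₃ ^ 2 * b₂ ^ 2 * b₁ ^ 2 * (s ^ 2) ^ (N + a + 3)) *
        (1 - b₃ ^ 2 * b₂ ^ 2 * (s ^ 2) ^ (a + 1)) *
        (qRacah s 0 y b₁ b₀ b₄ (N + 1 - a) * (qRacah s a 0 b₄ b₃ b₂ (N + 1 - y) /
          (1 - b₃ ^ 2 * b₂ ^ 2 * (s ^ 2) ^ (2 * a + 1))) * weight s a b₂ b₃ t) -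
      s ^ 2 * b₂ ^ 2 * (1 - b₃ ^ 2 * b₂ ^ 2 * (s ^ 2) ^ (N + a + 3)) *
        (1 - b₃ ^ 2 * (s ^ 2) ^ (a + 1)) * (1 - b₁ ^ 2 * (s ^ 2) ^ (N + 1 - a)) *
        (1 - (s ^ 2) ^ (a + 1)) *
        (qRacah s 0 y b₁ b₀ b₄ (N - a) * (qRacah s (a + 1) 0 b₄ b₃ b₂ (N + 1 - y) /
          (1 - b₃ ^ 2 * b₂ ^ 2 * (s ^ 2) ^ (2 * a + 3))) * weight s (a + 1) b₂ b₃ t)) =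
    b₃ * (1 - s ^ 2 * b₁ ^ 2) * weight s a (s * b₂) b₃ t *
      (b₄ * (1 - (s ^ 2) ^ k) * (1 - b₀ ^ 2 * b₁ ^ 2 * b₂ ^ 2 * (s ^ 2) ^ (N + y + 3)) *
        (1 - b₀ ^ 2 * b₁ ^ 2 * (s ^ 2) ^ (y + 1)) *
        (qRacah s 0 y (s * b₁) b₀ b₄ (N - a) * qRacah s a 0 b₄ b₃ (s * b₂) (N - y)) -
      s ^ 2 * b₀ * b₁ * b₂ * (1 - b₀ ^ 2 * b₁ ^ 2 * (s ^ 2) ^ (N + y + 2)) *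
        (1 - b₂ ^ 2 * (s ^ 2) ^ (k + 1)) * (1 - (s ^ 2) ^ y) *
        (qRacah s 0 (y - 1) (s * b₁) b₀ b₄ (N - a) *
          qRacah s a 0 b₄ b₃ (s * b₂) (N - (y - 1)))) := by
  have hq := h.q_ne
  rcases lt_or_ge (N + 1 - a) y with hya | hya
  · simp only [qRacah_of_lt_right s hya, qRacah_of_lt_right s (show N - a < y by omega),
      qRacah_of_lt_right s (show N - a < y - 1 by omega)]
    ring
  obtain ⟨r, rfl⟩ : ∃ r, k = a + r := Nat.exists_eq_add_of_le (by omega)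
  have tR : GenericTriple s b₄ b₃ b₂ := h.reflect.triple
  have tQ : GenericTriple s b₁ b₀ b₄ := h.rotate.rotate.rotate.rotate.triple.swap
  have h0 := qRacah_zero_succ_mul_shift_left tQ (show y ≤ N - a + 1 by omega)
  -- At `r = 0` the variable `y` is just beyond `N - a`, and `Q` is zero by convention although its
  -- product formula is not. The factor `1 - q^r`, which `h3` will provide, covers this case.
  have h1 : (1 - (s ^ 2) ^ r) * (qRacah s 0 y b₁ b₀ b₄ (N - a) *
      (1 - b₁ ^ 2 * (s ^ 2) ^ (N - a + 1))) =
      (1 - (s ^ 2) ^ r) * (qRacah s 0 0 (s * b₁) b₀ b₄ (N - a) * (1 - s ^ 2 * b₁ ^ 2)) := by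
    rcases r with _ | r
    · simp
    · rw [qRacah_zero_mul_shift_left tQ (by omega)]
  have h1' : (1 - (s ^ 2) ^ r) * qRacah s 0 y (s * b₁) b₀ b₄ (N - a) =
      (1 - (s ^ 2) ^ r) * qRacah s 0 0 (s * b₁) b₀ b₄ (N - a) := by
    rcases r with _ | r
    · simp
    · rw [qRacah_zero_left_eq tQ.shift₁ (by omega)]
  have h1'' : (1 - (s ^ 2) ^ y) * (qRacah s 0 (y - 1) (s * b₁) b₀ b₄ (N - a) *
      qRacah s a 0 b₄ b₃ (s * b₂) (N - (y - 1))) = (1 - (s ^ 2) ^ y) *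
      (qRacah s 0 0 (s * b₁) b₀ b₄ (N - a) * qRacah s a 0 b₄ b₃ (s * b₂) (a + r)) := by
    rcases y with _ | y
    · simp
    · rw [qRacah_zero_left_eq tQ.shift₁ (by omega), show N - (y + 1 - 1) = a + r by omega]
  have h2 := qRacah_zero_right_mul_shift tR a r
  have h3 := qRacah_succ_zero_right_mul_shift tR a r
  have h4 : qRacah s a 0 b₄ b₃ (s * b₂) (a + r - 1) * ((1 - (s ^ 2) ^ a * (s ^ 2) ^ r) *
      (1 - b₄ ^ 2 * b₃ ^ 2 * b₂ ^ 2 * (((s ^ 2) ^ a) ^ 2 * (s ^ 2) ^ r * s ^ 4)) *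
      (1 - b₄ ^ 2 * (s ^ 2) ^ r) * (s * b₃)) =
    qRacah s a 0 b₄ b₃ (s * b₂) (a + r) * ((1 - (s ^ 2) ^ r) *
      (1 - b₃ ^ 2 * b₂ ^ 2 * (((s ^ 2) ^ a) ^ 2 * (s ^ 2) ^ r * s ^ 4)) *
      (1 - b₄ ^ 2 * b₃ ^ 2 * b₂ ^ 2 * ((s ^ 2) ^ a * (s ^ 2) ^ r * s ^ 4))) := by
    linear_combination qRacah_zero_right_pred_mul tR.shift₃ a r
  have h5 := weight_shift_left (s := s) (b₁ := b₂) (b₂ := b₃) t a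
  have h6 := weight_succ_shift_left (b₁ := b₂) h.s_ne h.a₃ t a
  have hp : s ^ 3 * (s ^ 2) ^ a * (s ^ 2) ^ r * (s ^ 2) ^ y * b₀ * b₁ * b₂ * b₃ * b₄ = 1 := by
    have := h.prod_eq
    rw [← hk] at this
    linear_combination this
  have hn : 1 - b₄ ^ 2 * b₃ ^ 2 * b₂ ^ 2 * (((s ^ 2) ^ a) ^ 2 * (s ^ 2) ^ r * s ^ 4) ≠ 0 := by
    have := (tR.a₁₂₃.mul_pow hq (2 * a + r + 2)).one_sub
    rwa [show (s ^ 2) ^ (2 * a + r + 2) = ((s ^ 2) ^ a) ^ 2 * (s ^ 2) ^ r * s ^ 4 by ring] at this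
  have hm : 1 - b₄ ^ 2 * (s ^ 2) ^ r ≠ 0 := (h.a₄.mul_pow hq _).one_sub
  have hD : 1 - b₃ ^ 2 * b₂ ^ 2 * (((s ^ 2) ^ a) ^ 2 * s ^ 4) ≠ 0 := by
    have := (tR.a₂₃.mul_pow hq (2 * a + 2)).one_sub
    rwa [show (s ^ 2) ^ (2 * a + 2) = ((s ^ 2) ^ a) ^ 2 * s ^ 4 by ring] at this
  have hd1 : 1 - b₃ ^ 2 * b₂ ^ 2 * (s ^ 2) ^ (2 * a + 1) ≠ 0 := (tR.a₂₃.mul_pow hq _).one_sub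
  have hd3 : 1 - b₃ ^ 2 * b₂ ^ 2 * (s ^ 2) ^ (2 * a + 3) ≠ 0 := (tR.a₂₃.mul_pow hq _).one_sub
  have hg : 1 - s ^ 2 * b₂ ^ 2 ≠ 0 := (h.a₂.self_mul hq).one_sub
  have hS := pentagon_scalar_identity hp ht
  obtain ⟨M, rfl⟩ : ∃ M, N = a + M := Nat.exists_eq_add_of_le ha
  have hp2 : (s ^ 3 * (s ^ 2) ^ a * (s ^ 2) ^ r * (s ^ 2) ^ y * b₀ * b₁ * b₂ * b₃ * b₄) ^ 2 = 1 := by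
    rw [hp, one_pow]
  rw [show a + M - y = a + r - 1 by omega, show a + M + 1 - y = a + r by omega,
    show a + M + 1 - a = M + 1 by omega, Nat.add_sub_cancel_left,
    show a + M + a + 3 = 2 * a + r + y + 2 by omega,
    show a + M + y + 3 = a + r + 2 * y + 2 by omega,
    show a + M + y + 2 = a + r + 2 * y + 1 by omega]
  rw [Nat.add_sub_cancel_left] at h0 h1 h1' h1''
  have hM : (s ^ 2) ^ (M + 1) = (s ^ 2) ^ y * (s ^ 2) ^ r := by
    rw [← pow_add]; congr 1; omega
  have hM2 : (s ^ 2) ^ (M + 2) = (s ^ 2) ^ y * (s ^ 2) ^ r * s ^ 2 := by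
    rw [← hM]; ring
  rw [hM2] at h0
  rw [hM] at h1 ⊢
  have x1 : (s ^ 2) ^ (a + 1) = (s ^ 2) ^ a * s ^ 2 := by ring
  have x2 : (s ^ 2) ^ (2 * y + 1) = ((s ^ 2) ^ y) ^ 2 * s ^ 2 := by ring
  have x3 : (s ^ 2) ^ (2 * a + r + y + 2) = ((s ^ 2) ^ a) ^ 2 * (s ^ 2) ^ r * (s ^ 2) ^ y * s ^ 4 := by
    ring
  have x4 : (s ^ 2) ^ (a + r + 2 * y + 2) = (s ^ 2) ^ a * (s ^ 2) ^ r * ((s ^ 2) ^ y) ^ 2 * s ^ 4 := by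
    ring
  have x5 : (s ^ 2) ^ (a + r + 2 * y + 1) = (s ^ 2) ^ a * (s ^ 2) ^ r * ((s ^ 2) ^ y) ^ 2 * s ^ 2 := by
    ring
  have x6 : (s ^ 2) ^ (a + r + 1) = (s ^ 2) ^ a * (s ^ 2) ^ r * s ^ 2 := by ring
  have x7 : (s ^ 2) ^ (y + 1) = (s ^ 2) ^ y * s ^ 2 := by ring
  have x8 : (s ^ 2) ^ (2 * a + 2) = ((s ^ 2) ^ a) ^ 2 * s ^ 4 := by ring
  have x9 : (s ^ 2) ^ (2 * a + r + 2) = ((s ^ 2) ^ a) ^ 2 * (s ^ 2) ^ r * s ^ 4 := by ring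
  have x10 : (s ^ 2) ^ (a + r + 2) = (s ^ 2) ^ a * (s ^ 2) ^ r * s ^ 4 := by ring
  have x11 : (s ^ 2) ^ (a + r) = (s ^ 2) ^ a * (s ^ 2) ^ r := pow_add ..
  rw [x1, x8, x9, x10] at h2
  rw [x1, x8, x10] at h3
  rw [x1] at h5 h6
  rw [x1, x2, x3, x4, x5, x6, x7, x11]
  generalize (s ^ 2) ^ a = A at *
  generalize (s ^ 2) ^ r = R at *
  generalize (s ^ 2) ^ y = Y at *
  -- By the constraint, these two factors are those already occurring in `h0` and in `h2`, up to
  -- monomials.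
  have k1 : 1 - b₃ ^ 2 * b₂ ^ 2 * b₁ ^ 2 * (A ^ 2 * R * Y * s ^ 4) =
      -(b₁ ^ 2 * b₂ ^ 2 * b₃ ^ 2 * (A ^ 2 * R * Y * s ^ 4)) *
        (1 - b₀ ^ 2 * b₄ ^ 2 * (Y * R * s ^ 2)) := by
    linear_combination -hp2
  have k2 : 1 - b₀ ^ 2 * b₁ ^ 2 * (A * R * Y ^ 2 * s ^ 2) =
      -(b₀ ^ 2 * b₁ ^ 2 * (A * R * Y ^ 2 * s ^ 2)) *
        (1 - b₄ ^ 2 * b₃ ^ 2 * b₂ ^ 2 * (A * R * s ^ 4)) := by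
    linear_combination -hp2
  have d1 := div_mul_cancel₀ (qRacah s a 0 b₄ b₃ b₂ (a + r)) hd1
  have d3 := div_mul_cancel₀ (qRacah s (a + 1) 0 b₄ b₃ b₂ (a + r)) hd3
  have h2' := mul_left_cancel₀ hd1 (show (1 - b₃ ^ 2 * b₂ ^ 2 * (s ^ 2) ^ (2 * a + 1)) *
    (qRacah s a 0 b₄ b₃ b₂ (a + r) / (1 - b₃ ^ 2 * b₂ ^ 2 * (s ^ 2) ^ (2 * a + 1)) *
      ((1 - b₃ ^ 2 * b₂ ^ 2 * (A * s ^ 2)) *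
      (1 - b₄ ^ 2 * b₃ ^ 2 * b₂ ^ 2 * (A ^ 2 * R * s ^ 4)) * (1 - s ^ 2 * b₂ ^ 2) *
      (1 - b₃ ^ 2 * b₂ ^ 2 * (A ^ 2 * s ^ 4)))) = (1 - b₃ ^ 2 * b₂ ^ 2 * (s ^ 2) ^ (2 * a + 1)) *
    (qRacah s a 0 b₄ b₃ (s * b₂) (a + r) * ((1 - b₃ ^ 2 * b₂ ^ 2 * (A ^ 2 * R * s ^ 4)) *
      (1 - b₄ ^ 2 * b₃ ^ 2 * b₂ ^ 2 * (A * R * s ^ 4)) * (1 - b₂ ^ 2 * (A * s ^ 2)))) by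
        rw [← mul_assoc, mul_comm _ (_ / _), d1, h2]; ring)
  have h3' := mul_left_cancel₀ hd3 (show (1 - b₃ ^ 2 * b₂ ^ 2 * (s ^ 2) ^ (2 * a + 3)) *
    (qRacah s (a + 1) 0 b₄ b₃ b₂ (a + r) / (1 - b₃ ^ 2 * b₂ ^ 2 * (s ^ 2) ^ (2 * a + 3)) *
      ((1 - A * s ^ 2) * (1 - b₄ ^ 2 * R) * (s * b₃) ^ 2 * (1 - s ^ 2 * b₂ ^ 2) *
      (1 - b₃ ^ 2 * b₂ ^ 2 * (A ^ 2 * s ^ 4)))) = (1 - b₃ ^ 2 * b₂ ^ 2 * (s ^ 2) ^ (2 * a + 3)) *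
    (qRacah s a 0 b₄ b₃ (s * b₂) (a + r) * ((1 - R) * (1 - b₃ ^ 2 * (A * s ^ 2)) *
      (1 - b₄ ^ 2 * b₃ ^ 2 * b₂ ^ 2 * (A * R * s ^ 4)))) by
        rw [← mul_assoc, mul_comm _ (_ / _), d3, h3]; ring)
  clear h2 h3 d1 d3
  have hs := h.s_ne
  have hb3 := h.b₃_ne
  refine mul_left_cancel₀ (mul_ne_zero (mul_ne_zero (mul_ne_zero (mul_ne_zero hn hm) hD) hg)
    (mul_ne_zero (pow_ne_zero 2 hb3) hs)) ?_
  clear hp hp2 hn hm hD hg hd1 hd3 x1 x2 x3 x4 x5 x6 x7 x8 x9 x10 x11 hM hM2 tR tQ h ht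
  generalize qRacah s a 0 b₄ b₃ b₂ (a + r) / (1 - b₃ ^ 2 * b₂ ^ 2 * (s ^ 2) ^ (2 * a + 1)) = R₀ at *
  generalize qRacah s (a + 1) 0 b₄ b₃ b₂ (a + r) /
    (1 - b₃ ^ 2 * b₂ ^ 2 * (s ^ 2) ^ (2 * a + 3)) = R₁ at *
  generalize qRacah s a 0 b₄ b₃ (s * b₂) (a + r) = ρ at *
  generalize qRacah s a 0 b₄ b₃ (s * b₂) (a + r - 1) = R' at *
  generalize qRacah s a 0 b₄ b₃ (s * b₂) (a + M - (y - 1)) = R'' at *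
  generalize qRacah s 0 y b₁ b₀ b₄ (M + 1) = Q₀ at *
  generalize qRacah s 0 y b₁ b₀ b₄ M = Q₁ at *
  generalize qRacah s 0 y (s * b₁) b₀ b₄ M = Q' at *
  generalize qRacah s 0 (y - 1) (s * b₁) b₀ b₄ M = Q'' at *
  generalize qRacah s 0 0 (s * b₁) b₀ b₄ M = T at *
  generalize weight s a b₂ b₃ t = w₀ at *
  generalize weight s (a + 1) b₂ b₃ t = w₁ at *
  generalize weight s a (s * b₂) b₃ t = w at *
  generalize 1 - b₀ ^ 2 * b₁ ^ 2 * (Y ^ 2 * s ^ 2) = F1 at *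
  generalize 1 - b₂ ^ 2 * (A * s ^ 2) = F3 at *
  generalize 1 - b₃ ^ 2 * b₂ ^ 2 * b₁ ^ 2 * (A ^ 2 * R * Y * s ^ 4) = F4 at *
  generalize 1 - b₃ ^ 2 * b₂ ^ 2 * (A * s ^ 2) = F5 at *
  generalize 1 - b₃ ^ 2 * b₂ ^ 2 * (A ^ 2 * R * Y * s ^ 4) = F6 at *
  generalize 1 - b₃ ^ 2 * (A * s ^ 2) = F7 at *
  generalize 1 - b₁ ^ 2 * (Y * R) = F8 at *
  generalize 1 - A * s ^ 2 = F9 at *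
  generalize 1 - A * R = F10 at *
  generalize 1 - b₀ ^ 2 * b₁ ^ 2 * b₂ ^ 2 * (A * R * Y ^ 2 * s ^ 4) = F11 at *
  generalize 1 - b₀ ^ 2 * b₁ ^ 2 * (Y * s ^ 2) = F12 at *
  generalize 1 - b₀ ^ 2 * b₁ ^ 2 * (A * R * Y ^ 2 * s ^ 2) = F13 at *
  generalize 1 - b₂ ^ 2 * (A * R * s ^ 2) = F14 at *
  generalize 1 - b₄ ^ 2 * b₃ ^ 2 * b₂ ^ 2 * (A ^ 2 * R * s ^ 4) = n at *
  generalize 1 - b₄ ^ 2 * R = m at *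
  generalize 1 - b₃ ^ 2 * b₂ ^ 2 * (A ^ 2 * s ^ 4) = D at *
  generalize 1 - b₃ ^ 2 * b₂ ^ 2 * (A ^ 2 * R * s ^ 4) = f at *
  generalize 1 - b₄ ^ 2 * b₃ ^ 2 * b₂ ^ 2 * (A * R * s ^ 4) = E at *
  generalize 1 - s ^ 2 * b₂ ^ 2 = g at *
  generalize 1 - s ^ 2 * b₁ ^ 2 = g₁ at *
  generalize b₁ ^ 2 * b₂ ^ 2 * b₃ ^ 2 * (A ^ 2 * R * Y * s ^ 4) = p at *
  generalize b₀ ^ 2 * b₁ ^ 2 * (A * R * Y ^ 2 * s ^ 2) = p' at *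
  generalize 1 - b₀ ^ 2 * b₄ ^ 2 * (Y * R * s ^ 2) = K at *
  generalize 1 - Y * R = F2 at *
  generalize 1 - Y = F15 at *
  generalize 1 - R = F16 at *
  linear_combination b₀ * b₄ * F1 * F2 * F3 * F4 * Q₀ * w₀ * m * b₃ ^ 2 * s * h2' +
    b₀ * b₄ * F1 * F2 * F3 * F4 * Q₀ * m * b₃ ^ 2 * s * ρ * f * E * h5 +
    b₀ * b₄ * F1 * F2 * F3 * Q₀ * m * b₃ ^ 2 * s * ρ * f * E * g * w * k1 -
    b₀ * b₄ * F1 * F2 * F3 * m * b₃ ^ 2 * s * ρ * f * E * g * w * p * h0 -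
    b₀ * b₄ * F1 * b₂ ^ 2 * F6 * F7 * F8 * Q₁ * w₁ * n * s * h3' -
    b₀ * b₄ * F1 * b₂ ^ 2 * F6 * F8 * Q₁ * n * s * ρ * F16 * F7 * E * h6 -
    b₀ * b₄ * F1 * b₂ ^ 2 * F6 * n * s * ρ * F7 * E * g * t * w * h1 +
    T * g₁ * ρ * E * g * w * hS -
    g₁ * w * b₄ * F11 * F12 * Q' * D * g * b₃ ^ 2 * h4 -
    g₁ * w * b₄ * F11 * F12 * D * g * b₃ ^ 2 * ρ * f * E * h1' +
    b₃ ^ 3 * g₁ * w * s ^ 3 * b₀ * b₁ * b₂ * F13 * F14 * n * m * D * g * h1'' +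
    b₃ ^ 3 * g₁ * w * s ^ 3 * b₀ * b₁ * b₂ * F14 * n * m * D * g * F15 * T * ρ * k2

/-- The convolution with its first degree lowered by one, when `j = x = 0`. -/
theorem convolution_succ_zero_zero {s b₀ b₁ b₂ b₃ b₄ : ℂ} {N : ℕ}
    (h : GenericQuintuple s (N + 1) b₀ b₁ b₂ b₃ b₄) (i : ℕ) {y k : ℕ} (hk : y + k = N + 1) :
    (1 - (s ^ 2) ^ (i + 1)) * (1 - b₂ ^ 2 * b₁ ^ 2 * (s ^ 2) ^ (i + 2)) * (1 - s ^ 2 * b₁ ^ 2) *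
      (s * b₂) * s ^ ((N : ℤ) - 2 * i) *
      (b₀ * b₄ * (1 - b₀ ^ 2 * b₁ ^ 2 * (s ^ 2) ^ (2 * y + 1))) *
      convolution s b₀ b₁ b₂ b₃ b₄ (N + 1) (i + 1) 0 0 y =
    b₃ * (1 - s ^ 2 * b₁ ^ 2) *
      (b₄ * (1 - (s ^ 2) ^ k) * (1 - b₀ ^ 2 * b₁ ^ 2 * b₂ ^ 2 * (s ^ 2) ^ (N + y + 3)) *
        (1 - b₀ ^ 2 * b₁ ^ 2 * (s ^ 2) ^ (y + 1)) *
        convolution s b₀ (s * b₁) (s * b₂) b₃ b₄ N i 0 0 y -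
      s ^ 2 * b₀ * b₁ * b₂ * (1 - b₀ ^ 2 * b₁ ^ 2 * (s ^ 2) ^ (N + y + 2)) *
        (1 - b₂ ^ 2 * (s ^ 2) ^ (k + 1)) * (1 - (s ^ 2) ^ y) *
        convolution s b₀ (s * b₁) (s * b₂) b₃ b₄ N i 0 0 (y - 1)) := by
  have hs := h.s_ne
  have hq := h.q_ne
  have tP : GenericTriple s b₃ b₂ b₁ := h.reflect.rotate.triple
  have ht : b₁ * b₃ / (b₄ * b₂) * (b₄ * b₂) = b₁ * b₃ :=
    div_mul_cancel₀ _ (mul_ne_zero h.b₄_ne h.b₂_ne)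
  have ht' : s * b₁ * b₃ / (b₄ * (s * b₂)) = b₁ * b₃ / (b₄ * b₂) := by field_simp
  simp only [convolution]
  rw [ht', Nat.sub_zero, Nat.sub_zero]
  generalize b₁ * b₃ / (b₄ * b₂) = t at *
  set κ := (1 - (s ^ 2) ^ (i + 1)) * (1 - b₂ ^ 2 * b₁ ^ 2 * (s ^ 2) ^ (i + 2)) *
    (1 - s ^ 2 * b₁ ^ 2) * (s * b₂) * s ^ ((N : ℤ) - 2 * i) with hκ
  set P : ℕ → ℂ := fun a => qRacah s i a b₃ (s * b₂) (s * b₁) N with hP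
  set S : ℕ → ℂ := fun a => qRacah s 0 y b₁ b₀ b₄ (N + 1 - a) *
    (qRacah s a 0 b₄ b₃ b₂ (N + 1 - y) / (1 - b₃ ^ 2 * b₂ ^ 2 * (s ^ 2) ^ (2 * a + 1))) *
      weight s a b₂ b₃ t with hS
  set α : ℕ → ℂ := fun a => (1 - (s ^ 2) ^ (N + 1 - a)) * (1 - b₂ ^ 2 * (s ^ 2) ^ (a + 1)) *
        (1 - b₃ ^ 2 * b₂ ^ 2 * b₁ ^ 2 * (s ^ 2) ^ (N + a + 3)) *
        (1 - b₃ ^ 2 * b₂ ^ 2 * (s ^ 2) ^ (a + 1)) with hα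
  set β : ℕ → ℂ := fun a => s ^ 2 * b₂ ^ 2 * (1 - b₃ ^ 2 * b₂ ^ 2 * (s ^ 2) ^ (N + a + 2)) *
        (1 - b₃ ^ 2 * (s ^ 2) ^ a) * (1 - b₁ ^ 2 * (s ^ 2) ^ (N + 2 - a)) * (1 - (s ^ 2) ^ a) with hβ
  have e1 : ∀ a, κ * (qRacah s (i + 1) a b₃ b₂ b₁ (N + 1) * qRacah s 0 y b₁ b₀ b₄ (N + 1 - a) *
      qRacah s a 0 b₄ b₃ b₂ (N + 1 - y) * weight s a b₂ b₃ t) =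
      α a * P a * S a - β a * P (a - 1) * S a := by
    intro a
    have e := qRacah_succ tP i a N
    have hd : 1 - b₃ ^ 2 * b₂ ^ 2 * (s ^ 2) ^ (2 * a + 1) ≠ 0 := (tP.a₁₂.mul_pow hq _).one_sub
    have hR := div_mul_cancel₀ (qRacah s a 0 b₄ b₃ b₂ (N + 1 - y)) hd
    rw [← hR]
    simp only [hα, hβ, hP, hS]
    linear_combination (qRacah s 0 y b₁ b₀ b₄ (N + 1 - a) * (qRacah s a 0 b₄ b₃ b₂ (N + 1 - y) /
      (1 - b₃ ^ 2 * b₂ ^ 2 * (s ^ 2) ^ (2 * a + 1))) * weight s a b₂ b₃ t) * e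
  have hα0 : α (N + 1) = 0 := by simp [hα]
  have hβ0 : β 0 = 0 := by simp [hβ]
  -- The terms with `P (a - 1)` are reindexed by `a + 1`. Since `α (N + 1) = 0` and `β 0 = 0`, both
  -- sums then run over `a ≤ N`, and the claim can be checked for each coefficient of `P a`.
  have e2 : κ * ∑ a ∈ Finset.range (N + 1 + 1), qRacah s (i + 1) a b₃ b₂ b₁ (N + 1) *
      qRacah s 0 y b₁ b₀ b₄ (N + 1 - a) * qRacah s a 0 b₄ b₃ b₂ (N + 1 - y) * weight s a b₂ b₃ t =
      ∑ a ∈ Finset.range (N + 1), P a * (α a * S a - β (a + 1) * S (a + 1)) := by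
    rw [Finset.mul_sum, Finset.sum_congr rfl fun a _ => e1 a, Finset.sum_sub_distrib,
      Finset.sum_range_succ, Finset.sum_range_succ' (fun a => β a * P (a - 1) * S a), hα0, hβ0]
    simp only [zero_mul, add_zero, Nat.add_sub_cancel]
    rw [← Finset.sum_sub_distrib]
    exact Finset.sum_congr rfl fun a _ => by ring
  rw [mul_right_comm, e2, Finset.sum_mul, mul_sub, mul_sub]
  simp only [Finset.mul_sum]
  rw [← Finset.sum_sub_distrib]
  refine Finset.sum_congr rfl fun a ha => ?_
  have ha : a ≤ N := Nat.lt_succ_iff.1 (Finset.mem_range.1 ha)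
  have key := zero_zero_term_recurrence h ht ha hk
  simp only [hα, hβ, hP, hS, show N + 1 - (a + 1) = N - a by omega,
    show N + 2 - (a + 1) = N + 1 - a by omega, show N + (a + 1) + 2 = N + a + 3 by ring,
    show 2 * (a + 1) + 1 = 2 * a + 3 by ring]
  generalize qRacah s i a b₃ (s * b₂) (s * b₁) N = p at *
  linear_combination p * key

/-- The factor of degree `j = 0` on the right keeps its size and parameters, so the recurrence of
the right side is simply `qRacah_succ` for the other factor. It matches the two-term recurrence of
the convolution. -/
theorem PentagonAt.succ_zero_zero {s b₀ b₁ b₂ b₃ b₄ : ℂ} {N : ℕ}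
    (h : GenericQuintuple s (N + 1) b₀ b₁ b₂ b₃ b₄) {i : ℕ}
    (ih : ∀ y, PentagonAt s b₀ (s * b₁) (s * b₂) b₃ b₄ N i 0 0 y) (y : ℕ) :
    PentagonAt s b₀ b₁ b₂ b₃ b₄ (N + 1) (i + 1) 0 0 y := by
  rcases lt_or_ge (N + 1) y with hy | hy
  · exact pentagonAt_of_lt_right s _ _ _ _ _ _ _ (by omega)
  obtain ⟨k, hk⟩ : ∃ k, y + k = N + 1 := ⟨_, Nat.add_sub_cancel' hy⟩
  have hs := h.s_ne
  have hq := h.q_ne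
  have hb0 := h.b₀_ne
  have hb1 := h.b₁_ne
  have hb2 := h.b₂_ne
  have hb3 := h.b₃_ne
  have hb4 := h.b₄_ne
  have eL := convolution_succ_zero_zero h i hk
  have eR := qRacah_succ h.triple i y N
  rw [show N + 1 - y = k by omega, show N + 2 - y = k + 1 by omega] at eR
  have hwi := weight_succ_shift (b₁ := b₁) hs h.a₂ (b₀ * b₂ / (b₁ * b₃)) i
  have hwy := weight_shift_right (b₁ := b₀) hs h.a₁ (b₄ * b₁ / (b₂ * b₀)) y
  have hwy' : (1 - (s ^ 2) ^ y) * ((1 - s ^ 2 * b₁ ^ 2) *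
      weight s y b₀ b₁ (b₄ * b₁ / (b₂ * b₀))) = (1 - (s ^ 2) ^ y) * ((1 - b₀ ^ 2 * (s ^ 2) ^ y) *
        (b₄ * b₁ / (b₂ * b₀)) * weight s (y - 1) b₀ (s * b₁) (b₄ * b₁ / (b₂ * b₀))) := by
    rcases y with _ | y
    · simp
    · rw [weight_succ_shift_right hs h.a₁, Nat.add_sub_cancel]
  have i1 := ih y
  have i2 := ih (y - 1)
  unfold PentagonAt at i1 i2 ⊢
  rw [weight_zero, weight_zero, Nat.sub_zero,
    show b₀ * (s * b₂) / (s * b₁ * b₃) = b₀ * b₂ / (b₁ * b₃) by field_simp,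
    show b₄ * (s * b₁) / (s * b₂ * b₀) = b₄ * b₁ / (b₂ * b₀) by field_simp] at i1 i2
  rw [weight_zero, weight_zero, Nat.sub_zero, show N + 1 - (i + 1) = N - i by omega]
  have ti : b₀ * b₂ / (b₁ * b₃) * (b₁ * b₃) = b₀ * b₂ := div_mul_cancel₀ _ (mul_ne_zero hb1 hb3)
  have ty : b₄ * b₁ / (b₂ * b₀) * (b₂ * b₀) = b₄ * b₁ := div_mul_cancel₀ _ (mul_ne_zero hb2 hb0)
  have hD : (1 - (s ^ 2) ^ (i + 1)) * (1 - b₁ ^ 2 * b₂ ^ 2 * (s ^ 2) ^ (i + 2)) *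
      (1 - s ^ 2 * b₂ ^ 2) * (s * b₁) * s ^ ((N : ℤ) - 2 * i) *
      (1 - b₀ ^ 2 * b₁ ^ 2 * (s ^ 2) ^ (2 * y + 1)) ≠ 0 :=
    mul_ne_zero (mul_ne_zero (mul_ne_zero (mul_ne_zero (mul_ne_zero (h.root i)
      (h.a₁₂.mul_pow hq _).one_sub) (h.a₂.self_mul hq).one_sub) (mul_ne_zero hs hb1))
      (zpow_ne_zero _ hs)) (h.a₀₁.mul_pow hq _).one_sub
  have hg : 1 - s ^ 2 * b₁ ^ 2 ≠ 0 := (h.a₁.self_mul hq).one_sub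
  rw [mul_comm (b₂ ^ 2) (b₁ ^ 2)] at eL
  generalize weight s (i + 1) b₁ b₂ (b₀ * b₂ / (b₁ * b₃)) = Wi at *
  generalize weight s i (s * b₁) (s * b₂) (b₀ * b₂ / (b₁ * b₃)) = Wi' at *
  generalize weight s y b₀ b₁ (b₄ * b₁ / (b₂ * b₀)) = Wy at *
  generalize weight s y b₀ (s * b₁) (b₄ * b₁ / (b₂ * b₀)) = Wy' at *
  generalize weight s (y - 1) b₀ (s * b₁) (b₄ * b₁ / (b₂ * b₀)) = Wy'' at *
  generalize b₀ * b₂ / (b₁ * b₃) = u at *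
  generalize b₄ * b₁ / (b₂ * b₀) = v at *
  generalize convolution s b₀ b₁ b₂ b₃ b₄ (N + 1) (i + 1) 0 0 y = C at *
  generalize convolution s b₀ (s * b₁) (s * b₂) b₃ b₄ N i 0 0 y = C' at *
  generalize convolution s b₀ (s * b₁) (s * b₂) b₃ b₄ N i 0 0 (y - 1) = C'' at *
  generalize 1 - (s ^ 2) ^ (i + 1) = f1 at *
  generalize 1 - b₁ ^ 2 * b₂ ^ 2 * (s ^ 2) ^ (i + 2) = f2 at *
  generalize s ^ ((N : ℤ) - 2 * i) = z at *
  generalize 1 - b₀ ^ 2 * b₁ ^ 2 * (s ^ 2) ^ (2 * y + 1) = f3 at *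
  generalize 1 - (s ^ 2) ^ k = f4 at *
  generalize 1 - b₀ ^ 2 * b₁ ^ 2 * b₂ ^ 2 * (s ^ 2) ^ (N + y + 3) = f5 at *
  generalize 1 - b₀ ^ 2 * b₁ ^ 2 * (s ^ 2) ^ (y + 1) = f6 at *
  generalize 1 - b₀ ^ 2 * b₁ ^ 2 * (s ^ 2) ^ (N + y + 2) = f7 at *
  generalize 1 - b₂ ^ 2 * (s ^ 2) ^ (k + 1) = f8 at *
  generalize 1 - (s ^ 2) ^ y = f9 at *
  generalize 1 - s ^ 2 * b₁ ^ 2 = g at *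
  generalize 1 - s ^ 2 * b₂ ^ 2 = g' at *
  generalize 1 - b₁ ^ 2 * (s ^ 2) ^ (y + 1) = f10 at *
  generalize 1 - b₀ ^ 2 * (s ^ 2) ^ y = f11 at *
  refine mul_left_cancel₀ (mul_ne_zero (mul_ne_zero hg (mul_ne_zero (mul_ne_zero hb2 hb0)
    (mul_ne_zero hb3 hb4))) hD) ?_
  linear_combination g * b₂ * b₀ * b₃ * b₄ * f1 * f2 * s * b₁ * z * f3 * C * Wy * hwi +
    g * u * b₁ * b₃ * Wi' * Wy * eL +
    g ^ 2 * Wi' * Wy * b₃ * (b₄ * f4 * f5 * f6 * C' - s ^ 2 * b₀ * b₁ * b₂ * f7 * f8 * f9 * C'') * ti +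
    g * b₀ * b₂ * b₃ * Wi' * b₄ * f4 * f5 * f6 * C' * hwy -
    g * b₀ * b₂ * b₃ * Wi' * s ^ 2 * b₀ * b₁ * b₂ * f7 * f8 * C'' * hwy' -
    g * b₃ * Wi' * s ^ 2 * b₀ * b₁ * b₂ * f7 * f8 * C'' * f9 * f11 * Wy'' * ty +
    g * b₀ * b₂ * b₃ * b₄ * (f10 * f4 * f5 * f6 * i1 - s ^ 2 * b₁ ^ 2 * f7 * f8 * f9 * f11 * i2 -
      qRacah s 0 0 b₃ b₄ b₀ (N - i) * eR)

/-! ### The base case `i = j = x = 0`. -/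

/-- With `j = x = 0` both `Q` and `R` are products, and the summand is very-well-poised with `A = q
c₂c₃`, `u = q c₄`, `v = q^{y+1} c₁` and `w = q^{y+2} c₀c₄`. -/
theorem base_term_eq {s b₀ b₁ b₂ b₃ b₄ : ℂ} {y m : ℕ}
    (h : GenericQuintuple s (y + m) b₀ b₁ b₂ b₃ b₄) {a : ℕ} (ha : a ≤ m) :
    qRacah s 0 y b₁ b₀ b₄ (y + m - a) * qRacah s a 0 b₄ b₃ b₂ m *
      weight s a b₂ b₃ (b₁ * b₃ / (b₄ * b₂)) =
    qPoch (s ^ 2) (s ^ 2 * b₁ ^ 2) y * (s * b₀) ^ y * (s ^ 2 * b₀ * b₃) ^ m /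
      qPoch (s ^ 2) (b₀ ^ 2 * b₄ ^ 2 * (s ^ 2) ^ 2) y *
    wpTerm (s ^ 2) (b₃ ^ 2 * b₂ ^ 2 * s ^ 2) (s ^ 2 * b₄ ^ 2) (s ^ 2 * b₁ ^ 2 * (s ^ 2) ^ y)
      (s ^ 2 * b₄ ^ 2 * (b₀ ^ 2 * (s ^ 2) ^ (y + 1))) m a := by
  obtain ⟨r, rfl⟩ : ∃ r, m = a + r := Nat.exists_eq_add_of_le ha
  have hs := h.s_ne
  have hq := h.q_ne
  have hb0 := h.b₀_ne
  have hb1 := h.b₁_ne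
  have hb2 := h.b₂_ne
  have hb3 := h.b₃_ne
  have hb4 := h.b₄_ne
  have tR : GenericTriple s b₄ b₃ b₂ := h.reflect.triple
  have tQ : GenericTriple s b₁ b₀ b₄ := h.rotate.rotate.rotate.rotate.triple.swap
  rw [show y + (a + r) - a = y + r by omega, qRacah_zero_left tQ (Nat.le_add_right y r),
    qRacah_zero_right tR, Omega_add tR, weight, wpTerm, qPoch_add, qPoch_add,
    Nat.add_sub_cancel_left]
  have hpow : (s * b₀) ^ (y + r) * (b₁ * b₃ / (b₄ * b₂)) ^ a =
      (s * b₀) ^ y * (s ^ 2 * b₀ * b₃) ^ (a + r) *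
        (s ^ 2 * b₁ ^ 2 * (s ^ 2) ^ y * (s ^ 2) ^ (a + r) / s ^ 2) ^ a *
        (s * b₃) ^ ((a : ℤ) - r) := by
    -- The ratio of the weight matches the geometric ratio `v q^m / q` of the series only through
    -- the constraint, taken at the level of square roots.
    have hp : b₁ * b₃ / (b₄ * b₂) = (s * b₀) * (s * b₃) ^ 2 *
        (s ^ 2 * b₁ ^ 2 * (s ^ 2) ^ y * (s ^ 2) ^ (a + r) / s ^ 2) := by
      have := h.prod_eq
      rw [show s ^ 2 * b₁ ^ 2 * (s ^ 2) ^ y * (s ^ 2) ^ (a + r) / s ^ 2 =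
        b₁ ^ 2 * (s ^ 2) ^ (y + (a + r)) by field_simp; ring, div_eq_iff (by simp [hb2, hb4])]
      linear_combination -b₁ * b₃ * this
    have hz : (s * b₃) ^ ((a : ℤ) - r) * (s * b₃) ^ r = (s * b₃) ^ a := by
      rw [← zpow_natCast, ← zpow_natCast, ← zpow_add₀ (mul_ne_zero hs hb3)]
      congr 1
      ring
    rw [hp, show s ^ 2 * b₀ * b₃ = (s * b₀) * (s * b₃) by ring]
    generalize s ^ 2 * b₁ ^ 2 * (s ^ 2) ^ y * (s ^ 2) ^ (a + r) / s ^ 2 = c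
    generalize s * b₀ = σ
    generalize s * b₃ = τ at *
    linear_combination -σ ^ (y + a + r) * τ ^ a * c ^ a * hz
  rw [show s ^ 2 * b₄ ^ 2 * (b₀ ^ 2 * (s ^ 2) ^ (y + 1)) =
      b₀ ^ 2 * b₄ ^ 2 * (s ^ 2) ^ 2 * (s ^ 2) ^ y by ring,
    show b₃ ^ 2 * b₂ ^ 2 * (s ^ 2) ^ (2 * a + 1) = b₃ ^ 2 * b₂ ^ 2 * s ^ 2 * (s ^ 2) ^ (2 * a) by ring,
    show b₃ ^ 2 * b₂ ^ 2 * (s ^ 2) ^ (a + 1) = b₃ ^ 2 * b₂ ^ 2 * s ^ 2 * (s ^ 2) ^ a by ring,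
    show b₄ ^ 2 * b₃ ^ 2 * b₂ ^ 2 * (s ^ 2) ^ (a + r + 2) =
      b₃ ^ 2 * b₂ ^ 2 * s ^ 2 * (s ^ 2 * b₄ ^ 2) * (s ^ 2) ^ (a + r) by ring]
  have n1 := (h.a₃.self_mul hq).qPoch_ne a
  have n2 := (h.a₂.self_mul hq).qPoch_ne a
  have n3 : (s * b₃) ^ ((a : ℤ) - r) ≠ 0 := zpow_ne_zero _ (mul_ne_zero hs hb3)
  generalize s ^ 2 * b₁ ^ 2 * (s ^ 2) ^ y * (s ^ 2) ^ (a + r) / s ^ 2 = c at *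
  generalize b₁ * b₃ / (b₄ * b₂) = t at *
  generalize (s * b₃) ^ ((a : ℤ) - r) = z at *
  generalize qPoch (s ^ 2) (s ^ 2 * b₃ ^ 2) a = X₁ at *
  generalize qPoch (s ^ 2) (s ^ 2 * b₂ ^ 2) a = X₂ at *
  generalize qPoch (s ^ 2) (s ^ 2 * b₁ ^ 2) y = X₃ at *
  generalize qPoch (s ^ 2) (s ^ 2 * b₁ ^ 2 * (s ^ 2) ^ y) r = X₄ at *
  generalize qPoch (s ^ 2) (b₀ ^ 2 * b₄ ^ 2 * (s ^ 2) ^ 2) y = X₅ at *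
  generalize qPoch (s ^ 2) (b₀ ^ 2 * b₄ ^ 2 * (s ^ 2) ^ 2 * (s ^ 2) ^ y) r = X₆ at *
  generalize qPoch (s ^ 2) (s ^ 2) (a + r) / (qPoch (s ^ 2) (s ^ 2) a * qPoch (s ^ 2) (s ^ 2) r) = X₇
    at *
  generalize (1 - b₃ ^ 2 * b₂ ^ 2 * s ^ 2 * (s ^ 2) ^ (2 * a)) /
    qPoch (s ^ 2) (b₃ ^ 2 * b₂ ^ 2 * s ^ 2 * (s ^ 2) ^ a) (a + r + 1) = X₈ at *
  generalize qPoch (s ^ 2) (b₃ ^ 2 * b₂ ^ 2 * s ^ 2 * (s ^ 2 * b₄ ^ 2) * (s ^ 2) ^ (a + r)) a = X₉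
    at *
  generalize qPoch (s ^ 2) (s ^ 2 * b₄ ^ 2) r = X₁₀ at *
  have hpow' : (s * b₀) ^ (y + r) * t ^ a / z = (s * b₀) ^ y * (s ^ 2 * b₀ * b₃) ^ (a + r) * c ^ a := by
    rw [hpow, mul_div_cancel_right₀ _ n3]
  have e1 : X₁ * X₁⁻¹ = 1 := mul_inv_cancel₀ n1
  have e2 : X₂ * X₂⁻¹ = 1 := mul_inv_cancel₀ n2
  rw [div_eq_mul_inv _ z] at hpow'
  simp only [div_eq_mul_inv, mul_inv]
  linear_combination (X₃ * X₄ * X₅⁻¹ * X₆⁻¹ * X₇ * X₈ * X₉ * X₁₀ * X₂ * X₂⁻¹ * X₁ * X₁⁻¹) * hpow' +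
    ((s * b₀) ^ y * (s ^ 2 * b₀ * b₃) ^ (a + r) * c ^ a) * (X₃ * X₄ * X₅⁻¹ * X₆⁻¹ * X₇ * X₈ * X₉ * X₁₀) *
      (X₂ * X₂⁻¹ * e1 + e2)

theorem pentagonAt_base {s b₀ b₁ b₂ b₃ b₄ : ℂ} {N : ℕ}
    (h : GenericQuintuple s N b₀ b₁ b₂ b₃ b₄) (y : ℕ) :
    PentagonAt s b₀ b₁ b₂ b₃ b₄ N 0 0 0 y := by
  rcases lt_or_ge N y with hy | hy
  · exact pentagonAt_of_lt_right s _ _ _ _ _ _ _ (by omega)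
  obtain ⟨m, rfl⟩ : ∃ m, N = y + m := Nat.exists_eq_add_of_le hy
  have hs := h.s_ne
  have hq := h.q_ne
  have hb0 := h.b₀_ne
  have hb1 := h.b₁_ne
  have hb2 := h.b₂_ne
  have hb3 := h.b₃_ne
  have hb4 := h.b₄_ne
  have tP : GenericTriple s b₃ b₂ b₁ := h.reflect.rotate.triple
  have tG : GenericTriple s b₃ b₄ b₀ := h.rotate.rotate.rotate.triple
  have hA : Avoids (s ^ 2) (b₃ ^ 2 * b₂ ^ 2 * s ^ 2) := tP.a₁₂.mul_self hq
  have hug : Avoids (s ^ 2) (s ^ 2 * b₄ ^ 2 * (b₀ ^ 2 * (s ^ 2) ^ (y + 1))) := by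
    have := (h.a₄₀.mul_pow hq (y + 1)).self_mul hq
    rwa [show s ^ 2 * (b₄ ^ 2 * b₀ ^ 2 * (s ^ 2) ^ (y + 1)) =
      s ^ 2 * b₄ ^ 2 * (b₀ ^ 2 * (s ^ 2) ^ (y + 1)) by ring] at this
  -- The balancing condition of the `₆φ₅` sum is the squared constraint.
  have hbal : b₃ ^ 2 * b₂ ^ 2 * s ^ 2 * (s ^ 2 * b₄ ^ 2) * (b₀ ^ 2 * (s ^ 2) ^ (y + 1)) *
      (s ^ 2 * b₁ ^ 2 * (s ^ 2) ^ y) * (s ^ 2) ^ (2 * m) = s ^ 2 := by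
    linear_combination s ^ 2 * h.prod_sq_eq
  have hsum := sum_wpTerm hq h.root m hbal hA hug
  have hconv : convolution s b₀ b₁ b₂ b₃ b₄ (y + m) 0 0 0 y =
      qRacah s 0 0 b₃ b₂ b₁ (y + m) *
      (qPoch (s ^ 2) (s ^ 2 * b₁ ^ 2) y * (s * b₀) ^ y * (s ^ 2 * b₀ * b₃) ^ m /
        qPoch (s ^ 2) (b₀ ^ 2 * b₄ ^ 2 * (s ^ 2) ^ 2) y *
      ∑ a ∈ Finset.range (m + 1), wpTerm (s ^ 2) (b₃ ^ 2 * b₂ ^ 2 * s ^ 2) (s ^ 2 * b₄ ^ 2)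
        (s ^ 2 * b₁ ^ 2 * (s ^ 2) ^ y) (s ^ 2 * b₄ ^ 2 * (b₀ ^ 2 * (s ^ 2) ^ (y + 1))) m a) := by
    rw [Finset.mul_sum, Finset.mul_sum, convolution, Nat.sub_zero, Nat.add_sub_cancel_left]
    have hsub : Finset.range (m + 1) ⊆ Finset.range (y + m + 1) :=
      Finset.range_subset_range.2 (by omega)
    rw [← Finset.sum_subset hsub]
    · refine Finset.sum_congr rfl fun a ha => ?_
      have ha : a ≤ m := Nat.lt_succ_iff.1 (Finset.mem_range.1 ha)
      rw [qRacah_zero_left_eq tP (show a ≤ y + m by omega), ← base_term_eq h ha]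
      ring
    · intro a _ ha
      have ha : m < a := by simpa using ha
      rw [qRacah_of_lt_left s ha]
      ring
  rw [PentagonAt, hconv, hsum, weight_zero, weight_zero, weight_zero, Nat.sub_zero, weight,
    qRacah_zero_left tP (Nat.zero_le _), qRacah_zero_left tG (Nat.zero_le _),
    qRacah_zero_left h.triple (Nat.le_add_right y m)]
  have n1 := (h.a₁.self_mul hq).qPoch_ne y
  have e1 : s * b₂ * (s * b₀) * (b₄ * b₁ / (b₂ * b₀)) = s * b₄ * (s * b₁) := by field_simp
  have e2 : s * b₂ * (s ^ 2 * b₀ * b₃) *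
      (s ^ 2 * b₄ ^ 2 * (s ^ 2 * b₁ ^ 2 * (s ^ 2) ^ y) * (s ^ 2) ^ m / s ^ 2) =
      s * b₄ * (s * b₁) := by
    have e : s ^ 2 * b₄ ^ 2 * (s ^ 2 * b₁ ^ 2 * (s ^ 2) ^ y) * (s ^ 2) ^ m / s ^ 2 =
      b₄ ^ 2 * b₁ ^ 2 * (s ^ 2) ^ (y + m + 1) := by field_simp; ring
    rw [e]
    linear_combination s ^ 2 * b₄ * b₁ * h.prod_eq
  -- The powers agree block by block: `e1` accounts for exponent `y`, and `e2`, which uses the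
  -- constraint, for exponent `m`.
  have hpow : (s * b₂) ^ (y + m) * (s * b₀) ^ y * (s ^ 2 * b₀ * b₃) ^ m *
      (s ^ 2 * b₄ ^ 2 * (s ^ 2 * b₁ ^ 2 * (s ^ 2) ^ y) * (s ^ 2) ^ m / s ^ 2) ^ m *
      (b₄ * b₁ / (b₂ * b₀)) ^ y = (s * b₄) ^ (y + m) * (s * b₁) ^ (y + m) := by
    have e : (s * b₄) ^ (y + m) * (s * b₁) ^ (y + m) = (s * b₄ * (s * b₁)) ^ y *
        (s * b₄ * (s * b₁)) ^ m := by rw [← mul_pow, pow_add]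
    rw [e]
    nth_rewrite 1 [← e1]
    rw [← e2]
    generalize s ^ 2 * b₄ ^ 2 * (s ^ 2 * b₁ ^ 2 * (s ^ 2) ^ y) * (s ^ 2) ^ m / s ^ 2 = c
    generalize b₄ * b₁ / (b₂ * b₀) = t
    ring
  rw [mul_comm (b₄ ^ 2), qPoch_add _ (b₀ ^ 2 * b₄ ^ 2 * (s ^ 2) ^ 2), qPoch_add _ (s ^ 2 * b₀ ^ 2),
    show s ^ 2 * b₄ ^ 2 * (b₀ ^ 2 * (s ^ 2) ^ (y + 1)) =
      b₀ ^ 2 * b₄ ^ 2 * (s ^ 2) ^ 2 * (s ^ 2) ^ y by ring,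
    show b₀ ^ 2 * (s ^ 2) ^ (y + 1) = s ^ 2 * b₀ ^ 2 * (s ^ 2) ^ y by ring, mul_comm (b₁ ^ 2) (b₂ ^ 2)]
  generalize s ^ 2 * b₄ ^ 2 * (s ^ 2 * b₁ ^ 2 * (s ^ 2) ^ y) * (s ^ 2) ^ m / s ^ 2 = c at *
  generalize b₄ * b₁ / (b₂ * b₀) = t at *
  generalize qPoch (s ^ 2) (s ^ 2 * b₁ ^ 2) y = X₁ at *
  have e3 : X₁ * X₁⁻¹ = 1 := mul_inv_cancel₀ n1
  simp only [div_eq_mul_inv, mul_inv]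
  generalize qPoch (s ^ 2) (s ^ 2 * b₃ ^ 2) (y + m) = X₂
  generalize (qPoch (s ^ 2) (b₂ ^ 2 * b₁ ^ 2 * (s ^ 2) ^ 2) (y + m))⁻¹ = X₃
  generalize (qPoch (s ^ 2) (b₀ ^ 2 * b₄ ^ 2 * (s ^ 2) ^ 2) y)⁻¹ = X₄
  generalize (qPoch (s ^ 2) (b₀ ^ 2 * b₄ ^ 2 * (s ^ 2) ^ 2 * (s ^ 2) ^ y) m)⁻¹ = X₅
  generalize qPoch (s ^ 2) (s ^ 2 * b₀ ^ 2) y = X₆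
  generalize qPoch (s ^ 2) (s ^ 2 * b₀ ^ 2 * (s ^ 2) ^ y) m = X₇
  linear_combination X₂ * X₃ * X₄ * X₅ * X₆ * X₇ * (X₁ * X₁⁻¹ * hpow +
    (s * b₄) ^ (y + m) * (s * b₁) ^ (y + m) * e3)

/-! ### The induction, and the identity for generic parameters. -/

theorem pentagonAt {s : ℂ} (N : ℕ) : ∀ {b₀ b₁ b₂ b₃ b₄ : ℂ}
    (_ : GenericQuintuple s N b₀ b₁ b₂ b₃ b₄) (i j x y : ℕ),
    PentagonAt s b₀ b₁ b₂ b₃ b₄ N i j x y := by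
  induction N with
  | zero =>
    intro b₀ b₁ b₂ b₃ b₄ h i j x y
    rcases Nat.eq_zero_or_pos (i + j) with hij | hij
    · rcases Nat.eq_zero_or_pos (x + y) with hxy | hxy
      · obtain ⟨rfl, rfl⟩ := Nat.add_eq_zero_iff.1 hij
        obtain ⟨rfl, rfl⟩ := Nat.add_eq_zero_iff.1 hxy
        exact pentagonAt_base h 0
      · exact pentagonAt_of_lt_right s _ _ _ _ _ _ _ hxy
    · exact pentagonAt_of_lt_left s _ _ _ _ _ _ _ hij
  | succ N ih =>
    intro b₀ b₁ b₂ b₃ b₄ h i j x y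
    rcases j with _ | j
    · rcases x with _ | x
      · rcases i with _ | i
        · exact pentagonAt_base h y
        · exact PentagonAt.succ_zero_zero h (fun y => ih h.shift₁₂ i 0 0 y) y
      · exact PentagonAt.zero_succ h (ih h.shift₃₄ i 0 x y)
    · rcases lt_or_ge N i with hi | hi
      · exact pentagonAt_of_lt_left s _ _ _ _ _ _ _ (by omega)
      · exact PentagonAt.succ h hi (fun x y => ih h.shift₄₀ i j x y) x y

/-- The left-hand side of the pentagon identity. -/
noncomputable def pentagonSum (s b₀ b₁ b₂ b₃ b₄ : ℂ) (N i j x y : ℕ) : ℂ :=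
  ∑ a ∈ Finset.range (min (N - j) (N - y) + 1),
    qRacah s i a b₃ b₂ b₁ (N - j) * qRacah s j y b₁ b₀ b₄ (N - a) *
      qRacah s a x b₄ b₃ b₂ (N - y) *
      ((b₀ / b₃) ^ i * (b₃ / b₁) ^ j * (b₁ / b₄) ^ a * (b₄ / b₂) ^ y * (b₂ / b₀) ^ x) *
      (xi s i b₁ b₂ * xi s j b₄ b₀ * xi s a b₂ b₃ * xi s y b₀ b₁ * xi s x b₃ b₄)

theorem weight_eq_xi_mul (s : ℂ) (n : ℕ) (b₁ b₂ : ℂ) {t u : ℂ} (ht : t = b₂ / b₁ * u) :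
    weight s n b₁ b₂ t = xi s n b₁ b₂ * u ^ n := by
  rw [weight, xi, ht, mul_pow _ u, mul_assoc]

theorem pentagonSum_eq {s b₀ b₁ b₂ b₃ b₄ : ℂ} {N : ℕ}
    (h : GenericQuintuple s N b₀ b₁ b₂ b₃ b₄) (i j x y : ℕ) :
    pentagonSum s b₀ b₁ b₂ b₃ b₄ N i j x y =
      qRacah s j x b₃ b₄ b₀ (N - i) * qRacah s i y b₀ b₁ b₂ (N - x) := by
  rw [← pentagonAt N h i j x y, convolution, Finset.sum_mul, pentagonSum]
  -- The longer range used in the induction adds only zeros: `a` is the variable of the first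
  -- factor, of size `N - j`, and the degree of the third, of size `N - y`.
  have hsub : Finset.range (min (N - j) (N - y) + 1) ⊆ Finset.range (N + 1) :=
    Finset.range_subset_range.2 (by omega)
  rw [← Finset.sum_subset hsub]
  · refine Finset.sum_congr rfl fun a _ => ?_
    rw [weight_eq_xi_mul s i b₁ b₂ (u := b₀ / b₃) (by ring),
      weight_eq_xi_mul s j b₄ b₀ (u := b₃ / b₁) (by ring),
      weight_eq_xi_mul s a b₂ b₃ (u := b₁ / b₄) (by ring),
      weight_eq_xi_mul s y b₀ b₁ (u := b₄ / b₂) (by ring),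
      weight_eq_xi_mul s x b₃ b₄ (u := b₂ / b₀) (by ring)]
    ring
  · intro a _ ha
    have ha : min (N - j) (N - y) < a :=
      Nat.lt_of_succ_le (not_lt.1 fun h => ha (Finset.mem_range.2 h))
    rcases min_lt_iff.1 ha with ha | ha
    · simp [qRacah_of_lt_right s ha]
    · simp [qRacah_of_lt_left s ha]

/-! ### Continuity of both sides. -/

open Filter Topology

section Continuity

variable {X : Type*} [TopologicalSpace X] {p : X}

theorem continuousAt_qPoch {Q A : X → ℂ} (hQ : ContinuousAt Q p) (hA : ContinuousAt A p) (n : ℕ) :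
    ContinuousAt (fun t => qPoch (Q t) (A t) n) p := by
  unfold qPoch
  exact tendsto_finsetProd _ fun l _ => (continuousAt_const.sub (hA.mul (hQ.pow l)))

theorem qPoch_ne_zero {q a : ℂ} {n : ℕ} (h : ∀ l < n, 1 - a * q ^ l ≠ 0) : qPoch q a n ≠ 0 :=
  Finset.prod_ne_zero_iff.2 fun l hl => h l (Finset.mem_range.1 hl)

theorem continuousAt_phi43 {Q A₂ A₃ A₄ D₁ D₂ D₃ : X → ℂ} (hQ : ContinuousAt Q p)
    (h₂ : ContinuousAt A₂ p) (h₃ : ContinuousAt A₃ p) (h₄ : ContinuousAt A₄ p)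
    (k₁ : ContinuousAt D₁ p) (k₂ : ContinuousAt D₂ p) (k₃ : ContinuousAt D₃ p) {n : ℕ}
    (hq : Q p ≠ 0) (hr : ∀ k ≤ n, qPoch (Q p) (Q p) k ≠ 0)
    (n₁ : ∀ k ≤ n, qPoch (Q p) (D₁ p) k ≠ 0) (n₂ : ∀ k ≤ n, qPoch (Q p) (D₂ p) k ≠ 0)
    (n₃ : ∀ k ≤ n, qPoch (Q p) (D₃ p) k ≠ 0) :
    ContinuousAt (fun t => phi43 (Q t) n (A₂ t) (A₃ t) (A₄ t) (D₁ t) (D₂ t) (D₃ t)) p := by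
  unfold phi43
  refine tendsto_finsetSum _ fun k hk => ?_
  have hk : k ≤ n := Nat.lt_succ_iff.1 (Finset.mem_range.1 hk)
  exact ((((continuousAt_qPoch hQ (hQ.zpow₀ _ (Or.inl hq)) k).mul (continuousAt_qPoch hQ h₂ k)).mul
    (continuousAt_qPoch hQ h₃ k)).mul (continuousAt_qPoch hQ h₄ k)).div
    (((continuousAt_qPoch hQ k₁ k).mul (continuousAt_qPoch hQ k₂ k)).mul
      (continuousAt_qPoch hQ k₃ k)) (mul_ne_zero (mul_ne_zero (n₁ k hk) (n₂ k hk)) (n₃ k hk))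
    |>.mul ((hQ.pow k).div (continuousAt_qPoch hQ hQ k) (hr k hk))

/-- The hypotheses cover the denominators that occur for `n, x ≤ M`; otherwise the function is
constantly zero. -/
theorem continuousAt_qRacah {S B₁ B₂ B₃ : X → ℂ} (hS : ContinuousAt S p) (h₁ : ContinuousAt B₁ p)
    (h₂ : ContinuousAt B₂ p) (h₃ : ContinuousAt B₃ p) {M : ℕ} (hs : S p ≠ 0) (hb₂ : B₂ p ≠ 0)
    (hr : ∀ m, 1 ≤ m → m ≤ M → 1 - (S p ^ 2) ^ m ≠ 0)
    (n₂ : ∀ m, 1 ≤ m → m ≤ M → 1 - B₂ p ^ 2 * (S p ^ 2) ^ m ≠ 0)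
    (n₃ : ∀ m, 1 ≤ m → m ≤ M → 1 - B₃ p ^ 2 * (S p ^ 2) ^ m ≠ 0)
    (n₂₃ : ∀ m, 2 ≤ m → m ≤ 2 * M → 1 - B₂ p ^ 2 * B₃ p ^ 2 * (S p ^ 2) ^ m ≠ 0)
    (n₁₂₃ : ∀ m, 3 ≤ m → m ≤ 2 * M + 1 →
      1 - B₁ p ^ 2 * B₂ p ^ 2 * B₃ p ^ 2 * (S p ^ 2) ^ m ≠ 0) (n x : ℕ) :
    ContinuousAt (fun t => qRacah (S t) n x (B₁ t) (B₂ t) (B₃ t) M) p := by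
  unfold qRacah
  split_ifs with hnx
  swap
  · exact continuousAt_const
  obtain ⟨hn, hx⟩ := hnx
  have hq : S p ^ 2 ≠ 0 := pow_ne_zero 2 hs
  have hQ : ContinuousAt (fun t => S t ^ 2) p := hS.pow 2
  have hroot : ∀ k ≤ M, qPoch (S p ^ 2) (S p ^ 2) k ≠ 0 := fun k hk =>
    qPoch_ne_zero fun l hl => by
      rw [← pow_succ']
      exact hr _ (by omega) (by omega)
  have hc : ∀ b : ℂ, (∀ m, 1 ≤ m → m ≤ M → 1 - b ^ 2 * (S p ^ 2) ^ m ≠ 0) →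
      ∀ k ≤ M, qPoch (S p ^ 2) (S p ^ 2 * b ^ 2) k ≠ 0 := fun b hb k hk =>
    qPoch_ne_zero fun l hl => by
      rw [show S p ^ 2 * b ^ 2 * (S p ^ 2) ^ l = b ^ 2 * (S p ^ 2) ^ (l + 1) by ring]
      exact hb _ (by omega) (by omega)
  refine ContinuousAt.mul ?_ ?_
  · unfold Omega
    refine ContinuousAt.div (ContinuousAt.mul (ContinuousAt.mul ?_ ?_) ?_) (ContinuousAt.mul ?_ ?_)
      (mul_ne_zero (zpow_ne_zero _ (mul_ne_zero hs hb₂)) (hc _ n₃ n hn))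
    · unfold qBinom
      simp only [if_pos hn]
      exact (continuousAt_qPoch hQ hQ M).div
        ((continuousAt_qPoch hQ hQ n).mul (continuousAt_qPoch hQ hQ (M - n)))
        (mul_ne_zero (hroot n hn) (hroot _ (Nat.sub_le M n)))
    · unfold cancelledRatio
      refine ContinuousAt.inv₀ (tendsto_finsetProd _ fun l _ => continuousAt_const.sub
        (((h₂.pow 2).mul (h₃.pow 2)).mul (hQ.pow _))) (Finset.prod_ne_zero_iff.2 fun l hl => ?_)
      -- Erasing the index `l = n` keeps the exponent `n + 1 + l` between `2` and `2M`: the values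
      -- `1` and `2M + 1` would require `l = n = 0` and `l = n = M`.
      rw [Finset.mem_erase, Finset.mem_range] at hl
      exact n₂₃ _ (by omega) (by omega)
    · exact ((continuousAt_qPoch hQ (hQ.mul (h₂.pow 2)) n).mul (continuousAt_qPoch hQ
        ((((h₁.pow 2).mul (h₂.pow 2)).mul (h₃.pow 2)).mul (hQ.pow _)) n)).mul
        (continuousAt_qPoch hQ (hQ.mul (h₁.pow 2)) (M - n))
    · exact (hS.mul h₂).zpow₀ _ (Or.inl (mul_ne_zero hs hb₂))
    · exact continuousAt_qPoch hQ (hQ.mul (h₃.pow 2)) n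
  · refine continuousAt_phi43 hQ (((h₂.pow 2).mul (h₃.pow 2)).mul (hQ.pow _))
      (hQ.zpow₀ _ (Or.inl hq)) (((h₁.pow 2).mul (h₂.pow 2)).mul (hQ.pow _))
      (hQ.mul (h₂.pow 2)) ((((h₁.pow 2).mul (h₂.pow 2)).mul (h₃.pow 2)).mul (hQ.pow _))
      (hQ.zpow₀ _ (Or.inl hq)) hq (fun k hk => hroot k (hk.trans hn))
      (fun k hk => hc _ n₂ k (hk.trans hn)) (fun k hk => qPoch_ne_zero fun l hl => ?_)
      (fun k hk => qPoch_ne_zero fun l hl hz => ?_)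
    · simp only [Pi.mul_apply, Pi.pow_apply]
      rw [mul_assoc _ ((S p ^ 2) ^ (M + 2)), ← pow_add]
      exact n₁₂₃ _ (by omega) (by omega)
    · refine hr (M - l) (by omega) (by omega) ?_
      have e : (S p ^ 2) ^ M = (S p ^ 2) ^ (M - l) * (S p ^ 2) ^ l := by
        rw [← pow_add, Nat.sub_add_cancel (by omega)]
      rw [zpow_neg, zpow_natCast, e] at hz
      have h1 := pow_ne_zero l hq
      have h2 := pow_ne_zero (M - l) hq
      field_simp at hz
      linear_combination -hz

theorem continuousAt_xi {S B₁ B₂ : X → ℂ} (hS : ContinuousAt S p) (h₁ : ContinuousAt B₁ p)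
    (h₂ : ContinuousAt B₂ p) {n : ℕ} (hb₁ : B₁ p ≠ 0)
    (n₂ : ∀ m, 1 ≤ m → m ≤ n → 1 - B₂ p ^ 2 * (S p ^ 2) ^ m ≠ 0) :
    ContinuousAt (fun t => xi (S t) n (B₁ t) (B₂ t)) p := by
  unfold xi
  have hQ : ContinuousAt (fun t => S t ^ 2) p := hS.pow 2
  refine ((continuousAt_qPoch hQ (hQ.mul (h₁.pow 2)) n).div
    (continuousAt_qPoch hQ (hQ.mul (h₂.pow 2)) n) (qPoch_ne_zero fun l hl => ?_)).mul
    ((h₂.div h₁ hb₁).pow n)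
  simp only [Pi.mul_apply, Pi.pow_apply]
  rw [show S p ^ 2 * B₂ p ^ 2 * (S p ^ 2) ^ l = B₂ p ^ 2 * (S p ^ 2) ^ (l + 1) by ring]
  exact n₂ _ (by omega) (by omega)

end Continuity

/-! ### A deformation through generic parameters. -/

/-- The real exponential is injective, so there is at most one such `t`. -/
theorem countable_setOf_one_sub_mul_exp_eq_zero (c : ℂ) {r : ℝ} (hr : r ≠ 0) :
    {t : ℝ | 1 - c * Complex.exp ((r * t : ℝ) : ℂ) = 0}.Countable := by
  refine Set.Subsingleton.countable fun t ht u hu => ?_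
  simp only [Set.mem_ofPred_eq, sub_eq_zero] at ht hu
  have hc : c ≠ 0 := by
    rintro rfl
    simp at ht
  have h := mul_left_cancel₀ hc (ht.symm.trans hu)
  rw [← Complex.ofReal_exp, ← Complex.ofReal_exp, Complex.ofReal_inj, Real.exp_eq_exp] at h
  exact mul_left_cancel₀ hr h

/-- For each integer `m` the forbidden equation has exponential rate `2(r + m) ≠ 0`, hence at most
one solution; there are countably many `m`. -/
theorem countable_setOf_not_avoids {s b : ℂ} {r : ℝ} (hr : ∀ m : ℤ, r + m ≠ 0) :
    {t : ℝ | ¬ Avoids ((s * Complex.exp (t : ℂ)) ^ 2)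
      (b * Complex.exp ((2 * r * t : ℝ) : ℂ))}.Countable := by
  have hsub : {t : ℝ | ¬ Avoids ((s * Complex.exp (t : ℂ)) ^ 2)
      (b * Complex.exp ((2 * r * t : ℝ) : ℂ))} ⊆ ⋃ m : ℤ,
      {t : ℝ | 1 - b * (s ^ 2) ^ m * Complex.exp ((2 * (r + m) * t : ℝ) : ℂ) = 0} := by
    intro t ht
    simp only [Avoids, Set.mem_ofPred_eq, not_forall, not_not] at ht
    obtain ⟨m, hm⟩ := ht
    refine Set.mem_iUnion.2 ⟨m, ?_⟩
    rw [Set.mem_ofPred_eq, ← hm, mul_pow, mul_zpow, ← Complex.exp_nat_mul, ← Complex.exp_int_mul,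
      show ((2 * (r + m) * t : ℝ) : ℂ) = ((2 * r * t : ℝ) : ℂ) + m * ((2 : ℕ) * (t : ℂ)) by
        push_cast; ring, Complex.exp_add]
    ring
  exact (Set.countable_iUnion fun m =>
    countable_setOf_one_sub_mul_exp_eq_zero _ (mul_ne_zero two_ne_zero (hr m))).mono hsub

/-- Almost every member of a suitable one-parameter deformation is generic. -/
theorem countable_setOf_not_genericQuintuple {s b₀ b₁ b₂ b₃ b₄ : ℂ} {N : ℕ}
    (h : s ^ (2 * N + 3) * b₀ * b₁ * b₂ * b₃ * b₄ = 1) {r₀ r₁ r₂ r₃ r₄ : ℝ}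
    (hr : (2 * N + 3) + r₀ + r₁ + r₂ + r₃ + r₄ = 0)
    (h₀ : ∀ m : ℤ, r₀ + m ≠ 0) (h₁ : ∀ m : ℤ, r₁ + m ≠ 0) (h₂ : ∀ m : ℤ, r₂ + m ≠ 0)
    (h₃ : ∀ m : ℤ, r₃ + m ≠ 0) (h₄ : ∀ m : ℤ, r₄ + m ≠ 0) (h₀₁ : ∀ m : ℤ, r₀ + r₁ + m ≠ 0)
    (h₁₂ : ∀ m : ℤ, r₁ + r₂ + m ≠ 0) (h₂₃ : ∀ m : ℤ, r₂ + r₃ + m ≠ 0)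
    (h₃₄ : ∀ m : ℤ, r₃ + r₄ + m ≠ 0) (h₄₀ : ∀ m : ℤ, r₄ + r₀ + m ≠ 0) :
    {t : ℝ | ¬ GenericQuintuple (s * Complex.exp (t : ℂ)) N (b₀ * Complex.exp ((r₀ * t : ℝ) : ℂ))
      (b₁ * Complex.exp ((r₁ * t : ℝ) : ℂ)) (b₂ * Complex.exp ((r₂ * t : ℝ) : ℂ))
      (b₃ * Complex.exp ((r₃ * t : ℝ) : ℂ)) (b₄ * Complex.exp ((r₄ * t : ℝ) : ℂ))}.Countable := by
  have hroot : (⋃ m : ℕ, {t : ℝ | 1 - (s ^ 2) ^ (m + 1) *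
      Complex.exp ((2 * (m + 1) * t : ℝ) : ℂ) = 0}).Countable :=
    Set.countable_iUnion fun m => countable_setOf_one_sub_mul_exp_eq_zero _ (by positivity)
  have hone : ∀ (b : ℂ) (r t : ℝ), (b * Complex.exp ((r * t : ℝ) : ℂ)) ^ 2 =
      b ^ 2 * Complex.exp ((2 * r * t : ℝ) : ℂ) := by
    intro b r t
    rw [mul_pow, ← Complex.exp_nat_mul]
    congr 2
    push_cast
    ring
  have htwo : ∀ (b b' : ℂ) (r r' t : ℝ), (b * Complex.exp ((r * t : ℝ) : ℂ)) ^ 2 *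
      (b' * Complex.exp ((r' * t : ℝ) : ℂ)) ^ 2 =
      b ^ 2 * b' ^ 2 * Complex.exp ((2 * (r + r') * t : ℝ) : ℂ) := by
    intro b b' r r' t
    rw [hone, hone, mul_mul_mul_comm, ← Complex.exp_add]
    congr 2
    push_cast
    ring
  refine ((((((((((hroot.union (countable_setOf_not_avoids (s := s) (b := b₀ ^ 2) h₀)).union
    (countable_setOf_not_avoids (s := s) (b := b₁ ^ 2) h₁)).union
    (countable_setOf_not_avoids (s := s) (b := b₂ ^ 2) h₂)).union
    (countable_setOf_not_avoids (s := s) (b := b₃ ^ 2) h₃)).union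
    (countable_setOf_not_avoids (s := s) (b := b₄ ^ 2) h₄)).union
    (countable_setOf_not_avoids (s := s) (b := b₀ ^ 2 * b₁ ^ 2) h₀₁)).union
    (countable_setOf_not_avoids (s := s) (b := b₁ ^ 2 * b₂ ^ 2) h₁₂)).union
    (countable_setOf_not_avoids (s := s) (b := b₂ ^ 2 * b₃ ^ 2) h₂₃)).union
    (countable_setOf_not_avoids (s := s) (b := b₃ ^ 2 * b₄ ^ 2) h₃₄)).union
    (countable_setOf_not_avoids (s := s) (b := b₄ ^ 2 * b₀ ^ 2) h₄₀)).mono fun t ht => ?_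
  by_contra hg
  simp only [Set.mem_union, Set.mem_ofPred_eq, not_or, not_not, Set.mem_iUnion, not_exists] at hg
  obtain ⟨⟨⟨⟨⟨⟨⟨⟨⟨⟨g, g₀⟩, g₁⟩, g₂⟩, g₃⟩, g₄⟩, g₀₁⟩, g₁₂⟩, g₂₃⟩, g₃₄⟩, g₄₀⟩ := hg
  refine ht ⟨?_, fun m => ?_, ?_, ?_, ?_, ?_, ?_, ?_, ?_, ?_, ?_, ?_⟩
  · have e : Complex.exp (t : ℂ) ^ (2 * N + 3) * Complex.exp ((r₀ * t : ℝ) : ℂ) *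
        Complex.exp ((r₁ * t : ℝ) : ℂ) * Complex.exp ((r₂ * t : ℝ) : ℂ) *
        Complex.exp ((r₃ * t : ℝ) : ℂ) * Complex.exp ((r₄ * t : ℝ) : ℂ) = 1 := by
      rw [← Complex.exp_nat_mul, ← Complex.exp_add, ← Complex.exp_add, ← Complex.exp_add,
        ← Complex.exp_add, ← Complex.exp_add, Complex.exp_eq_one_iff]
      refine ⟨0, ?_⟩
      have : ((2 * N + 3 + r₀ + r₁ + r₂ + r₃ + r₄ : ℝ) : ℂ) = 0 := by rw [hr]; simp
      push_cast at this ⊢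
      linear_combination (t : ℂ) * this
    rw [mul_pow]
    linear_combination e + (Complex.exp (t : ℂ) ^ (2 * N + 3) * Complex.exp ((r₀ * t : ℝ) : ℂ) *
        Complex.exp ((r₁ * t : ℝ) : ℂ) * Complex.exp ((r₂ * t : ℝ) : ℂ) *
        Complex.exp ((r₃ * t : ℝ) : ℂ) * Complex.exp ((r₄ * t : ℝ) : ℂ)) * h
  · have e : ((s * Complex.exp (t : ℂ)) ^ 2) ^ (m + 1) = (s ^ 2) ^ (m + 1) *
        Complex.exp ((2 * (m + 1) * t : ℝ) : ℂ) := by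
      rw [mul_pow, mul_pow, ← Complex.exp_nat_mul, ← Complex.exp_nat_mul]
      congr 2
      push_cast
      ring
    rw [e]
    exact g m
  · rwa [hone]
  · rwa [hone]
  · rwa [hone]
  · rwa [hone]
  · rwa [hone]
  · rwa [htwo]
  · rwa [htwo]
  · rwa [htwo]
  · rwa [htwo]
  · rwa [htwo]

/-! ### Passage to admissible parameters. -/

/-- The genericity assumptions of the pentagon identity for parameters `c_k = b_k²`. -/
structure AdmissibleQuintuple (s : ℂ) (N : ℕ) (b₀ b₁ b₂ b₃ b₄ : ℂ) : Prop where
  prod_eq : s ^ (2 * N + 3) * b₀ * b₁ * b₂ * b₃ * b₄ = 1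
  root : ∀ m, 1 ≤ m → m ≤ N → 1 - (s ^ 2) ^ m ≠ 0
  a₀ : ∀ m, 1 ≤ m → m ≤ N → 1 - b₀ ^ 2 * (s ^ 2) ^ m ≠ 0
  a₁ : ∀ m, 1 ≤ m → m ≤ N → 1 - b₁ ^ 2 * (s ^ 2) ^ m ≠ 0
  a₂ : ∀ m, 1 ≤ m → m ≤ N → 1 - b₂ ^ 2 * (s ^ 2) ^ m ≠ 0
  a₃ : ∀ m, 1 ≤ m → m ≤ N → 1 - b₃ ^ 2 * (s ^ 2) ^ m ≠ 0
  a₄ : ∀ m, 1 ≤ m → m ≤ N → 1 - b₄ ^ 2 * (s ^ 2) ^ m ≠ 0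
  a₀₁ : ∀ m, 2 ≤ m → m ≤ 2 * N → 1 - b₀ ^ 2 * b₁ ^ 2 * (s ^ 2) ^ m ≠ 0
  a₁₂ : ∀ m, 2 ≤ m → m ≤ 2 * N → 1 - b₁ ^ 2 * b₂ ^ 2 * (s ^ 2) ^ m ≠ 0
  a₂₃ : ∀ m, 2 ≤ m → m ≤ 2 * N → 1 - b₂ ^ 2 * b₃ ^ 2 * (s ^ 2) ^ m ≠ 0
  a₃₄ : ∀ m, 2 ≤ m → m ≤ 2 * N → 1 - b₃ ^ 2 * b₄ ^ 2 * (s ^ 2) ^ m ≠ 0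
  a₄₀ : ∀ m, 2 ≤ m → m ≤ 2 * N → 1 - b₄ ^ 2 * b₀ ^ 2 * (s ^ 2) ^ m ≠ 0

namespace AdmissibleQuintuple

variable {s b₀ b₁ b₂ b₃ b₄ : ℂ} {N : ℕ}

theorem rotate (h : AdmissibleQuintuple s N b₀ b₁ b₂ b₃ b₄) :
    AdmissibleQuintuple s N b₁ b₂ b₃ b₄ b₀ where
  prod_eq := by linear_combination h.prod_eq
  root := h.root
  a₀ := h.a₁
  a₁ := h.a₂
  a₂ := h.a₃
  a₃ := h.a₄
  a₄ := h.a₀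
  a₀₁ := h.a₁₂
  a₁₂ := h.a₂₃
  a₂₃ := h.a₃₄
  a₃₄ := h.a₄₀
  a₄₀ := h.a₀₁

theorem reverse (h : AdmissibleQuintuple s N b₀ b₁ b₂ b₃ b₄) :
    AdmissibleQuintuple s N b₄ b₃ b₂ b₁ b₀ where
  prod_eq := by linear_combination h.prod_eq
  root := h.root
  a₀ := h.a₄
  a₁ := h.a₃
  a₂ := h.a₂
  a₃ := h.a₁
  a₄ := h.a₀
  a₀₁ m h₁ h₂ := by rw [mul_comm (b₄ ^ 2)]; exact h.a₃₄ m h₁ h₂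
  a₁₂ m h₁ h₂ := by rw [mul_comm (b₃ ^ 2)]; exact h.a₂₃ m h₁ h₂
  a₂₃ m h₁ h₂ := by rw [mul_comm (b₂ ^ 2)]; exact h.a₁₂ m h₁ h₂
  a₃₄ m h₁ h₂ := by rw [mul_comm (b₁ ^ 2)]; exact h.a₀₁ m h₁ h₂
  a₄₀ m h₁ h₂ := by rw [mul_comm (b₀ ^ 2)]; exact h.a₄₀ m h₁ h₂

theorem s_ne_zero (h : AdmissibleQuintuple s N b₀ b₁ b₂ b₃ b₄) : s ≠ 0 := by
  rintro rfl
  simpa using h.prod_eq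

theorem b₀_ne_zero (h : AdmissibleQuintuple s N b₀ b₁ b₂ b₃ b₄) : b₀ ≠ 0 := by
  rintro rfl
  simpa using h.prod_eq

/-- By the constraint, vanishing at exponent `m` forces `1 - c₃c₄q^{2N+3-m} = 0`, and `m ↦ 2N + 3 -
m` maps `[3, 2N + 1]` onto `[2, 2N]`. -/
theorem triple (h : AdmissibleQuintuple s N b₀ b₁ b₂ b₃ b₄) {m : ℕ} (h₁ : 3 ≤ m)
    (h₂ : m ≤ 2 * N + 1) : 1 - b₀ ^ 2 * b₁ ^ 2 * b₂ ^ 2 * (s ^ 2) ^ m ≠ 0 := by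
  intro hz
  refine h.a₃₄ (2 * N + 3 - m) (by omega) (by omega) ?_
  have e : (s ^ 2) ^ m * (s ^ 2) ^ (2 * N + 3 - m) = (s ^ (2 * N + 3)) ^ 2 := by
    rw [← pow_add, Nat.add_sub_cancel' (by omega), pow_right_comm]
  linear_combination -b₀ ^ 2 * b₁ ^ 2 * b₂ ^ 2 * b₃ ^ 2 * b₄ ^ 2 * e
    - (s ^ (2 * N + 3) * b₀ * b₁ * b₂ * b₃ * b₄ + 1) * h.prod_eq
    - b₃ ^ 2 * b₄ ^ 2 * (s ^ 2) ^ (2 * N + 3 - m) * hz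

section Continuity

variable {X : Type*} [TopologicalSpace X] {p : X} {S B₀ B₁ B₂ B₃ B₄ : X → ℂ}

theorem continuousAt_qRacah (h : AdmissibleQuintuple (S p) N (B₀ p) (B₁ p) (B₂ p) (B₃ p) (B₄ p))
    (hS : ContinuousAt S p) (h₀ : ContinuousAt B₀ p) (h₁ : ContinuousAt B₁ p)
    (h₂ : ContinuousAt B₂ p) {M : ℕ} (hM : M ≤ N) (n x : ℕ) :
    ContinuousAt (fun t => qRacah (S t) n x (B₀ t) (B₁ t) (B₂ t) M) p :=
  QRacah.continuousAt_qRacah hS h₀ h₁ h₂ h.s_ne_zero h.rotate.b₀_ne_zero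
    (fun m k₁ k₂ => h.root m k₁ (by omega)) (fun m k₁ k₂ => h.a₁ m k₁ (by omega))
    (fun m k₁ k₂ => h.a₂ m k₁ (by omega)) (fun m k₁ k₂ => h.a₁₂ m k₁ (by omega))
    (fun m k₁ k₂ => h.triple k₁ (by omega)) n x

theorem continuousAt_pentagonSum
    (h : AdmissibleQuintuple (S p) N (B₀ p) (B₁ p) (B₂ p) (B₃ p) (B₄ p))
    (hS : ContinuousAt S p) (h₀ : ContinuousAt B₀ p) (h₁ : ContinuousAt B₁ p)
    (h₂ : ContinuousAt B₂ p) (h₃ : ContinuousAt B₃ p) (h₄ : ContinuousAt B₄ p)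
    {i j x y : ℕ} (hij : i + j ≤ N) (hxy : x + y ≤ N) :
    ContinuousAt (fun t => pentagonSum (S t) (B₀ t) (B₁ t) (B₂ t) (B₃ t) (B₄ t) N i j x y) p := by
  have z₀ := h.b₀_ne_zero
  have z₁ := h.rotate.b₀_ne_zero
  have z₂ := h.rotate.rotate.b₀_ne_zero
  have z₃ := h.rotate.rotate.rotate.b₀_ne_zero
  have z₄ := h.reverse.b₀_ne_zero
  unfold pentagonSum
  refine tendsto_finsetSum _ fun a ha => ?_
  have ha : a ≤ N := by
    have := Finset.mem_range.1 ha
    omega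
  have f₁ := h.reverse.rotate.continuousAt_qRacah hS h₃ h₂ h₁ (M := N - j) (by omega) i a
  have f₂ := h.reverse.rotate.rotate.rotate.continuousAt_qRacah hS h₁ h₀ h₄ (M := N - a)
    (by omega) j y
  have f₃ := h.reverse.continuousAt_qRacah hS h₄ h₃ h₂ (M := N - y) (by omega) a x
  have g := (((((h₀.div h₃ z₃).pow i).mul ((h₃.div h₁ z₁).pow j)).mul
    ((h₁.div h₄ z₄).pow a)).mul ((h₄.div h₂ z₂).pow y)).mul ((h₂.div h₀ z₀).pow x)
  have k₁ := continuousAt_xi hS h₁ h₂ (n := i) z₁ fun m l₁ l₂ => h.a₂ m l₁ (by omega)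
  have k₂ := continuousAt_xi hS h₄ h₀ (n := j) z₄ fun m l₁ l₂ => h.a₀ m l₁ (by omega)
  have k₃ := continuousAt_xi hS h₂ h₃ (n := a) z₂ fun m l₁ l₂ => h.a₃ m l₁ (by omega)
  have k₄ := continuousAt_xi hS h₀ h₁ (n := y) z₀ fun m l₁ l₂ => h.a₁ m l₁ (by omega)
  have k₅ := continuousAt_xi hS h₃ h₄ (n := x) z₃ fun m l₁ l₂ => h.a₄ m l₁ (by omega)
  exact (((f₁.mul f₂).mul f₃).mul g).mul ((((k₁.mul k₂).mul k₃).mul k₄).mul k₅)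

end Continuity

theorem pentagonSum_eq (h : AdmissibleQuintuple s N b₀ b₁ b₂ b₃ b₄) {i j x y : ℕ}
    (hij : i + j ≤ N) (hxy : x + y ≤ N) :
    pentagonSum s b₀ b₁ b₂ b₃ b₄ N i j x y =
      qRacah s j x b₃ b₄ b₀ (N - i) * qRacah s i y b₀ b₁ b₂ (N - x) := by
  have hne : ∀ k : ℤ, ¬ (7 ∣ k) → ∀ (r : ℝ), 7 * r = k → ∀ m : ℤ, r + m ≠ 0 := by
    intro k hk r hr m hm
    have : ((k + 7 * m : ℤ) : ℝ) = 0 := by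
      push_cast
      linear_combination 7 * hm - hr
    rw [Int.cast_eq_zero] at this
    omega
  set r : ℝ := 1 / 7 with hr
  -- Four exponents `1/7` and one `r'` preserve the constraint. Modulo integers, the single
  -- exponents and the neighbouring sums are `1/7`, `-4/7`, `2/7`, `-3/7`, none of them integral.
  set r' : ℝ := -(2 * N + 3) - 4 / 7 with hr'
  have e₁ : ∀ m : ℤ, r + m ≠ 0 := hne 1 (by omega) r (by rw [hr]; norm_num)
  have e₂ : ∀ m : ℤ, r + r + m ≠ 0 := hne 2 (by omega) _ (by rw [hr]; norm_num)
  have e₃ : ∀ m : ℤ, r' + m ≠ 0 :=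
    hne (-7 * (2 * N + 3) - 4) (by omega) _ (by rw [hr']; push_cast; ring)
  have e₄ : ∀ m : ℤ, r' + r + m ≠ 0 :=
    hne (-7 * (2 * N + 3) - 3) (by omega) _ (by rw [hr, hr']; push_cast; ring)
  have e₅ : ∀ m : ℤ, r + r' + m ≠ 0 := by simpa only [add_comm r r'] using e₄
  have hbad := countable_setOf_not_genericQuintuple h.prod_eq (r₀ := r) (r₁ := r) (r₂ := r)
    (r₃ := r) (r₄ := r') (by rw [hr, hr']; ring) e₁ e₁ e₁ e₁ e₃ e₂ e₂ e₂ e₅ e₄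
  set S : ℝ → ℂ := fun t => s * Complex.exp (t : ℂ) with hS
  set D : ℂ → ℝ → ℝ → ℂ := fun b ρ t => b * Complex.exp ((ρ * t : ℝ) : ℂ) with hD
  have hSc : ContinuousAt S 0 := by
    refine Continuous.continuousAt ?_
    fun_prop
  have hDc : ∀ b ρ, ContinuousAt (D b ρ) 0 := fun b ρ => by
    refine Continuous.continuousAt ?_
    fun_prop
  have hS₀ : S 0 = s := by simp [hS]
  have hD₀ : ∀ b ρ, D b ρ 0 = b := fun b ρ => by simp [hD]
  have h0 : AdmissibleQuintuple (S 0) N (D b₀ r 0) (D b₁ r 0) (D b₂ r 0) (D b₃ r 0)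
      (D b₄ r' 0) := by simpa only [hS₀, hD₀] using h
  have hl := h0.continuousAt_pentagonSum hSc (hDc _ _) (hDc _ _) (hDc _ _) (hDc _ _) (hDc _ _)
    hij hxy
  have hr₁ := h0.rotate.rotate.rotate.continuousAt_qRacah hSc (hDc _ _) (hDc _ _) (hDc _ _)
    (Nat.sub_le N i) j x
  have hr₂ := h0.continuousAt_qRacah hSc (hDc _ _) (hDc _ _) (hDc _ _) (Nat.sub_le N x) i y
  -- The complement of a countable set is dense in `ℝ`, so `0` is a limit point of generic times;
  -- the two continuous functions agree there and hence have the same limit at `0`.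
  have key := @tendsto_nhds_unique_of_eventuallyEq _ _ _ _ _ _ _ _ _
    (mem_closure_iff_nhdsWithin_neBot.1 (hbad.dense_compl ℝ (0 : ℝ))) (hl.mono_left nhdsWithin_le_nhds)
    ((hr₁.mul hr₂).mono_left nhdsWithin_le_nhds) (eventually_nhdsWithin_of_forall fun t ht =>
      QRacah.pentagonSum_eq (not_not.1 ht) i j x y)
  simpa only [Pi.mul_apply, hS₀, hD₀] using key

end AdmissibleQuintuple

end QRacah

/-! ### The theorem in its original form. -/

theorem mainTheorem3 (N : ℕ) (q : ℂ) (c : Fin 5 → ℂ)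
    -- consistent square roots of `q` and of the `c k`
    (s : ℂ) (b : Fin 5 → ℂ) (hs : s ^ 2 = q) (hb : ∀ k, b k ^ 2 = c k)
    -- `q^{2N+3} c₀c₁c₂c₃c₄ = 1`, at the level of the square roots
    (hroot : s ^ (2 * N + 3) * b 0 * b 1 * b 2 * b 3 * b 4 = 1)
    -- genericity: `q, …, q^N ≠ 1`
    (hq : ∀ m ∈ Finset.Icc 1 N, q ^ m ≠ 1)
    -- `c₀c₁, c₁c₂, c₂c₃, c₃c₄, c₄c₀ ∉ {q⁻², …, q^{-2N}}` (indices modulo `5`)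
    (hcc : ∀ k, ∀ m ∈ Finset.Icc 2 (2 * N), c k * c (k + 1) ≠ q ^ (-(m : ℤ)))
    -- `c₀, …, c₄ ∉ {q⁻¹, …, q^{-N}}`
    (hc : ∀ k, ∀ m ∈ Finset.Icc 1 N, c k ≠ q ^ (-(m : ℤ)))
    (i j x y : ℕ) (hij : i + j ≤ N) (hxy : x + y ≤ N) :
    (∑ a ∈ Finset.range (min (N - j) (N - y) + 1),
        QRacah.qRacah s i a (b 3) (b 2) (b 1) (N - j) *
        QRacah.qRacah s j y (b 1) (b 0) (b 4) (N - a) *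
        QRacah.qRacah s a x (b 4) (b 3) (b 2) (N - y) *
        ((b 0 / b 3) ^ i * (b 3 / b 1) ^ j * (b 1 / b 4) ^ a * (b 4 / b 2) ^ y *
          (b 2 / b 0) ^ x) *
        (QRacah.xi s i (b 1) (b 2) * QRacah.xi s j (b 4) (b 0) * QRacah.xi s a (b 2) (b 3) *
          QRacah.xi s y (b 0) (b 1) * QRacah.xi s x (b 3) (b 4))
      = QRacah.qRacah s j x (b 3) (b 4) (b 0) (N - i) *
          QRacah.qRacah s i y (b 0) (b 1) (b 2) (N - x)) ∧
    QRacah.qRacah s j x (b 3) (b 4) (b 0) (N - i) *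
        QRacah.qRacah s i y (b 0) (b 1) (b 2) (N - x)
      = QRacah.tratnik s j i x y (b 3) (b 4) (b 0) (b 2) N := by
  subst hs
  have hq₀ : s ^ 2 ≠ 0 := by
    refine pow_ne_zero 2 ?_
    rintro rfl
    simp at hroot
  have avoid : ∀ {d : ℂ} {m : ℕ}, d ≠ (s ^ 2) ^ (-(m : ℤ)) → 1 - d * (s ^ 2) ^ m ≠ 0 := by
    intro d m hd hz
    refine hd ?_
    rw [zpow_neg, zpow_natCast]
    exact eq_inv_of_mul_eq_one_left (sub_eq_zero.1 hz).symm
  have one : ∀ k m, 1 ≤ m → m ≤ N → 1 - b k ^ 2 * (s ^ 2) ^ m ≠ 0 := fun k m h₁ h₂ =>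
    avoid (hb k ▸ hc k m (Finset.mem_Icc.2 ⟨h₁, h₂⟩))
  have two : ∀ k m, 2 ≤ m → m ≤ 2 * N →
      1 - b k ^ 2 * b (k + 1) ^ 2 * (s ^ 2) ^ m ≠ 0 := fun k m h₁ h₂ =>
    avoid (hb k ▸ hb (k + 1) ▸ hcc k m (Finset.mem_Icc.2 ⟨h₁, h₂⟩))
  have h : QRacah.AdmissibleQuintuple s N (b 0) (b 1) (b 2) (b 3) (b 4) :=
    { prod_eq := hroot
      root := fun m h₁ h₂ hz =>
        hq m (Finset.mem_Icc.2 ⟨h₁, h₂⟩) (sub_eq_zero.1 hz).symm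
      a₀ := one 0
      a₁ := one 1
      a₂ := one 2
      a₃ := one 3
      a₄ := one 4
      a₀₁ := two 0
      a₁₂ := two 1
      a₂₃ := two 2
      a₃₄ := two 3
      a₄₀ := two 4 }
  refine ⟨h.pentagonSum_eq hij hxy, ?_⟩
  -- For the Tratnik polynomial with parameters `c₃, c₄, c₀, c₂`, the parameter fixed by the
  -- constraint is `c₁`, with square root `b 1`.
  have e : (s ^ (2 * N + 3) * b 3 * b 4 * b 0 * b 2)⁻¹ = b 1 :=
    inv_eq_of_mul_eq_one_right (by linear_combination hroot)
  rw [QRacah.tratnik, e]
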